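/- Let $n_1,m,n_2,q$ be integers with $1<n_1<m$, $\gcd(m,n_1)=1$, $n_2>1$, $q>0$, $\gcd(q,n_2)=1$, and put $D:=mn_1n_2+q$. A polynomial $f\in\mathbb{R}[x,y]$ is said to be of type $(n_1n_2,mn_2,mn_2+q)^-$ if $f=g^{n_2}+x^ay^b+h_2$ with $g=x^{n_1}-y^m+h_1$, $h_1,h_2\in\mathbb{R}[x,y]$ and integers $a,b\ge 0$, such that the following holds. (H1) Every monomial $x^iy^j$ of $h_1$ satisfies $mi+n_1j>mn_1$. (H2) $am+bn_1=D$. (H3) There is a real polynomial $w(t)=t+a_1t^2+\dots+a_kt^{k+1}$ such that, with $Y(t):=w(t)^{n_1}$, the order in $t$ of $g(t^m,Y(t))$ is greater than $D/n_2$, and $Y(x^{1/m})>0$ for $0<x\le 1$. (H4) The germ of $f$ at the origin is irreducible with characteristic sequence $(n_1n_2,mn_2,mn_2+q)$, and $h_2$ consists of higher order terms in the following sense: every monomial $x^iy^j$ of the polynomial $h_2\bigl(x^m,((1-y)w(x))^{n_1}\bigr)$ satisfies $n_2i+qj>n_2D$ (after division by $x^{mn_1n_2}$ it lies strictly above the Newton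 polygon of $y^{n_2}+x^q$). (H5) $f>0$ on $\mathcal{D}_Y\setminus\{(0,0)\}$, where $\mathcal{D}_Y:=\{(x,y)\in\mathbb{R}^2: 0\le x\le 1,\ 0\le y\le Y(x^{1/m})\}$. Put $g_Y(x,y):=\prod_{\zeta^m=1}\bigl(y-Y(\zeta x^{1/m})\bigr)$, the product over the complex $m$-th roots of unity and, for integers $\beta_1,\beta_2\ge1$ and $\beta_3\ge0$, $$\mathcal{I}(f,\beta_1,\beta_2,\beta_3)(s)=\iint_{\mathcal{D}_Y} f(x,y)^s\,x^{\beta_1}y^{\beta_2}\,g_Y(x,y)^{\beta_3}\,\frac{dx}{x}\frac{dy}{y}.$$ Let $N_k:=(m+n_1)n_2+q+k$, let $\Gamma$ be the semigroup generated by $n_1n_2$, $mn_2$, $D$ (with $0\in\Gamma$), and let $$A_2:=\Bigl\{\alpha=-\tfrac{N_k}{n_2D}\ :\ 0\le k<n_2D,\ n_2\alpha\notin\mathbb{Z},\ D\alpha\notin\mathbb{Z}\Bigr\},\qquad A_{21}:=\Bigl\{-\tfrac{N_k}{n_2D}\in A_2\ :\ N_k-q\in\Gamma\Bigr\}.$$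 **Proposition.** Let $f$ be of type $(n_1n_2,mn_2,mn_2+q)^-$, and let $\alpha\in A_{21}$ be written as $$\alpha=-\frac{n_2(\beta_1m+\beta_2n_1)+\beta_3D+q}{n_2D},\qquad \beta_1,\beta_2\in\mathbb{Z}_{\ge1},\ \beta_3\in\mathbb{Z}_{\ge0}.$$ Assume that $\alpha\ne-\frac{m\beta_1+n_1\beta_2+mn_1\beta_3+\nu}{mn_1n_2}$ for all $\nu\in\mathbb{Z}_{\ge0}$ (this is automatic if $\gcd(q,mn_1)=1$). Then $\mathcal{I}(f,\beta_1,\beta_2,\beta_3)(s)$ converges absolutely on some right half-plane and continues meromorphically to $\mathbb{C}$, and the continuation has a simple pole at $\alpha$ with residue $$(-1)^{\beta_3}\,\frac{1}{n_2(mn_1n_2+q)}\,\boldsymbol{B}\!\left(\frac{\beta_3+1}{n_2},\,-\alpha-\frac{\beta_3+1}{n_2}\right),$$ where $\boldsymbol{B}(u,v)=\Gamma(u)\Gamma(v)/\Gamma(u+v)$. -/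

import Mathlib

open MeasureTheory Filter Topology

noncomputable section

namespace TwoPuiseux

/-- The germ at the origin of the plane curve `f = 0` is irreducible with characteristic sequence
`(n, b₁, b₂)`: `f(x, 0)` has order `n` in `x`, and `f` has a Puiseux root `x = φ(y^{1/n})`, where
`b₁` is the least exponent of `φ` not divisible by `n`, `b₂` is the least exponent not
divisible by `gcd(n, b₁)`, and `gcd(n, b₁, b₂) = 1`.  (The variables are `x = X 0`, `y = X 1`.) -/
def HasCharSeq (f : MvPolynomial (Fin 2) ℝ) (n b₁ b₂ : ℕ) : Prop :=
  0 < n ∧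
  (MvPolynomial.aeval ![(PowerSeries.X : PowerSeries ℝ), 0] f).order = n ∧
  ∃ φ : PowerSeries ℂ,
    PowerSeries.constantCoeff φ = 0 ∧
    MvPolynomial.aeval ![φ, (PowerSeries.X : PowerSeries ℂ) ^ n] f = 0 ∧
    IsLeast {k : ℕ | PowerSeries.coeff k φ ≠ 0 ∧ ¬ n ∣ k} b₁ ∧
    IsLeast {k : ℕ | PowerSeries.coeff k φ ≠ 0 ∧ ¬ n.gcd b₁ ∣ k} b₂ ∧
    (n.gcd b₁).gcd b₂ = 1

/-- The value `Y(x^{1/m})`, where `Y(t) = w(t)^{n₁}`. -/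
def curveY (n₁ m : ℕ) (w : Polynomial ℝ) (x : ℝ) : ℝ :=
  (w.eval (x ^ (1 / (m : ℝ)))) ^ n₁

/-- The curved domain `D_Y = {(x, y) : 0 ≤ x ≤ 1, 0 ≤ y ≤ Y(x^{1/m})}`. -/
def domainY (n₁ m : ℕ) (w : Polynomial ℝ) : Set (ℝ × ℝ) :=
  {p | 0 ≤ p.1 ∧ p.1 ≤ 1 ∧ 0 ≤ p.2 ∧ p.2 ≤ curveY n₁ m w p.1}

/-- `g_Y(x, y) = ∏_{ζ^m = 1} (y - Y(ζ x^{1/m}))`, the product over the complex `m`-th roots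
of unity. -/
def gY (n₁ m : ℕ) (w : Polynomial ℝ) (x y : ℝ) : ℂ :=
  ∏ ζ ∈ Polynomial.nthRootsFinset m (1 : ℂ),
    ((y : ℂ) - (Polynomial.aeval (ζ * ((x ^ (1 / (m : ℝ)) : ℝ) : ℂ)) w) ^ n₁)

/-- `g(x, y) = x^{n₁} - y^m + h₁(x, y)`. -/
def gPoly (n₁ m : ℕ) (h₁ : MvPolynomial (Fin 2) ℝ) : MvPolynomial (Fin 2) ℝ :=
  MvPolynomial.X 0 ^ n₁ - MvPolynomial.X 1 ^ m + h₁

/-- `f` is of type `(n₁ n₂, m n₂, m n₂ + q)⁻`, as witnessed by `h₁`, `h₂`, `a`, `b` and by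
`w(t) = t + a₁ t² + ⋯ + a_k t^{k+1}`, with `Y(t) = w(t)^{n₁}`.
The supports of `h₂` and of the other terms are not required to be disjoint. -/
structure IsTypeMinus (n₁ m n₂ q : ℕ) (f h₁ h₂ : MvPolynomial (Fin 2) ℝ) (a b : ℕ)
    (w : Polynomial ℝ) : Prop where
  /-- The shape of `f`. -/
  eq : f = gPoly n₁ m h₁ ^ n₂ + MvPolynomial.X 0 ^ a * MvPolynomial.X 1 ^ b + h₂
  /-- The exponents `(i, j)` of `h₁` satisfy `m i + n₁ j > m n₁`. -/
  supp_h₁ : ∀ d ∈ h₁.support, m * n₁ < m * d 0 + n₁ * d 1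
  /-- The weight of `x^a y^b`. -/
  weight : a * m + b * n₁ = m * n₁ * n₂ + q
  w_zero : w.coeff 0 = 0
  w_one : w.coeff 1 = 1
  /-- The order of `g(x, Y(x^{1/m}))` in `x` is greater than `(m n₁ n₂ + q) / (m n₂)`; with
  `x = t^m`, the order in `t` is greater than `(m n₁ n₂ + q) / n₂`. -/
  order_g : ∀ k : ℕ, n₂ * k ≤ m * n₁ * n₂ + q →
    (MvPolynomial.aeval ![(Polynomial.X : Polynomial ℝ) ^ m, w ^ n₁] (gPoly n₁ m h₁)).coeff k = 0
  Y_pos : ∀ x : ℝ, 0 < x → x ≤ 1 → 0 < curveY n₁ m w x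
  charSeq : HasCharSeq f (n₁ * n₂) (m * n₂) (m * n₂ + q)
  /-- In the coordinates `x ↦ x^m`, `y ↦ ((1 - y) w(x))^{n₁}`, and after division by
  `x^{m n₁ n₂}`, all monomials of `h₂` lie strictly above the Newton polygon of `y^{n₂} + x^q`. -/
  newton_h₂ : ∀ d ∈ (MvPolynomial.aeval
      ![(MvPolynomial.X 0 : MvPolynomial (Fin 2) ℝ) ^ m,
        ((1 - MvPolynomial.X 1) * Polynomial.aeval (MvPolynomial.X 0) w) ^ n₁] h₂).support,
    n₂ * (m * n₁ * n₂ + q) < n₂ * d 0 + q * d 1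
  f_pos : ∀ p ∈ domainY n₁ m w, p ≠ (0, 0) → 0 < MvPolynomial.eval ![p.1, p.2] f

/-- The integrand `f(x,y)^s x^{β₁} y^{β₂} g_Y(x,y)^{β₃} (1/x) (1/y)`. -/
def integrand (n₁ m : ℕ) (f : MvPolynomial (Fin 2) ℝ) (w : Polynomial ℝ) (β₁ β₂ β₃ : ℕ)
    (s : ℂ) (p : ℝ × ℝ) : ℂ :=
  ((MvPolynomial.eval ![p.1, p.2] f : ℝ) : ℂ) ^ s * (p.1 : ℂ) ^ β₁ * (p.2 : ℂ) ^ β₂ *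
    gY n₁ m w p.1 p.2 ^ β₃ / ((p.1 : ℂ) * (p.2 : ℂ))

/-- The integral `ℐ(f, β₁, β₂, β₃)(s)` over `D_Y`. -/
def integralI (n₁ m : ℕ) (f : MvPolynomial (Fin 2) ℝ) (w : Polynomial ℝ) (β₁ β₂ β₃ : ℕ)
    (s : ℂ) : ℂ :=
  ∫ p in domainY n₁ m w, integrand n₁ m f w β₁ β₂ β₃ s p

/-- `F` is the meromorphic continuation of `s ↦ ℐ(f, β₁, β₂, β₃)(s)`: it is meromorphic on `ℂ`, and
on some right half-plane the integral converges absolutely and equals `F`. -/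
def IsMeromorphicContinuation (n₁ m : ℕ) (f : MvPolynomial (Fin 2) ℝ) (w : Polynomial ℝ)
    (β₁ β₂ β₃ : ℕ) (F : ℂ → ℂ) : Prop :=
  MeromorphicOn F Set.univ ∧
  ∃ σ : ℝ, ∀ s : ℂ, σ < s.re →
    IntegrableOn (integrand n₁ m f w β₁ β₂ β₃ s) (domainY n₁ m w) ∧
    F s = integralI n₁ m f w β₁ β₂ β₃ s

/-- The semigroup `Γ` generated by `n₁ n₂`, `m n₂` and `m n₁ n₂ + q`. -/
def Gam (n₁ m n₂ q : ℕ) : AddSubmonoid ℕ :=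
  AddSubmonoid.closure {n₁ * n₂, m * n₂, m * n₁ * n₂ + q}

/-- `N_k = (m + n₁) n₂ + q + k`. -/
def Nk (n₁ m n₂ q k : ℕ) : ℕ := (m + n₁) * n₂ + q + k

/-- The set `A₂` of the `α = -N_k / (n₂ D)`, `0 ≤ k < n₂ D`, `D = m n₁ n₂ + q`, for which
neither `n₂ α` nor `D α` is an integer. -/
def A2 (n₁ m n₂ q : ℕ) : Set ℚ :=
  {α | (∃ k : ℕ, k < n₂ * (m * n₁ * n₂ + q) ∧
      α = -(Nk n₁ m n₂ q k : ℚ) / ((n₂ : ℚ) * ((m : ℚ) * n₁ * n₂ + q))) ∧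
    (¬ ∃ z : ℤ, (n₂ : ℚ) * α = z) ∧ ¬ ∃ z : ℤ, ((m : ℚ) * n₁ * n₂ + q) * α = z}

/-- The set `A₂₁` of the elements `-N_k / (n₂ D)` of `A₂` for which `N_k - q ∈ Γ`. -/
def A21 (n₁ m n₂ q : ℕ) : Set ℚ :=
  {α | α ∈ A2 n₁ m n₂ q ∧ ∃ k : ℕ, ∃ γ ∈ Gam n₁ m n₂ q, Nk n₁ m n₂ q k = γ + q ∧
    α = -(Nk n₁ m n₂ q k : ℚ) / ((n₂ : ℚ) * ((m : ℚ) * n₁ * n₂ + q))}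

/-- Euler's beta function `B(u, v) = Γ(u) Γ(v) / Γ(u + v)`; the second argument may have negative
real part, so that the integral representation is not enough. -/
def betaFn (u v : ℂ) : ℂ := Complex.Gamma u * Complex.Gamma v / Complex.Gamma (u + v)

end TwoPuiseux

end

/-!
Write `A = m n₁ n₂`, `D = A + q`. In the coordinates `x ↦ x^m`, `y ↦ ((1 - y) w(x))^{n₁}`
(`pullback`) the domain `D_Y` becomes the unit square, the curve `y = Y(x^{1/m})` becomes the side
`y = 0`, the function `g_Y` becomes `x^{m n₁} y` times a polynomial with value `-m n₁` at the origin
(`exists_gY_eq`), and `f` becomes `x^A` times a polynomial whose part on the Newton polygon at the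
origin is `c y^{n₂} + x^q` with `c = (m n₁)^{n₂}`. For the last point the order condition on `g`
serves for `g^{n₂}`, and the Newton polygon condition on `h₂` for the rest; that the pullback of
`h₂` is divisible by `x^{A + 1}` is not part of the hypotheses, but follows from them
(`weight_lt_of_newton`): its lowest part in `x` would otherwise be a polynomial in `1 - y` with too
few terms for its order of vanishing at `y = 0`.

The square is cut along `y^{n₂} = x^q` and each half is parametrised by a weighted blow-up chart,
`(x, y) = (X^{n₂}, X^q T)` and `(x, y) = (X^{n₂} T, X^q)`. There `f` is `X^{n₂ D} P` and
`X^{n₂ D} T^A Q` with `P` and `Q` positive on the closed square (`exists_chartLower`,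
`exists_chartUpper`), so that the zeta integral is a sum of two integrals of
`X^{z₁ - 1} T^{z₂ - 1} P^s H`, with exponents `z₁`, `z₂` affine in `s`
(`exists_regularization`). Such an integral is `Γ(z₁) Γ(z₂) E(s)` with `E` entire
(`exists_entire_squareIntegrand`): repeated integration by parts shows that
`Γ(z)⁻¹ ∫₀¹ t^{z - 1} k(t) dt` continues to an entire function `regInt` of `z`, with value `k(0)` at
`z = 0`, and this is applied in both variables.

At `s = α` the exponent `z₁ = n₂ D s + n₂ B + q (β₃ + 1)`, `B = m β₁ + n₁ β₂ + m n₁ β₃`, of both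
charts vanishes, so `Γ(z₁)` has a simple pole with residue `1 / (n₂ D)`, whereas the `Γ(z₂)` are
finite, in the second chart by the assumption on `α`. The factor multiplying `Γ(z₁)` is a sum of
two regularised one-dimensional integrals over the exceptional curve `X = 0`. These are the two
halves of an Euler beta integral, the one over `(0, c / (1 + c))` and the one over
`(c / (1 + c), 1)`, in the substitution `c T^{n₂} / (1 + c T^{n₂})` and its counterpart in the
other chart. Integration by parts moves the second argument of the beta function into the
half-plane of convergence, which gives `residue_eq_betaFn`. As the beta value is not zero, the pole
does not cancel.
-/

noncomputable section

namespace TwoPuiseux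

/-! ### Regularised integrals -/

/-- An integral depends holomorphically on a parameter if the integrand does and is dominated;
Cauchy's estimate bounds the derivative of the integrand. -/
theorem differentiableAt_integral_of_dominated {β : Type*} [MeasurableSpace β] {μ : Measure β}
    {F : ℂ → β → ℂ} {s₀ : ℂ} {r : ℝ} (hr : 0 < r) {bound : β → ℝ}
    (hmeas : ∀ s ∈ Metric.ball s₀ r, AEStronglyMeasurable (F s) μ)
    (hbound : ∀ᵐ x ∂μ, ∀ s ∈ Metric.ball s₀ r, ‖F s x‖ ≤ bound x)
    (hint : Integrable bound μ)
    (hdiff : ∀ᵐ x ∂μ, DifferentiableOn ℂ (fun s => F s x) (Metric.ball s₀ r)) :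
    DifferentiableAt ℂ (fun s => ∫ x, F s x ∂μ) s₀ := by
  have hs₀ : s₀ ∈ Metric.ball s₀ r := Metric.mem_ball_self hr
  have hd : ∀ᵐ x ∂μ, ∀ s ∈ Metric.ball s₀ (r / 2),
      HasDerivAt (fun s => F s x) (deriv (fun s => F s x) s) s := by
    filter_upwards [hdiff] with x hx s hs
    refine (hx.differentiableAt (Metric.isOpen_ball.mem_nhds ?_)).hasDerivAt
    exact Metric.ball_subset_ball (by linarith) hs
  refine (hasDerivAt_integral_of_dominated_loc_of_deriv_le
    (F' := fun s x => deriv (fun s => F s x) s) (bound := fun x => bound x / (r / 4))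
    (Metric.ball_mem_nhds s₀ (half_pos hr)) ?_ ?_ ?_ ?_ ?_ hd).2.differentiableAt
  · filter_upwards [Metric.ball_mem_nhds s₀ hr] with s hs using hmeas s hs
  · refine Integrable.mono' hint (hmeas s₀ hs₀) ?_
    filter_upwards [hbound] with x hx using hx s₀ hs₀
  · -- the derivative is a pointwise limit of difference quotients along `r / (n + 2)`
    have hlim : Tendsto (fun n : ℕ => s₀ + ((r / ((n : ℝ) + 2) : ℝ) : ℂ)) atTop (𝓝[≠] s₀) := by
      refine tendsto_nhdsWithin_iff.2 ⟨?_, Eventually.of_forall fun n => ?_⟩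
      · have h1 : Tendsto (fun n : ℕ => r / ((n : ℝ) + 2)) atTop (𝓝 0) :=
          tendsto_const_nhds.div_atTop
            (tendsto_atTop_add_const_right _ _ tendsto_natCast_atTop_atTop)
        have h2 := (Complex.continuous_ofReal.tendsto 0).comp h1
        simpa using (tendsto_const_nhds (x := s₀)).add h2
      · have : r / ((n : ℝ) + 2) ≠ 0 := by positivity
        simp only [Set.mem_compl_iff, Set.mem_singleton_iff, add_eq_left, Complex.ofReal_eq_zero]
        exact this
    refine aestronglyMeasurable_of_tendsto_ae atTop
      (f := fun (n : ℕ) x => slope (fun s => F s x) s₀ (s₀ + ((r / ((n : ℝ) + 2) : ℝ) : ℂ)))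
      (fun n => ?_) ?_
    · have hm : s₀ + ((r / ((n : ℝ) + 2) : ℝ) : ℂ) ∈ Metric.ball s₀ r := by
        have h0 : (0 : ℝ) ≤ n := Nat.cast_nonneg n
        have h3 : |r / ((n : ℝ) + 2)| < r := by
          rw [abs_of_nonneg (by positivity), div_lt_iff₀ (by positivity)]
          nlinarith
        rw [Metric.mem_ball, dist_eq_norm, add_sub_cancel_left, Complex.norm_real]
        exact h3
      simp only [slope, vsub_eq_sub]
      exact ((hmeas _ hm).sub (hmeas _ hs₀)).const_smul
        (s₀ + ((r / ((n : ℝ) + 2) : ℝ) : ℂ) - s₀)⁻¹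
    · filter_upwards [hd] with x hx
      exact (hasDerivAt_iff_tendsto_slope.1 (hx s₀ (Metric.mem_ball_self (half_pos hr)))).comp hlim
  · filter_upwards [hbound, hdiff] with x hx hx' s hs
    have hsub : Metric.closedBall s (r / 4) ⊆ Metric.ball s₀ r := by
      intro y hy
      rw [Metric.mem_ball] at hs ⊢
      rw [Metric.mem_closedBall] at hy
      linarith [dist_triangle y s s₀]
    refine Complex.norm_deriv_le_of_forall_mem_sphere_norm_le (by positivity) ?_ ?_
    · refine DifferentiableOn.diffContOnCl ?_
      refine hx'.mono ?_
      exact (Metric.closure_ball_subset_closedBall).trans hsub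
    · intro z hz
      exact hx z (hsub (Metric.sphere_subset_closedBall hz))
  · exact hint.div_const _

theorem intervalIntegrable_cpow_mul {k : ℝ → ℂ} (hk : ContinuousOn k (Set.Icc 0 1)) {w : ℂ}
    (hw : 0 < w.re) :
    IntervalIntegrable (fun t : ℝ => (t : ℂ) ^ (w - 1) * k t) volume 0 1 := by
  refine (intervalIntegral.intervalIntegrable_cpow' (by simpa using hw)).mul_continuousOn ?_
  rwa [Set.uIcc_of_le zero_le_one]

theorem norm_cpow_mul_le {t : ℝ} (ht : t ∈ Set.Ioc (0 : ℝ) 1) {w y : ℂ} {ρ c : ℝ} (hw : ρ ≤ w.re)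
    (hy : ‖y‖ ≤ c) : ‖(t : ℂ) ^ (w - 1) * y‖ ≤ t ^ (ρ - 1) * c := by
  rw [norm_mul, Complex.norm_cpow_eq_rpow_re_of_pos ht.1]
  refine mul_le_mul ?_ hy (norm_nonneg _) (Real.rpow_nonneg ht.1.le _)
  exact Real.rpow_le_rpow_of_exponent_ge ht.1 ht.2 (by simpa using hw)

theorem intervalIntegrable_rpow_mul_const {ρ : ℝ} (hρ : 0 < ρ) (c : ℝ) :
    IntervalIntegrable (fun t : ℝ => t ^ (ρ - 1) * c) volume 0 1 :=
  (intervalIntegral.intervalIntegrable_rpow' (by linarith)).mul_const _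

/-- The first `M` steps of integration by parts applied to
`Γ(z)⁻¹ ∫₀¹ t^{z-1} k₀(t) dt`, where `kⱼ₊₁ = kⱼ'`.  The formula makes sense for `-M < re z`; the
function `(Complex.Gamma z)⁻¹` is entire because `Complex.Gamma` takes the value `0` at its poles. -/
def regIntAux (k : ℕ → ℝ → ℂ) (M : ℕ) (z : ℂ) : ℂ :=
  ∑ j ∈ Finset.range M, (-1) ^ j * k j 1 * (Complex.Gamma (z + j + 1))⁻¹ +
    (-1) ^ M * (Complex.Gamma (z + M))⁻¹ * ∫ t in (0 : ℝ)..1, (t : ℂ) ^ (z + M - 1) * k M t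

/-- The entire continuation in `z` of `Γ(z)⁻¹ ∫₀¹ t^{z-1} k₀(t) dt`, for a smooth function `k₀`
on `[0, 1]` that is given together with its derivatives `kⱼ`. -/
def regInt (k : ℕ → ℝ → ℂ) (z : ℂ) : ℂ := regIntAux k (⌈|z.re|⌉₊ + 1) z

/-- `k` is the sequence of derivatives of a function that is smooth on `[0, 1]`. -/
structure IsDerivSeq (k : ℕ → ℝ → ℂ) : Prop where
  cont : ∀ j, ContinuousOn (k j) (Set.Icc 0 1)
  deriv : ∀ j, ∀ t ∈ Set.Ioo (0 : ℝ) 1, HasDerivAt (k j) (k (j + 1) t) t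

theorem integral_cpow_mul_by_parts {f f' : ℝ → ℂ} (hf : ContinuousOn f (Set.Icc 0 1))
    (hf' : ∀ t ∈ Set.Ioo (0 : ℝ) 1, HasDerivAt f (f' t) t)
    (hf'' : IntervalIntegrable f' volume 0 1) {w : ℂ} (hw : 0 < w.re) :
    ∫ t in (0 : ℝ)..1, (t : ℂ) ^ (w - 1) * f t =
      (f 1 - ∫ t in (0 : ℝ)..1, (t : ℂ) ^ w * f' t) / w := by
  have hw0 : w ≠ 0 := by rintro rfl; simp at hw
  have key := intervalIntegral.integral_mul_deriv_eq_deriv_mul_of_hasDerivAt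
    (a := 0) (b := 1) (u := f) (v := fun t : ℝ => (t : ℂ) ^ w / w) (u' := f')
    (v' := fun t : ℝ => (t : ℂ) ^ (w - 1)) (by rwa [Set.uIcc_of_le zero_le_one])
    ((continuous_iff_continuousAt.2 fun t =>
      (Complex.continuousAt_ofReal_cpow_const t w (Or.inl hw)).div_const _).continuousOn)
    (by simpa using hf')
    (by
      intro t ht
      simp only [zero_le_one, inf_of_le_left, sup_of_le_right] at ht
      have := hasDerivAt_ofReal_cpow_const' (x := t) (ne_of_gt ht.1) (r := w - 1)
        (by intro h; apply hw0; linear_combination h)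
      simpa only [sub_add_cancel] using this)
    hf'' (intervalIntegral.intervalIntegrable_cpow' (by simpa using hw))
  simp only [Complex.ofReal_zero, Complex.ofReal_one, Complex.one_cpow,
    Complex.zero_cpow hw0, zero_div, mul_zero, sub_zero] at key
  rw [show (∫ t in (0 : ℝ)..1, (t : ℂ) ^ (w - 1) * f t) = ∫ t in (0 : ℝ)..1, f t * (t : ℂ) ^ (w - 1)
    from by simp only [mul_comm], key, sub_div, ← intervalIntegral.integral_div]
  congr 1
  · ring
  · exact intervalIntegral.integral_congr fun t _ => by ring

/-- One more integration by parts; the boundary term at `0` vanishes since `0 < re (z + M)`. -/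
theorem regIntAux_succ {k : ℕ → ℝ → ℂ} (hk : IsDerivSeq k) {M : ℕ} {z : ℂ} (hz : 0 < (z + M).re) :
    regIntAux k (M + 1) z = regIntAux k M z := by
  have hz0 : z + M ≠ 0 := by intro h; simp [h] at hz
  have h1 := integral_cpow_mul_by_parts (hk.cont M) (hk.deriv M)
    ((by simpa [Set.uIcc_of_le zero_le_one] using hk.cont (M + 1) :
      ContinuousOn (k (M + 1)) (Set.uIcc 0 1)).intervalIntegrable) hz
  unfold regIntAux
  rw [Finset.sum_range_succ, h1, Nat.cast_succ,
    show z + ((M : ℂ) + 1) = z + M + 1 by ring, show z + (M : ℂ) + 1 - 1 = z + M by ring,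
    Complex.Gamma_add_one _ hz0]
  field_simp
  ring

theorem regIntAux_eq_of_le {k : ℕ → ℝ → ℂ} (hk : IsDerivSeq k) {M N : ℕ} (hMN : M ≤ N) {z : ℂ}
    (hz : 0 < (z + M).re) : regIntAux k N z = regIntAux k M z := by
  induction N, hMN using Nat.le_induction with
  | base => rfl
  | succ N hN ih =>
    rw [regIntAux_succ hk, ih]
    have : (M : ℝ) ≤ N := by exact_mod_cast hN
    simp only [Complex.add_re, Complex.natCast_re] at hz ⊢
    linarith

theorem regInt_eq {k : ℕ → ℝ → ℂ} (hk : IsDerivSeq k) {M : ℕ} {z : ℂ} (hz : 0 < (z + M).re) :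
    regInt k z = regIntAux k M z := by
  have h0 : 0 < (z + (⌈|z.re|⌉₊ + 1 : ℕ)).re := by
    have h1 := Nat.le_ceil |z.re|
    have h2 := neg_abs_le z.re
    simp only [Complex.add_re, Complex.natCast_re]
    push_cast
    linarith
  unfold regInt
  rcases le_total M (⌈|z.re|⌉₊ + 1) with h | h
  · exact regIntAux_eq_of_le hk h hz
  · exact (regIntAux_eq_of_le hk h h0).symm

theorem regInt_of_re_pos {k : ℕ → ℝ → ℂ} (hk : IsDerivSeq k) {z : ℂ} (hz : 0 < z.re) :
    regInt k z = (Complex.Gamma z)⁻¹ * ∫ t in (0 : ℝ)..1, (t : ℂ) ^ (z - 1) * k 0 t := by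
  rw [regInt_eq hk (M := 0) (by simpa using hz)]
  simp [regIntAux]

/-- The residue of `∫₀¹ t^{z-1} k₀(t) dt` at `z = 0` is `k₀(0)`. -/
theorem regInt_zero {k : ℕ → ℝ → ℂ} (hk : IsDerivSeq k) : regInt k 0 = k 0 0 := by
  rw [regInt_eq hk (M := 1) (by simp)]
  have h := intervalIntegral.integral_eq_sub_of_hasDerivAt_of_le zero_le_one (hk.cont 0)
    (hk.deriv 0) ((by simpa [Set.uIcc_of_le zero_le_one] using hk.cont 1 :
      ContinuousOn (k 1) (Set.uIcc 0 1)).intervalIntegrable)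
  simp [regIntAux, h]

/-! ### Holomorphic dependence on parameters -/

theorem eventually_bound {Ω : Type*} [TopologicalSpace Ω] [LocallyCompactSpace Ω] {S : Set Ω}
    (hS : IsClosed S) {k : Ω → ℝ → ℂ}
    (hk : ContinuousOn (fun p : Ω × ℝ => k p.1 p.2) (S ×ˢ Set.Icc 0 1)) (x₀ : Ω) :
    ∃ c : ℝ, ∀ᶠ x in 𝓝[S] x₀, ∀ t ∈ Set.Icc (0 : ℝ) 1, ‖k x t‖ ≤ c := by
  obtain ⟨K, hK, hx⟩ := exists_compact_mem_nhds x₀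
  obtain ⟨c, hc⟩ := ((hK.inter_right hS).prod isCompact_Icc).exists_bound_of_continuousOn
    (hk.mono (Set.prod_mono_left Set.inter_subset_right))
  refine ⟨c, ?_⟩
  filter_upwards [mem_nhdsWithin_of_mem_nhds hx, self_mem_nhdsWithin] with x h1 h2 t ht
  exact hc (x, t) ⟨⟨h1, h2⟩, ht⟩

theorem eventually_half_re_le {Ω : Type*} [TopologicalSpace Ω] {S : Set Ω} {w : Ω → ℂ} {x₀ : Ω}
    (hw : ContinuousWithinAt w S x₀) (h0 : 0 < (w x₀).re) :
    ∀ᶠ x in 𝓝[S] x₀, (w x₀).re / 2 ≤ (w x).re := by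
  have h1 := (Complex.continuous_re.continuousAt.comp_continuousWithinAt hw)
  filter_upwards [h1 (Ioi_mem_nhds (half_lt_self h0))] with x hx using le_of_lt hx

theorem aestronglyMeasurable_cpow_mul {k : ℝ → ℂ} (hk : ContinuousOn k (Set.Icc 0 1)) (w : ℂ) :
    AEStronglyMeasurable (fun t : ℝ => (t : ℂ) ^ (w - 1) * k t)
      (volume.restrict (Set.uIoc 0 1)) := by
  rw [Set.uIoc_of_le zero_le_one]
  refine AEStronglyMeasurable.mul ?_
    ((hk.mono Set.Ioc_subset_Icc_self).aestronglyMeasurable measurableSet_Ioc)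
  exact (by fun_prop : Measurable fun t : ℝ => (t : ℂ) ^ (w - 1)).aestronglyMeasurable

theorem continuousWithinAt_integral_cpow_mul {Ω : Type*} [TopologicalSpace Ω]
    [FirstCountableTopology Ω] [LocallyCompactSpace Ω] {S : Set Ω} (hS : IsClosed S)
    {k : Ω → ℝ → ℂ} (hk : ContinuousOn (fun p : Ω × ℝ => k p.1 p.2) (S ×ˢ Set.Icc 0 1))
    {w : Ω → ℂ} {x₀ : Ω} (hx₀ : x₀ ∈ S) (hw : ContinuousWithinAt w S x₀) (h0 : 0 < (w x₀).re) :
    ContinuousWithinAt (fun x => ∫ t in (0 : ℝ)..1, (t : ℂ) ^ (w x - 1) * k x t) S x₀ := by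
  obtain ⟨c, hc⟩ := eventually_bound hS hk x₀
  have hw' := eventually_half_re_le hw h0
  refine intervalIntegral.continuousWithinAt_of_dominated_interval
    (bound := fun t => t ^ ((w x₀).re / 2 - 1) * c) ?_ ?_
    (intervalIntegrable_rpow_mul_const (half_pos h0) c) ?_
  · filter_upwards [self_mem_nhdsWithin] with x hx
    exact aestronglyMeasurable_cpow_mul
      (hk.comp (by fun_prop : Continuous fun t : ℝ => (x, t)).continuousOn fun t ht => ⟨hx, ht⟩) _
  · filter_upwards [hc, hw'] with x h1 h2
    refine Eventually.of_forall fun t ht => ?_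
    rw [Set.uIoc_of_le zero_le_one] at ht
    exact norm_cpow_mul_le ht h2 (h1 t (Set.Ioc_subset_Icc_self ht))
  · refine Eventually.of_forall fun t ht => ?_
    rw [Set.uIoc_of_le zero_le_one] at ht
    refine ContinuousWithinAt.mul ?_ ?_
    · exact (hw.sub continuousWithinAt_const).const_cpow (Or.inl (by exact_mod_cast ht.1.ne'))
    · exact (hk (x₀, t) ⟨hx₀, Set.Ioc_subset_Icc_self ht⟩).comp
        (f := fun x => (x, t)) (by fun_prop) fun x hx => ⟨hx, Set.Ioc_subset_Icc_self ht⟩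

theorem differentiableAt_integral_cpow_mul {k : ℂ → ℝ → ℂ}
    (hk : ContinuousOn (fun p : ℂ × ℝ => k p.1 p.2) (Set.univ ×ˢ Set.Icc 0 1))
    (hk' : ∀ t ∈ Set.Icc (0 : ℝ) 1, Differentiable ℂ fun s => k s t)
    {w : ℂ → ℂ} (hw : Differentiable ℂ w) {s₀ : ℂ} (h0 : 0 < (w s₀).re) :
    DifferentiableAt ℂ (fun s => ∫ t in (0 : ℝ)..1, (t : ℂ) ^ (w s - 1) * k s t) s₀ := by
  obtain ⟨c, hc⟩ := eventually_bound isClosed_univ hk s₀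
  have hw' := eventually_half_re_le hw.continuous.continuousAt.continuousWithinAt (S := Set.univ) h0
  rw [nhdsWithin_univ] at hc hw'
  obtain ⟨r, hr, hball⟩ := Metric.eventually_nhds_iff_ball.1 (hc.and hw')
  simp only [intervalIntegral.integral_of_le zero_le_one]
  refine differentiableAt_integral_of_dominated hr (bound := fun t => t ^ ((w s₀).re / 2 - 1) * c)
    (fun s _ => ?_) ?_ ?_ ?_
  · rw [← Set.uIoc_of_le zero_le_one]
    exact aestronglyMeasurable_cpow_mul
      (hk.comp (by fun_prop : Continuous fun t : ℝ => (s, t)).continuousOn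
        fun t ht => ⟨Set.mem_univ _, ht⟩) _
  · refine (ae_restrict_iff' measurableSet_Ioc).2 (Eventually.of_forall fun t ht s hs => ?_)
    exact norm_cpow_mul_le ht (hball s hs).2 ((hball s hs).1 t (Set.Ioc_subset_Icc_self ht))
  · exact (intervalIntegrable_iff_integrableOn_Ioc_of_le zero_le_one).1
      (intervalIntegrable_rpow_mul_const (half_pos h0) c)
  · refine (ae_restrict_iff' measurableSet_Ioc).2 (Eventually.of_forall fun t ht => ?_)
    refine Differentiable.differentiableOn ?_
    refine Differentiable.mul ?_ (hk' t (Set.Ioc_subset_Icc_self ht))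
    exact (hw.sub_const 1).const_cpow (Or.inl (by exact_mod_cast ht.1.ne'))

theorem hasDerivAt_integral_cpow_mul {k k' : ℝ → ℝ → ℂ}
    (hk : ContinuousOn (fun p : ℝ × ℝ => k p.1 p.2) (Set.Icc 0 1 ×ˢ Set.Icc 0 1))
    (hk' : ContinuousOn (fun p : ℝ × ℝ => k' p.1 p.2) (Set.Icc 0 1 ×ˢ Set.Icc 0 1))
    (hd : ∀ x ∈ Set.Ioo (0 : ℝ) 1, ∀ t ∈ Set.Icc (0 : ℝ) 1,
      HasDerivAt (fun x => k x t) (k' x t) x)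
    {w : ℂ} (h0 : 0 < w.re) {x₀ : ℝ} (hx₀ : x₀ ∈ Set.Ioo (0 : ℝ) 1) :
    HasDerivAt (fun x => ∫ t in (0 : ℝ)..1, (t : ℂ) ^ (w - 1) * k x t)
      (∫ t in (0 : ℝ)..1, (t : ℂ) ^ (w - 1) * k' x₀ t) x₀ := by
  obtain ⟨c, hc⟩ := (isCompact_Icc.prod isCompact_Icc).exists_bound_of_continuousOn hk'
  have hsec : ∀ {f : ℝ → ℝ → ℂ},
      ContinuousOn (fun p : ℝ × ℝ => f p.1 p.2) (Set.Icc 0 1 ×ˢ Set.Icc 0 1) →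
      ∀ x ∈ Set.Ioo (0 : ℝ) 1, ContinuousOn (f x) (Set.Icc 0 1) := fun {f} hf x hx =>
    hf.comp (by fun_prop : Continuous fun t : ℝ => (x, t)).continuousOn
      fun t ht => ⟨Set.Ioo_subset_Icc_self hx, ht⟩
  have hmem := isOpen_Ioo.mem_nhds hx₀
  refine (intervalIntegral.hasDerivAt_integral_of_dominated_loc_of_deriv_le
    (F' := fun x t => (t : ℂ) ^ (w - 1) * k' x t) (bound := fun t => t ^ (w.re - 1) * c) hmem
    ?_ (intervalIntegrable_cpow_mul (hsec hk x₀ hx₀) h0)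
    (aestronglyMeasurable_cpow_mul (hsec hk' x₀ hx₀) w) ?_
    (intervalIntegrable_rpow_mul_const h0 c) ?_).2
  · filter_upwards [hmem] with x hx using aestronglyMeasurable_cpow_mul (hsec hk x hx) w
  · refine Eventually.of_forall fun t ht x hx => ?_
    rw [Set.uIoc_of_le zero_le_one] at ht
    exact norm_cpow_mul_le ht le_rfl
      (hc (x, t) ⟨Set.Ioo_subset_Icc_self hx, Set.Ioc_subset_Icc_self ht⟩)
  · refine Eventually.of_forall fun t ht x hx => ?_
    rw [Set.uIoc_of_le zero_le_one] at ht
    exact (hd x hx t (Set.Ioc_subset_Icc_self ht)).const_mul _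

/-- A family, indexed by `s : ℂ`, of smooth functions on `[0, 1]`, given together with all its
derivatives `K j` in the real variable; these are jointly continuous, and entire in `s`. -/
structure SmoothFam (K : ℕ → ℂ → ℝ → ℂ) : Prop where
  cont : ∀ j, ContinuousOn (fun p : ℂ × ℝ => K j p.1 p.2) (Set.univ ×ˢ Set.Icc 0 1)
  deriv : ∀ j s, ∀ t ∈ Set.Ioo (0 : ℝ) 1, HasDerivAt (K j s) (K (j + 1) s t) t
  holo : ∀ j, ∀ t ∈ Set.Icc (0 : ℝ) 1, Differentiable ℂ fun s => K j s t

/-- A family, indexed by `s : ℂ`, of smooth functions of `(x, t) ∈ [0, 1]²`, given together with all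
its partial derivatives `K i j = ∂ₓⁱ ∂ₜʲ (K 0 0)`; these are jointly continuous, and entire in
`s`. -/
structure SmoothFam₂ (K : ℕ → ℕ → ℂ → ℝ → ℝ → ℂ) : Prop where
  cont : ∀ i j, ContinuousOn (fun p : ℂ × ℝ × ℝ => K i j p.1 p.2.1 p.2.2)
    (Set.univ ×ˢ Set.Icc 0 1 ×ˢ Set.Icc 0 1)
  deriv_fst : ∀ i j s, ∀ x ∈ Set.Ioo (0 : ℝ) 1, ∀ t ∈ Set.Icc (0 : ℝ) 1,
    HasDerivAt (fun x => K i j s x t) (K (i + 1) j s x t) x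
  deriv_snd : ∀ i j s, ∀ x ∈ Set.Icc (0 : ℝ) 1, ∀ t ∈ Set.Ioo (0 : ℝ) 1,
    HasDerivAt (K i j s x) (K i (j + 1) s x t) t
  holo : ∀ i j, ∀ x ∈ Set.Icc (0 : ℝ) 1, ∀ t ∈ Set.Icc (0 : ℝ) 1,
    Differentiable ℂ fun s => K i j s x t

theorem SmoothFam.isDerivSeq {K : ℕ → ℂ → ℝ → ℂ} (hK : SmoothFam K) (s : ℂ) :
    IsDerivSeq fun j => K j s where
  cont j := (hK.cont j).comp (by fun_prop : Continuous fun t : ℝ => (s, t)).continuousOn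
    fun t ht => ⟨Set.mem_univ _, ht⟩
  deriv j t ht := hK.deriv j s t ht

theorem exists_nat_add_re_pos (z : ℂ) : ∃ M : ℕ, 0 < (z + M).re := by
  obtain ⟨M, hM⟩ := exists_nat_gt (-z.re)
  exact ⟨M, by simp only [Complex.add_re, Complex.natCast_re]; linarith⟩

/-- Near a point the number of integrations by parts can be kept fixed. -/
theorem SmoothFam.differentiable_regInt {K : ℕ → ℂ → ℝ → ℂ} (hK : SmoothFam K) {z : ℂ → ℂ}
    (hz : Differentiable ℂ z) : Differentiable ℂ fun s => regInt (fun j => K j s) (z s) := by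
  intro s₀
  obtain ⟨M, hM⟩ := exists_nat_add_re_pos (z s₀)
  have hev : ∀ᶠ s in 𝓝 s₀, regInt (fun j => K j s) (z s) = regIntAux (fun j => K j s) M (z s) := by
    have hc : Continuous fun s => (z s + M).re :=
      Complex.continuous_re.comp (hz.continuous.add continuous_const)
    filter_upwards [hc.continuousAt.eventually (lt_mem_nhds hM)] with s hs
    exact regInt_eq (hK.isDerivSeq s) hs
  refine DifferentiableAt.congr_of_eventuallyEq ?_ hev
  have hG : ∀ N : ℂ, Differentiable ℂ fun s => (Complex.Gamma (z s + N))⁻¹ := fun N =>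
    Complex.differentiable_one_div_Gamma.comp (hz.add_const N)
  unfold regIntAux
  refine DifferentiableAt.add (DifferentiableAt.fun_sum fun j _ => ?_) ?_
  · have := hG (j + 1) s₀
    simp only [← add_assoc] at this
    exact (((hK.holo j 1 (by simp)) s₀).const_mul _).mul this
  · refine ((hG M s₀).const_mul _).mul ?_
    exact differentiableAt_integral_cpow_mul (hK.cont M) (hK.holo M) (hz.add_const _) hM

theorem SmoothFam₂.section_fst {K : ℕ → ℕ → ℂ → ℝ → ℝ → ℂ} (hK : SmoothFam₂ K) (i : ℕ) {x : ℝ}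
    (hx : x ∈ Set.Icc (0 : ℝ) 1) : SmoothFam fun j s t => K i j s x t where
  cont j := (hK.cont i j).comp
    (by fun_prop : Continuous fun p : ℂ × ℝ => (p.1, x, p.2)).continuousOn
    fun p hp => ⟨Set.mem_univ _, hx, hp.2⟩
  deriv j s t ht := hK.deriv_snd i j s x hx t ht
  holo j t ht := hK.holo i j x hx t ht

/-- Regularised integration in the second variable keeps smoothness in the first one, so that it can
be followed by regularised integration in the first variable. -/
theorem SmoothFam₂.smoothFam_regInt {K : ℕ → ℕ → ℂ → ℝ → ℝ → ℂ} (hK : SmoothFam₂ K) {z : ℂ → ℂ}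
    (hz : Differentiable ℂ z) : SmoothFam fun i s x => regInt (fun j => K i j s x) (z s) where
  holo i x hx := (hK.section_fst i hx).differentiable_regInt hz
  deriv i s x₀ hx₀ := by
    obtain ⟨M, hM⟩ := exists_nat_add_re_pos (z s)
    have hev : ∀ i, ∀ x ∈ Set.Ioo (0 : ℝ) 1,
        regInt (fun j => K i j s x) (z s) = regIntAux (fun j => K i j s x) M (z s) :=
      fun i x hx => regInt_eq ((hK.section_fst i (Set.Ioo_subset_Icc_self hx)).isDerivSeq s) hM
    rw [hev (i + 1) x₀ hx₀]
    refine HasDerivAt.congr_of_eventuallyEq ?_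
      (by filter_upwards [isOpen_Ioo.mem_nhds hx₀] with x hx using hev i x hx)
    unfold regIntAux
    refine HasDerivAt.add (HasDerivAt.fun_sum fun j _ => ?_) (HasDerivAt.const_mul _ ?_)
    · exact ((hK.deriv_fst i j s x₀ hx₀ 1 (by simp)).const_mul _).mul_const _
    · have hc : ∀ i, ContinuousOn (fun p : ℝ × ℝ => K i M s p.1 p.2)
          (Set.Icc 0 1 ×ˢ Set.Icc 0 1) := fun i => (hK.cont i M).comp
        (by fun_prop : Continuous fun p : ℝ × ℝ => (s, p.1, p.2)).continuousOn
        fun p hp => ⟨Set.mem_univ _, hp⟩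
      exact hasDerivAt_integral_cpow_mul (hc i) (hc (i + 1)) (hK.deriv_fst i M s) hM hx₀
  cont i := by
    rintro ⟨s₀, x₀⟩ hp₀
    obtain ⟨M, hM⟩ := exists_nat_add_re_pos (z s₀)
    have hzc : Continuous fun p : ℂ × ℝ => z p.1 := hz.continuous.comp continuous_fst
    have hev : ∀ᶠ p : ℂ × ℝ in 𝓝[Set.univ ×ˢ Set.Icc 0 1] (s₀, x₀),
        regInt (fun j => K i j p.1 p.2) (z p.1) = regIntAux (fun j => K i j p.1 p.2) M (z p.1) := by
      have hc : Continuous fun p : ℂ × ℝ => (z p.1 + M).re :=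
        Complex.continuous_re.comp (hzc.add continuous_const)
      filter_upwards [mem_nhdsWithin_of_mem_nhds (hc.continuousAt.eventually (lt_mem_nhds hM)),
        self_mem_nhdsWithin] with p h1 h2
      exact regInt_eq ((hK.section_fst i h2.2).isDerivSeq p.1) h1
    refine ContinuousWithinAt.congr_of_eventuallyEq ?_ hev (hev.self_of_nhdsWithin hp₀)
    have hG : ∀ N : ℂ, Continuous fun p : ℂ × ℝ => (Complex.Gamma (z p.1 + N))⁻¹ := fun N =>
      Complex.differentiable_one_div_Gamma.continuous.comp (hzc.add continuous_const)
    unfold regIntAux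
    refine ContinuousWithinAt.add (tendsto_finsetSum _ fun j _ => ?_)
      (ContinuousWithinAt.mul ?_ ?_)
    · have h1 := (hG (j + 1)).continuousWithinAt (s := Set.univ ×ˢ Set.Icc 0 1) (x := (s₀, x₀))
      simp only [← add_assoc] at h1
      refine ContinuousWithinAt.mul (continuousWithinAt_const.mul ?_) h1
      exact ((hK.cont i j).comp
        (by fun_prop : Continuous fun p : ℂ × ℝ => (p.1, p.2, (1 : ℝ))).continuousOn
        fun p hp => ⟨Set.mem_univ _, hp.2, by simp⟩) (s₀, x₀) hp₀
    · exact (continuous_const.mul (hG M)).continuousWithinAt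
    · refine continuousWithinAt_integral_cpow_mul (isClosed_univ.prod isClosed_Icc)
        (k := fun p t => K i M p.1 p.2 t) (w := fun p : ℂ × ℝ => z p.1 + M) ?_ hp₀
        (hzc.add continuous_const).continuousWithinAt hM
      exact (hK.cont i M).comp
        (by fun_prop : Continuous fun p : (ℂ × ℝ) × ℝ => (p.1.1, p.1.2, p.2)).continuousOn
        fun p hp => ⟨Set.mem_univ _, hp.1.2, hp.2⟩

/-! ### Regularisation over the unit square -/

theorem hasDerivAt_mvPolynomial_eval {𝕜 σ : Type*} [RCLike 𝕜] [Fintype σ] [DecidableEq σ]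
    (p : MvPolynomial σ ℂ) [NormedAlgebra 𝕜 ℂ] {v : 𝕜 → σ → ℂ} {v' : σ → ℂ} {z : 𝕜}
    (hv : ∀ i, HasDerivAt (fun z => v z i) (v' i) z) :
    HasDerivAt (fun z => MvPolynomial.eval (v z) p)
      (∑ i, MvPolynomial.eval (v z) (MvPolynomial.pderiv i p) * v' i) z := by
  induction p using MvPolynomial.induction_on with
  | C a => simpa using hasDerivAt_const z a
  | add p q hp hq =>
    simp only [map_add, add_mul, Finset.sum_add_distrib]
    exact hp.fun_add hq
  | mul_X p n hp =>
    have h := hp.mul (hv n)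
    simp only [map_mul, MvPolynomial.eval_X]
    refine h.congr_deriv ?_
    simp only [MvPolynomial.pderiv_mul, MvPolynomial.pderiv_X, map_add, map_mul,
      MvPolynomial.eval_X, add_mul, Finset.sum_add_distrib, Finset.sum_mul]
    congr 1
    · exact Finset.sum_congr rfl fun i _ => by ring
    · rw [Finset.sum_eq_single n]
      · simp
      · intro i _ hi
        simp [hi.symm]
      · simp

theorem pderiv_comm {R σ : Type*} [CommRing R] (i j : σ) (p : MvPolynomial σ R) :
    MvPolynomial.pderiv i (MvPolynomial.pderiv j p) =
      MvPolynomial.pderiv j (MvPolynomial.pderiv i p) := by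
  classical
  have h : ⁅(MvPolynomial.pderiv i : Derivation R (MvPolynomial σ R) (MvPolynomial σ R)),
      (MvPolynomial.pderiv j : Derivation R (MvPolynomial σ R) (MvPolynomial σ R))⁆ = 0 := by
    apply MvPolynomial.derivation_ext
    intro k
    rw [Derivation.commutator_apply, MvPolynomial.pderiv_X, MvPolynomial.pderiv_X,
      Pi.single_apply, Pi.single_apply, Derivation.zero_apply]
    split_ifs <;> simp
  have := congrArg (fun D => D p) h
  simpa [Derivation.commutator_apply, sub_eq_zero] using this

/-- The operator `H ↦ (s - n) (∂ᵢ P) H + P ∂ᵢ H`, with `s = X 0`, for which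
`∂ᵢ (P^{s-n} H) = P^{s-n-1} · powDeriv P i n H` when `i ≠ 0`. -/
def powDeriv (P : MvPolynomial (Fin 3) ℂ) (i : Fin 3) (n : ℕ) (H : MvPolynomial (Fin 3) ℂ) :
    MvPolynomial (Fin 3) ℂ :=
  (MvPolynomial.X 0 - (n : MvPolynomial (Fin 3) ℂ)) * MvPolynomial.pderiv i P * H +
    P * MvPolynomial.pderiv i H

theorem powDeriv_comm (P H : MvPolynomial (Fin 3) ℂ) (n : ℕ) :
    powDeriv P 2 (n + 1) (powDeriv P 1 n H) = powDeriv P 1 (n + 1) (powDeriv P 2 n H) := by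
  have h1 : MvPolynomial.pderiv 1 (n : MvPolynomial (Fin 3) ℂ) = 0 := Derivation.map_natCast _ n
  have h2 : MvPolynomial.pderiv 2 (n : MvPolynomial (Fin 3) ℂ) = 0 := Derivation.map_natCast _ n
  simp only [powDeriv, map_add, map_sub, MvPolynomial.pderiv_mul, h1, h2,
    MvPolynomial.pderiv_X_of_ne (show (0 : Fin 3) ≠ 1 by decide),
    MvPolynomial.pderiv_X_of_ne (show (0 : Fin 3) ≠ 2 by decide)]
  rw [pderiv_comm 2 1 P, pderiv_comm 2 1 H]
  push_cast
  ring

/-- The polynomials `H i j` with `∂ₓⁱ ∂ₜʲ (P^s H) = P^{s-i-j} · H i j`. -/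
def powCoeff (P H : MvPolynomial (Fin 3) ℂ) : ℕ → ℕ → MvPolynomial (Fin 3) ℂ
  | i, 0 => Nat.rec H (fun i => powDeriv P 1 i) i
  | i, j + 1 => powDeriv P 2 (i + j) (powCoeff P H i j)

theorem powCoeff_succ_right (P H : MvPolynomial (Fin 3) ℂ) (i j : ℕ) :
    powCoeff P H i (j + 1) = powDeriv P 2 (i + j) (powCoeff P H i j) := rfl

theorem powCoeff_succ_left (P H : MvPolynomial (Fin 3) ℂ) (i j : ℕ) :
    powCoeff P H (i + 1) j = powDeriv P 1 (i + j) (powCoeff P H i j) := by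
  induction j with
  | zero => rfl
  | succ j ih =>
    rw [powCoeff_succ_right, powCoeff_succ_right, ih, show i + 1 + j = i + j + 1 by ring,
      powDeriv_comm]
    rfl

theorem cpow_sub_natCast_succ {x : ℂ} (hx : x ≠ 0) (s : ℂ) (n : ℕ) :
    x ^ (s - n) = x ^ (s - (n + 1 : ℕ)) * x := by
  rw [show s - (n : ℂ) = s - (n + 1 : ℕ) + 1 by push_cast; ring, Complex.cpow_add _ _ hx,
    Complex.cpow_one]

theorem hasDerivAt_cpow_mul_eval {P H : MvPolynomial (Fin 3) ℂ} {i : Fin 3} {s : ℂ}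
    {v : ℝ → Fin 3 → ℂ} {x : ℝ} (hv : ∀ j, HasDerivAt (fun z => v z j) (if j = i then 1 else 0) x)
    (hs : v x 0 = s) (hP : MvPolynomial.eval (v x) P ∈ Complex.slitPlane) (n : ℕ) :
    HasDerivAt (fun x => MvPolynomial.eval (v x) P ^ (s - n) * MvPolynomial.eval (v x) H)
      (MvPolynomial.eval (v x) P ^ (s - (n + 1 : ℕ)) *
        MvPolynomial.eval (v x) (powDeriv P i n H)) x := by
  have hd := fun p => hasDerivAt_mvPolynomial_eval p hv
  simp only [mul_ite, mul_one, mul_zero, Finset.sum_ite_eq', Finset.mem_univ, if_true] at hd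
  have h1 : HasDerivAt (fun x => MvPolynomial.eval (v x) P ^ (s - n))
      ((s - n) * MvPolynomial.eval (v x) P ^ (s - n - 1) *
        MvPolynomial.eval (v x) (MvPolynomial.pderiv i P)) x := by
    have := (Complex.hasStrictDerivAt_cpow_const (c := s - n) hP).hasDerivAt.scomp x (hd P)
    simpa [Function.comp_def, smul_eq_mul, mul_comm, mul_left_comm, mul_assoc] using this
  refine (h1.mul (hd H)).congr_deriv ?_
  rw [cpow_sub_natCast_succ (Complex.slitPlane_ne_zero hP),
    show s - (n : ℂ) - 1 = s - (n + 1 : ℕ) by push_cast; ring]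
  simp only [powDeriv, map_add, map_mul, map_sub, MvPolynomial.eval_X, map_natCast, hs]
  ring

/-- The first of the three variables of `P` and `H` is the parameter `s`; the derivatives of `P^s H`
are again a power of `P` times a polynomial. -/
theorem smoothFam₂_cpow_mul {P H : MvPolynomial (Fin 3) ℂ}
    (hP : ∀ s : ℂ, ∀ x ∈ Set.Icc (0 : ℝ) 1, ∀ t ∈ Set.Icc (0 : ℝ) 1,
      MvPolynomial.eval ![s, (x : ℂ), (t : ℂ)] P ∈ Complex.slitPlane) :
    SmoothFam₂ fun i j s x t =>
      MvPolynomial.eval ![s, (x : ℂ), (t : ℂ)] P ^ (s - (i + j : ℕ)) *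
        MvPolynomial.eval ![s, (x : ℂ), (t : ℂ)] (powCoeff P H i j) where
  cont i j := by
    have hv : Continuous fun p : ℂ × ℝ × ℝ => ![p.1, (p.2.1 : ℂ), (p.2.2 : ℂ)] := by
      refine continuous_pi fun i => ?_
      fin_cases i
      · exact continuous_fst
      · exact Complex.continuous_ofReal.comp (continuous_fst.comp continuous_snd)
      · exact Complex.continuous_ofReal.comp (continuous_snd.comp continuous_snd)
    have hc : ∀ Q : MvPolynomial (Fin 3) ℂ, Continuous fun p : ℂ × ℝ × ℝ =>
        MvPolynomial.eval ![p.1, (p.2.1 : ℂ), (p.2.2 : ℂ)] Q :=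
      fun Q => (MvPolynomial.continuous_eval Q).comp hv
    refine ContinuousOn.mul ?_ (hc _).continuousOn
    exact ContinuousOn.cpow (hc P).continuousOn (by fun_prop)
      fun p hp => hP p.1 p.2.1 hp.2.1 p.2.2 hp.2.2
  deriv_fst i j s x hx t ht := by
    have := hasDerivAt_cpow_mul_eval (i := 1) (s := s) (P := P) (H := powCoeff P H i j)
      (v := fun x : ℝ => ![s, (x : ℂ), (t : ℂ)]) (x := x) (fun j => ?_) rfl
      (hP s x (Set.Ioo_subset_Icc_self hx) t ht) (i + j)
    · rw [powCoeff_succ_left, show i + 1 + j = i + j + 1 by ring]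
      exact this
    · fin_cases j
      · simpa using hasDerivAt_const x s
      · simpa using (hasDerivAt_id x).ofReal_comp
      · simpa using hasDerivAt_const x (t : ℂ)
  deriv_snd i j s x hx t ht := by
    have := hasDerivAt_cpow_mul_eval (i := 2) (s := s) (P := P) (H := powCoeff P H i j)
      (v := fun t : ℝ => ![s, (x : ℂ), (t : ℂ)]) (x := t) (fun j => ?_) rfl
      (hP s x hx t (Set.Ioo_subset_Icc_self ht)) (i + j)
    · rw [powCoeff_succ_right, ← add_assoc]
      exact this
    · fin_cases j
      · simpa using hasDerivAt_const t s
      · simpa using hasDerivAt_const t (x : ℂ)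
      · simpa using (hasDerivAt_id t).ofReal_comp
  holo i j x hx t ht := by
    intro s
    have hd : ∀ Q : MvPolynomial (Fin 3) ℂ,
        DifferentiableAt ℂ (fun s => MvPolynomial.eval ![s, (x : ℂ), (t : ℂ)] Q) s := fun Q => by
      refine (hasDerivAt_mvPolynomial_eval (v := fun s : ℂ => ![s, (x : ℂ), (t : ℂ)])
        (v' := ![1, 0, 0]) Q fun j => ?_).differentiableAt
      fin_cases j
      · exact hasDerivAt_id s
      · simpa using hasDerivAt_const s (x : ℂ)
      · simpa using hasDerivAt_const s (t : ℂ)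
    exact ((hd P).cpow (by fun_prop) (hP s x hx t ht)).mul (hd _)

/-- The integrand of a local zeta integral with normal crossings on the unit square. -/
def squareIntegrand (P : MvPolynomial (Fin 2) ℝ) (H : MvPolynomial (Fin 2) ℂ) (z₁ z₂ s : ℂ)
    (p : ℝ × ℝ) : ℂ :=
  (p.1 : ℂ) ^ (z₁ - 1) * ((p.2 : ℂ) ^ (z₂ - 1) *
    (((MvPolynomial.eval ![p.1, p.2] P : ℝ) : ℂ) ^ s *
      MvPolynomial.eval ![(p.1 : ℂ), (p.2 : ℂ)] H))

theorem integrableOn_cpow_mul_cpow_mul {f : ℝ × ℝ → ℂ}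
    (hf : ContinuousOn f (Set.Icc 0 1 ×ˢ Set.Icc 0 1)) {z₁ z₂ : ℂ} (h1 : 0 < z₁.re)
    (h2 : 0 < z₂.re) :
    IntegrableOn (fun p : ℝ × ℝ => (p.1 : ℂ) ^ (z₁ - 1) * ((p.2 : ℂ) ^ (z₂ - 1) * f p))
      (Set.Ioo 0 1 ×ˢ Set.Ioo 0 1) := by
  obtain ⟨c, hc'⟩ := (isCompact_Icc.prod isCompact_Icc).exists_bound_of_continuousOn hf
  have hpow : ∀ w : ℂ, 0 < w.re →
      Integrable (fun t : ℝ => (t : ℂ) ^ (w - 1)) (volume.restrict (Set.Ioo 0 1)) :=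
    fun w hw => (intervalIntegrable_iff_integrableOn_Ioo_of_le zero_le_one).1
      (intervalIntegral.intervalIntegrable_cpow' (by simpa using hw))
  have hprod := (hpow _ h1).mul_prod (hpow _ h2)
  rw [Measure.prod_restrict, ← Measure.volume_eq_prod] at hprod
  have hmeas : MeasurableSet (Set.Ioo (0 : ℝ) 1 ×ˢ Set.Ioo (0 : ℝ) 1) :=
    measurableSet_Ioo.prod measurableSet_Ioo
  have hsub : Set.Ioo (0 : ℝ) 1 ×ˢ Set.Ioo (0 : ℝ) 1 ⊆ Set.Icc 0 1 ×ˢ Set.Icc 0 1 :=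
    Set.prod_mono Set.Ioo_subset_Icc_self Set.Ioo_subset_Icc_self
  have hbd : Integrable (fun p : ℝ × ℝ => (p.1 : ℂ) ^ (z₁ - 1) * (p.2 : ℂ) ^ (z₂ - 1) * f p)
      (volume.restrict (Set.Ioo 0 1 ×ˢ Set.Ioo 0 1)) :=
    hprod.mul_bdd (c := c) ((hf.mono hsub).aestronglyMeasurable hmeas)
      ((ae_restrict_iff' hmeas).2 (Eventually.of_forall fun p hp => hc' p (hsub hp)))
  rw [IntegrableOn]
  simpa only [mul_assoc] using hbd

theorem setIntegral_Ioo_prod_cpow_mul {k : ℝ → ℝ → ℂ}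
    (hk : ContinuousOn (fun p : ℝ × ℝ => k p.1 p.2) (Set.Icc 0 1 ×ˢ Set.Icc 0 1)) {z₁ z₂ : ℂ}
    (h1 : 0 < z₁.re) (h2 : 0 < z₂.re) :
    ∫ p in Set.Ioo (0 : ℝ) 1 ×ˢ Set.Ioo (0 : ℝ) 1,
        (p.1 : ℂ) ^ (z₁ - 1) * ((p.2 : ℂ) ^ (z₂ - 1) * k p.1 p.2) =
      ∫ x in (0 : ℝ)..1, (x : ℂ) ^ (z₁ - 1) *
        ∫ t in (0 : ℝ)..1, (t : ℂ) ^ (z₂ - 1) * k x t := by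
  rw [Measure.volume_eq_prod, setIntegral_prod _ (integrableOn_cpow_mul_cpow_mul hk h1 h2)]
  simp only [intervalIntegral.integral_of_le zero_le_one, integral_Ioc_eq_integral_Ioo,
    integral_const_mul]

/-- The integral over the unit square of `x^{z₁-1} t^{z₂-1} P^s H` is `Γ(z₁) Γ(z₂)` times an entire
function. Where `z₁ = 0` that function is the regularised integral of the restriction to `x = 0`. -/
theorem exists_entire_squareIntegrand {P : MvPolynomial (Fin 2) ℝ} (H : MvPolynomial (Fin 2) ℂ)
    (hP : ∀ x ∈ Set.Icc (0 : ℝ) 1, ∀ t ∈ Set.Icc (0 : ℝ) 1, 0 < MvPolynomial.eval ![x, t] P)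
    {z₁ z₂ : ℂ → ℂ} (hz₁ : Differentiable ℂ z₁) (hz₂ : Differentiable ℂ z₂) :
    ∃ E : ℂ → ℂ, Differentiable ℂ E ∧
      (∀ s, 0 < (z₁ s).re → 0 < (z₂ s).re →
        IntegrableOn (squareIntegrand P H (z₁ s) (z₂ s) s) (Set.Ioo 0 1 ×ˢ Set.Ioo 0 1) ∧
        ∫ p in Set.Ioo (0 : ℝ) 1 ×ˢ Set.Ioo (0 : ℝ) 1, squareIntegrand P H (z₁ s) (z₂ s) s p =
          Complex.Gamma (z₁ s) * Complex.Gamma (z₂ s) * E s) ∧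
      ∀ s, z₁ s = 0 → ∃ k : ℕ → ℝ → ℂ, IsDerivSeq k ∧
        (∀ t, k 0 t = ((MvPolynomial.eval ![0, t] P : ℝ) : ℂ) ^ s *
          MvPolynomial.eval ![0, (t : ℂ)] H) ∧
        E s = regInt k (z₂ s) := by
  let P' : MvPolynomial (Fin 3) ℂ :=
    MvPolynomial.rename ![1, 2] (MvPolynomial.map Complex.ofRealHom P)
  let H' : MvPolynomial (Fin 3) ℂ := MvPolynomial.rename ![1, 2] H
  have hcomp : ∀ a b c : ℂ, (![a, b, c] : Fin 3 → ℂ) ∘ (![1, 2] : Fin 2 → Fin 3) = ![b, c] := by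
    intro a b c
    ext i
    fin_cases i <;> rfl
  have hP' : ∀ (s : ℂ) (x t : ℝ), MvPolynomial.eval ![s, (x : ℂ), (t : ℂ)] P' =
      ((MvPolynomial.eval ![x, t] P : ℝ) : ℂ) := by
    intro s x t
    have h2 : (![(x : ℂ), (t : ℂ)] : Fin 2 → ℂ) = Complex.ofRealHom ∘ ![x, t] := by
      ext i
      fin_cases i <;> rfl
    rw [MvPolynomial.eval_rename, hcomp, h2, MvPolynomial.eval_map, ← MvPolynomial.eval₂_comp]
    rfl
  have hH' : ∀ (s : ℂ) (x t : ℝ), MvPolynomial.eval ![s, (x : ℂ), (t : ℂ)] H' =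
      MvPolynomial.eval ![(x : ℂ), (t : ℂ)] H := by
    intro s x t
    rw [MvPolynomial.eval_rename, hcomp]
  have hK := smoothFam₂_cpow_mul (P := P') (H := H') (fun s x hx t ht => by
    rw [hP']
    exact Complex.ofReal_mem_slitPlane.2 (hP x hx t ht))
  set K : ℕ → ℕ → ℂ → ℝ → ℝ → ℂ := fun i j s x t =>
      MvPolynomial.eval ![s, (x : ℂ), (t : ℂ)] P' ^ (s - (i + j : ℕ)) *
        MvPolynomial.eval ![s, (x : ℂ), (t : ℂ)] (powCoeff P' H' i j) with hKdef
  have hK0 : ∀ (s : ℂ) (x t : ℝ), K 0 0 s x t = ((MvPolynomial.eval ![x, t] P : ℝ) : ℂ) ^ s *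
      MvPolynomial.eval ![(x : ℂ), (t : ℂ)] H := by
    intro s x t
    simp only [hKdef, hP', powCoeff, add_zero, Nat.cast_zero, sub_zero]
    exact congrArg _ (hH' s x t)
  clear_value K
  have hL := hK.smoothFam_regInt hz₂
  refine ⟨_, hL.differentiable_regInt hz₁, fun s h1 h2 => ?_, fun s h1 => ?_⟩
  · have hc : ContinuousOn (fun p : ℝ × ℝ => K 0 0 s p.1 p.2) (Set.Icc 0 1 ×ˢ Set.Icc 0 1) :=
      (hK.cont 0 0).comp
        (by fun_prop : Continuous fun p : ℝ × ℝ => (s, p.1, p.2)).continuousOn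
        fun p hp => ⟨Set.mem_univ _, hp⟩
    have heq : squareIntegrand P H (z₁ s) (z₂ s) s = fun p : ℝ × ℝ =>
        (p.1 : ℂ) ^ (z₁ s - 1) * ((p.2 : ℂ) ^ (z₂ s - 1) * K 0 0 s p.1 p.2) := by
      ext p
      rw [hK0]
      rfl
    rw [heq]
    refine ⟨integrableOn_cpow_mul_cpow_mul hc h1 h2, ?_⟩
    rw [setIntegral_Ioo_prod_cpow_mul hc h1 h2]
    have hG1 := Complex.Gamma_ne_zero_of_re_pos h1
    have hG2 := Complex.Gamma_ne_zero_of_re_pos h2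
    rw [regInt_of_re_pos (hL.isDerivSeq s) h1]
    have outer : (∫ x in (0 : ℝ)..1, (x : ℂ) ^ (z₁ s - 1) * regInt (fun j => K 0 j s x) (z₂ s)) =
        (Complex.Gamma (z₂ s))⁻¹ * ∫ x in (0 : ℝ)..1, (x : ℂ) ^ (z₁ s - 1) *
          ∫ t in (0 : ℝ)..1, (t : ℂ) ^ (z₂ s - 1) * K 0 0 s x t := by
      rw [← intervalIntegral.integral_const_mul]
      refine intervalIntegral.integral_congr fun x hx => ?_
      rw [Set.uIcc_of_le zero_le_one] at hx
      simp only [regInt_of_re_pos ((hK.section_fst 0 hx).isDerivSeq s) h2]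
      ring
    rw [outer]
    generalize (∫ x in (0 : ℝ)..1, (x : ℂ) ^ (z₁ s - 1) *
          ∫ t in (0 : ℝ)..1, (t : ℂ) ^ (z₂ s - 1) * K 0 0 s x t) = I
    field_simp
  · refine ⟨fun j => K 0 j s 0, (hK.section_fst 0 (by simp)).isDerivSeq s, fun t => ?_, ?_⟩
    · exact (hK0 s 0 t).trans (by rw [Complex.ofReal_zero])
    · simp only [h1]
      exact regInt_zero (hL.isDerivSeq s)

/-! ### Incomplete beta integrals -/

theorem ofReal_cpow_eq_exp {x : ℝ} (hx : 0 < x) (a : ℂ) :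
    (x : ℂ) ^ a = Complex.exp (a * (Real.log x : ℝ)) := by
  rw [Complex.cpow_def_of_ne_zero (by exact_mod_cast hx.ne'), Complex.ofReal_log hx.le, mul_comm]

theorem continuousOn_ofReal_cpow_const {f : ℝ → ℝ} (hf : Continuous f)
    (hpos : ∀ t ∈ Set.Icc (0 : ℝ) 1, 0 < f t) (a : ℂ) :
    ContinuousOn (fun t => (f t : ℂ) ^ a) (Set.Icc 0 1) :=
  ContinuousOn.cpow (Complex.continuous_ofReal.comp hf).continuousOn continuousOn_const
    fun t ht => Complex.ofReal_mem_slitPlane.2 (hpos t ht)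

theorem hasDerivAt_ofReal_cpow {f : ℝ → ℝ} {f' t : ℝ} (hf : HasDerivAt f f' t) (hpos : 0 < f t)
    (a : ℂ) : HasDerivAt (fun t => (f t : ℂ) ^ a) (a * (f t : ℂ) ^ (a - 1) * f') t := by
  have := (Complex.hasStrictDerivAt_cpow_const (c := a)
    (Complex.ofReal_mem_slitPlane.2 hpos)).hasDerivAt.scomp t hf.ofReal_comp
  simpa [Function.comp_def, smul_eq_mul, mul_comm, mul_left_comm, mul_assoc] using this

/-- The substitution `x = c t^n / (1 + c t^n)` in an incomplete beta integral. -/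
theorem integral_beta_lower {c : ℝ} (hc : 0 < c) {n : ℕ} (hn : 0 < n) {u w : ℂ} (hu : 0 < u.re)
    (hw : 0 < w.re) :
    (n : ℂ) * (c : ℂ) ^ u * ∫ t in (0 : ℝ)..1,
        (t : ℂ) ^ (n * u - 1) * ((1 + c * t ^ n : ℝ) : ℂ) ^ (-u - w) =
      ∫ x in (0 : ℝ)..(c / (1 + c)), (x : ℂ) ^ (u - 1) * (1 - (x : ℂ)) ^ (w - 1) := by
  set g : ℝ → ℂ := fun x => (x : ℂ) ^ (u - 1) * (1 - (x : ℂ)) ^ (w - 1) with hg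
  set φ : ℝ → ℝ := fun t => c * t ^ n / (1 + c * t ^ n) with hφ
  have hden : ∀ t : ℝ, 0 ≤ t → 0 < 1 + c * t ^ n := fun t ht => by positivity
  have hn' : (0 : ℝ) < n := by exact_mod_cast hn
  have hφ' : ∀ t : ℝ, 0 ≤ t →
      HasDerivAt φ (c * (n * t ^ (n - 1)) / (1 + c * t ^ n) ^ 2) t := by
    intro t ht
    have h1 : HasDerivAt (fun t : ℝ => c * t ^ n) (c * (n * t ^ (n - 1))) t :=
      (hasDerivAt_pow n t).const_mul c
    refine (h1.div (h1.const_add 1) (hden t ht).ne').congr_deriv ?_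
    ring
  -- both sides are compared as exponentials of combinations of logarithms
  have hpt : ∀ t ∈ Set.Ioo (0 : ℝ) 1, (c * (n * t ^ (n - 1)) / (1 + c * t ^ n) ^ 2) • (g ∘ φ) t =
      (n : ℂ) * (c : ℂ) ^ u * ((t : ℂ) ^ (n * u - 1) *
        ((1 + c * t ^ n : ℝ) : ℂ) ^ (-u - w)) := by
    intro t ht
    have hd := hden t ht.1.le
    have hφt : φ t = Real.exp (Real.log c + n * Real.log t - Real.log (1 + c * t ^ n)) := by
      rw [Real.exp_sub, Real.exp_add, Real.exp_log hc, Real.exp_log hd, ← Real.log_pow,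
        Real.exp_log (pow_pos ht.1 n)]
    have hφt' : 1 - φ t = Real.exp (-Real.log (1 + c * t ^ n)) := by
      rw [Real.exp_neg, Real.exp_log hd]
      simp only [hφ]
      field_simp
      ring
    have hder : c * (n * t ^ (n - 1)) / (1 + c * t ^ n) ^ 2 =
        n * Real.exp (Real.log c + (n - 1) * Real.log t - 2 * Real.log (1 + c * t ^ n)) := by
      have h2 : Real.exp (2 * Real.log (1 + c * t ^ n)) = (1 + c * t ^ n) ^ 2 := by
        rw [two_mul, Real.exp_add, Real.exp_log hd]
        ring
      have h3 : Real.exp (((n : ℝ) - 1) * Real.log t) = t ^ (n - 1) := by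
        rw [← Nat.cast_pred hn, ← Real.log_pow, Real.exp_log (pow_pos ht.1 _)]
      rw [Real.exp_sub, Real.exp_add, Real.exp_log hc, h2, h3]
      ring
    rw [hder]
    simp only [hg, Function.comp_apply]
    rw [show (1 : ℂ) - (φ t : ℂ) = ((1 - φ t : ℝ) : ℂ) by push_cast; rfl, hφt', hφt,
      ofReal_cpow_eq_exp (Real.exp_pos _), ofReal_cpow_eq_exp (Real.exp_pos _),
      ofReal_cpow_eq_exp hc, ofReal_cpow_eq_exp ht.1, ofReal_cpow_eq_exp hd, Real.log_exp,
      Real.log_exp, Complex.real_smul, Complex.ofReal_mul, Complex.ofReal_exp,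
      Complex.ofReal_natCast]
    simp only [mul_assoc, ← Complex.exp_add]
    congr 2
    push_cast
    ring
  have hint : IntervalIntegrable (fun t : ℝ => (n : ℂ) * (c : ℂ) ^ u * ((t : ℂ) ^ (n * u - 1) *
        ((1 + c * t ^ n : ℝ) : ℂ) ^ (-u - w))) volume 0 1 := by
    refine IntervalIntegrable.const_mul (intervalIntegrable_cpow_mul ?_ ?_) _
    · exact continuousOn_ofReal_cpow_const (f := fun t => 1 + c * t ^ n) (by fun_prop)
        (fun t ht => hden t ht.1) _
    · simpa [hn] using hu
  have hgint : IntegrableOn g (Set.Ioo 0 1) :=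
    (intervalIntegrable_iff_integrableOn_Ioo_of_le zero_le_one).1
      (Complex.betaIntegral_convergent hu hw)
  have hφmem : ∀ t ∈ Set.Icc (0 : ℝ) 1, φ t ∈ Set.Ico (0 : ℝ) 1 := by
    intro t ht
    have := hden t ht.1
    have h0 : 0 ≤ c * t ^ n := mul_nonneg hc.le (pow_nonneg ht.1 n)
    exact ⟨by positivity, by rw [div_lt_one this]; linarith⟩
  have key := intervalIntegral.integral_deriv_smul_comp''' (a := 0) (b := 1) (f := φ)
    (f' := fun t => c * (n * t ^ (n - 1)) / (1 + c * t ^ n) ^ 2) (g := g)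
    (by
      rw [Set.uIcc_of_le zero_le_one]
      exact fun t ht => (hφ' t ht.1).continuousAt.continuousWithinAt)
    (by
      intro t ht
      simp only [zero_le_one, inf_of_le_left, sup_of_le_right] at ht
      exact (hφ' t ht.1.le).hasDerivWithinAt)
    (by
      simp only [zero_le_one, inf_of_le_left, sup_of_le_right]
      rintro x ⟨t, ht, rfl⟩
      have h1 := hφmem t (Set.Ioo_subset_Icc_self ht)
      have h0 : 0 < φ t := div_pos (mul_pos hc (pow_pos ht.1 n)) (hden t ht.1.le)
      refine ContinuousAt.continuousWithinAt ?_
      refine ContinuousAt.mul ?_ ?_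
      · exact Complex.continuousAt_ofReal_cpow_const _ _ (Or.inr h0.ne')
      · refine ContinuousAt.cpow (by fun_prop) continuousAt_const ?_
        rw [← Complex.ofReal_one, ← Complex.ofReal_sub]
        exact Complex.ofReal_mem_slitPlane.2 (by linarith [h1.2]))
    (by
      rw [Set.uIcc_of_le zero_le_one]
      refine (((integrableOn_Icc_iff_integrableOn_Ioo).2 hgint)).mono_set ?_
      rintro x ⟨t, ht, rfl⟩
      exact Set.Ico_subset_Icc_self (hφmem t ht))
    (by
      rw [Set.uIcc_of_le zero_le_one, integrableOn_Icc_iff_integrableOn_Ioo]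
      exact ((intervalIntegrable_iff_integrableOn_Ioo_of_le zero_le_one).1 hint).congr_fun
        (fun t ht => (hpt t ht).symm) measurableSet_Ioo)
  have e0 : φ 0 = 0 := by simp [hφ, hn.ne']
  have e1 : φ 1 = c / (1 + c) := by simp [hφ]
  rw [e0, e1] at key
  rw [← key, ← intervalIntegral.integral_const_mul]
  simp only [intervalIntegral.integral_of_le zero_le_one, integral_Ioc_eq_integral_Ioo]
  exact setIntegral_congr_fun measurableSet_Ioo fun t ht => (hpt t ht).symm

/-! ### The beta function as a sum of two regularised integrals -/

/-- The complementary integral is obtained from `integral_beta_lower` by `x ↦ 1 - x`, `c ↦ c⁻¹`. -/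
theorem integral_beta_upper {c : ℝ} (hc : 0 < c) {q : ℕ} (hq : 0 < q) {u w : ℂ} (hu : 0 < u.re)
    (hw : 0 < w.re) :
    (q : ℂ) * (c : ℂ) ^ u * ∫ t in (0 : ℝ)..1,
        (t : ℂ) ^ (q * w - 1) * ((c + t ^ q : ℝ) : ℂ) ^ (-u - w) =
      ∫ x in (c / (1 + c))..(1 : ℝ), (x : ℂ) ^ (u - 1) * (1 - (x : ℂ)) ^ (w - 1) := by
  have h := integral_beta_lower (inv_pos.2 hc) hq hw hu
  have e1 : c⁻¹ / (1 + c⁻¹) = 1 - c / (1 + c) := by field_simp; ring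
  have h2 := intervalIntegral.integral_comp_sub_left (a := c / (1 + c)) (b := 1)
    (fun x : ℝ => (x : ℂ) ^ (w - 1) * (1 - (x : ℂ)) ^ (u - 1)) 1
  rw [e1] at h
  rw [sub_self, ← h] at h2
  rw [show (∫ x in (c / (1 + c))..(1 : ℝ), (x : ℂ) ^ (u - 1) * (1 - (x : ℂ)) ^ (w - 1)) =
      ∫ x in (c / (1 + c))..(1 : ℝ), ((1 - x : ℝ) : ℂ) ^ (w - 1) *
        (1 - ((1 - x : ℝ) : ℂ)) ^ (u - 1) from
    intervalIntegral.integral_congr fun x _ => by simp [mul_comm], h2]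
  simp only [← intervalIntegral.integral_const_mul]
  refine intervalIntegral.integral_congr_uIoo fun t ht => ?_
  rw [Set.uIoo_of_le zero_le_one] at ht
  have ht0 : 0 < c + t ^ q := add_pos hc (pow_pos ht.1 q)
  have e2 : 1 + c⁻¹ * t ^ q = c⁻¹ * (c + t ^ q) := by field_simp
  rw [e2, ofReal_cpow_eq_exp hc, ofReal_cpow_eq_exp (inv_pos.2 hc), ofReal_cpow_eq_exp ht.1,
    ofReal_cpow_eq_exp ht0, ofReal_cpow_eq_exp (mul_pos (inv_pos.2 hc) ht0),
    Real.log_mul (inv_pos.2 hc).ne' ht0.ne', Real.log_inv]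
  simp only [mul_assoc, ← Complex.exp_add]
  congr 2
  push_cast
  ring

/-- The two incomplete integrals add up to a beta integral in the region of convergence. -/
theorem integral_beta_add {c : ℝ} (hc : 0 < c) {n q : ℕ} (hn : 0 < n) (hq : 0 < q) {u w : ℂ}
    (hu : 0 < u.re) (hw : 0 < w.re) :
    (n : ℂ) * (∫ t in (0 : ℝ)..1,
        (t : ℂ) ^ (n * u - 1) * ((1 + c * t ^ n : ℝ) : ℂ) ^ (-u - w)) +
      (q : ℂ) * (∫ t in (0 : ℝ)..1,
        (t : ℂ) ^ (q * w - 1) * ((c + t ^ q : ℝ) : ℂ) ^ (-u - w)) =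
      (c : ℂ) ^ (-u) * betaFn u w := by
  have h1 := integral_beta_lower hc hn hu hw
  have h2 := integral_beta_upper hc hq hu hw
  have hint := Complex.betaIntegral_convergent hu hw
  have hmem : c / (1 + c) ∈ Set.uIcc (0 : ℝ) 1 := by
    rw [Set.uIcc_of_le zero_le_one]
    exact ⟨by positivity, by rw [div_le_one (by positivity)]; linarith⟩
  have hsum := intervalIntegral.integral_add_adjacent_intervals
    (hint.mono_set (Set.uIcc_subset_uIcc_left hmem))
    (hint.mono_set (Set.uIcc_subset_uIcc_right hmem))
  have hG := Complex.Gamma_mul_Gamma_eq_betaIntegral hu hw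
  have hne := Complex.Gamma_ne_zero_of_re_pos (s := u + w)
    (by rw [Complex.add_re]; exact add_pos hu hw)
  rw [Complex.betaIntegral, ← hsum, ← h1, ← h2] at hG
  have hcu : (c : ℂ) ^ u ≠ 0 := by
    rw [ofReal_cpow_eq_exp hc]
    exact Complex.exp_ne_zero _
  rw [betaFn, hG, Complex.cpow_neg]
  field_simp

/-- Integration by parts, in the first half of the beta integral, for the shift of the exponent `a`
by one. -/
theorem integral_lower_step {c : ℝ} (hc : 0 < c) {n : ℕ} (hn : 0 < n) {u : ℂ} (hu : 0 < u.re)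
    (a : ℂ) :
    (u + a) * ((n : ℂ) * ∫ t in (0 : ℝ)..1,
        (t : ℂ) ^ (n * u - 1) * ((1 + c * t ^ n : ℝ) : ℂ) ^ a) =
      ((1 + c : ℝ) : ℂ) ^ a + a * ((n : ℂ) * ∫ t in (0 : ℝ)..1,
        (t : ℂ) ^ (n * u - 1) * ((1 + c * t ^ n : ℝ) : ℂ) ^ (a - 1)) := by
  have hden : ∀ t ∈ Set.Icc (0 : ℝ) 1, 0 < 1 + c * t ^ n := fun t ht => by
    have := ht.1
    positivity
  have hcont : ∀ b : ℂ, ContinuousOn (fun t : ℝ => ((1 + c * t ^ n : ℝ) : ℂ) ^ b) (Set.Icc 0 1) :=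
    fun b => continuousOn_ofReal_cpow_const (f := fun t => 1 + c * t ^ n) (by fun_prop) hden b
  have hnu : 0 < ((n : ℂ) * u).re := by simpa [hn] using hu
  have hu0 : (n : ℂ) * u ≠ 0 := by intro h; simp [h] at hnu
  have hder : ∀ t ∈ Set.Ioo (0 : ℝ) 1, HasDerivAt (fun t : ℝ => ((1 + c * t ^ n : ℝ) : ℂ) ^ a)
      (a * ((1 + c * t ^ n : ℝ) : ℂ) ^ (a - 1) * (c * (n * t ^ (n - 1)) : ℝ)) t := fun t ht =>
    hasDerivAt_ofReal_cpow (((hasDerivAt_pow n t).const_mul c).const_add 1)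
      (hden t (Set.Ioo_subset_Icc_self ht)) a
  have hcont' : ContinuousOn (fun t : ℝ => a * ((1 + c * t ^ n : ℝ) : ℂ) ^ (a - 1) *
      (c * (n * t ^ (n - 1)) : ℝ)) (Set.uIcc 0 1) := by
    rw [Set.uIcc_of_le zero_le_one]
    exact (continuousOn_const.mul (hcont _)).mul (by fun_prop)
  have h := integral_cpow_mul_by_parts (hcont a) hder hcont'.intervalIntegrable hnu
  have h2 : (∫ t in (0 : ℝ)..1, (t : ℂ) ^ ((n : ℂ) * u) *
      (a * ((1 + c * t ^ n : ℝ) : ℂ) ^ (a - 1) * (c * (n * t ^ (n - 1)) : ℝ))) =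
      a * ((n : ℂ) * ∫ t in (0 : ℝ)..1, (t : ℂ) ^ (n * u - 1) * ((1 + c * t ^ n : ℝ) : ℂ) ^ a) -
      a * ((n : ℂ) * ∫ t in (0 : ℝ)..1,
        (t : ℂ) ^ (n * u - 1) * ((1 + c * t ^ n : ℝ) : ℂ) ^ (a - 1)) := by
    simp only [← intervalIntegral.integral_const_mul]
    rw [← intervalIntegral.integral_sub
      (((intervalIntegrable_cpow_mul (hcont a) hnu).const_mul _).const_mul _)
      (((intervalIntegrable_cpow_mul (hcont (a - 1)) hnu).const_mul _).const_mul _)]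
    refine intervalIntegral.integral_congr_uIoo fun t ht => ?_
    rw [Set.uIoo_of_le zero_le_one] at ht
    have hd := hden t (Set.Ioo_subset_Icc_self ht)
    have htc : (t : ℂ) ≠ 0 := by exact_mod_cast ht.1.ne'
    have hdc : ((1 + c * t ^ n : ℝ) : ℂ) ≠ 0 := by exact_mod_cast hd.ne'
    have e1 : (t : ℂ) ^ ((n : ℂ) * u) = (t : ℂ) ^ ((n : ℂ) * u - 1) * t := by
      rw [Complex.cpow_sub _ _ htc, Complex.cpow_one]
      field_simp
    have e2 : ((1 + c * t ^ n : ℝ) : ℂ) ^ a =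
        ((1 + c * t ^ n : ℝ) : ℂ) ^ (a - 1) * ((1 + c * t ^ n : ℝ) : ℂ) := by
      rw [Complex.cpow_sub _ _ hdc, Complex.cpow_one]
      field_simp
    obtain ⟨m, rfl⟩ : ∃ m, n = m + 1 := ⟨n - 1, by omega⟩
    simp only [e1, e2]
    rw [Nat.add_sub_cancel]
    push_cast
    ring
  rw [h2, eq_div_iff hu0] at h
  simp only [one_pow, mul_one] at h
  linear_combination h

/-- Integration by parts, in the second half of the beta integral, expresses the regularised
integral on `-q < re z` by a convergent one. -/
theorem integral_upper_step {c : ℝ} (hc : 0 < c) {q : ℕ} (hq : 0 < q) (a h : ℂ)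
    {k : ℕ → ℝ → ℂ} (hk : IsDerivSeq k) (hk0 : ∀ t, k 0 t = ((c + t ^ q : ℝ) : ℂ) ^ a * h) {z : ℂ}
    (hz : -(q : ℝ) < z.re) :
    regInt k z = (Complex.Gamma (z + 1))⁻¹ * (h * (((c + 1 : ℝ) : ℂ) ^ a - a * ((q : ℂ) *
      ∫ t in (0 : ℝ)..1, (t : ℂ) ^ (z + q - 1) * ((c + t ^ q : ℝ) : ℂ) ^ (a - 1)))) := by
  have hden : ∀ t ∈ Set.Icc (0 : ℝ) 1, 0 < c + t ^ q := fun t ht => by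
    have := ht.1
    positivity
  have hcont : ∀ b : ℂ, ContinuousOn (fun t : ℝ => ((c + t ^ q : ℝ) : ℂ) ^ b) (Set.Icc 0 1) :=
    fun b => continuousOn_ofReal_cpow_const (f := fun t => c + t ^ q) (by fun_prop) hden b
  have hpos : ∀ z : ℂ, 0 < z.re → regInt k z = (Complex.Gamma (z + 1))⁻¹ * (h *
      (((c + 1 : ℝ) : ℂ) ^ a - a * ((q : ℂ) *
      ∫ t in (0 : ℝ)..1, (t : ℂ) ^ (z + q - 1) * ((c + t ^ q : ℝ) : ℂ) ^ (a - 1)))) := by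
    intro z hz
    have hz0 : z ≠ 0 := by rintro rfl; simp at hz
    have hder : ∀ t ∈ Set.Ioo (0 : ℝ) 1, HasDerivAt (fun t : ℝ => ((c + t ^ q : ℝ) : ℂ) ^ a)
        (a * ((c + t ^ q : ℝ) : ℂ) ^ (a - 1) * (q * t ^ (q - 1) : ℝ)) t := fun t ht =>
      hasDerivAt_ofReal_cpow ((hasDerivAt_pow q t).const_add c)
        (hden t (Set.Ioo_subset_Icc_self ht)) a
    have hcont' : ContinuousOn (fun t : ℝ => a * ((c + t ^ q : ℝ) : ℂ) ^ (a - 1) *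
        (q * t ^ (q - 1) : ℝ)) (Set.uIcc 0 1) := by
      rw [Set.uIcc_of_le zero_le_one]
      exact (continuousOn_const.mul (hcont _)).mul (by fun_prop)
    have hparts := integral_cpow_mul_by_parts (hcont a) hder hcont'.intervalIntegrable hz
    have h2 : (∫ t in (0 : ℝ)..1, (t : ℂ) ^ z *
        (a * ((c + t ^ q : ℝ) : ℂ) ^ (a - 1) * (q * t ^ (q - 1) : ℝ))) =
        a * ((q : ℂ) * ∫ t in (0 : ℝ)..1,
          (t : ℂ) ^ (z + q - 1) * ((c + t ^ q : ℝ) : ℂ) ^ (a - 1)) := by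
      simp only [← intervalIntegral.integral_const_mul]
      refine intervalIntegral.integral_congr_uIoo fun t ht => ?_
      rw [Set.uIoo_of_le zero_le_one] at ht
      have htc : (t : ℂ) ≠ 0 := by exact_mod_cast ht.1.ne'
      obtain ⟨m, rfl⟩ : ∃ m, q = m + 1 := ⟨q - 1, by omega⟩
      have e1 : (t : ℂ) ^ (z + ((m + 1 : ℕ) : ℂ) - 1) = (t : ℂ) ^ z * (t : ℂ) ^ m := by
        rw [← Complex.cpow_natCast, ← Complex.cpow_add _ _ htc]
        congr 1
        push_cast
        ring
      simp only [e1]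
      rw [Nat.add_sub_cancel]
      push_cast
      ring
    rw [regInt_of_re_pos hk hz, Complex.Gamma_add_one _ hz0]
    simp only [hk0, ← mul_assoc]
    rw [intervalIntegral.integral_mul_const, hparts, h2]
    simp only [one_pow]
    field_simp
  -- both sides are holomorphic on the half-plane, and agree where `0 < re z`
  set U : Set ℂ := {z | -(q : ℝ) < z.re} with hU
  have hUo : IsOpen U := isOpen_lt continuous_const Complex.continuous_re
  have hUc : Convex ℝ U := convex_halfSpace_re_gt _
  have hf : AnalyticOnNhd ℂ (regInt k) U := by
    refine DifferentiableOn.analyticOnNhd ?_ hUo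
    refine Differentiable.differentiableOn ?_
    have hS : SmoothFam fun j (_ : ℂ) t => k j t :=
      { cont := fun j => (hk.cont j).comp continuousOn_snd fun p hp => hp.2
        deriv := fun j _ t ht => hk.deriv j t ht
        holo := fun j t _ => differentiable_const _ }
    exact hS.differentiable_regInt differentiable_id
  have hg : AnalyticOnNhd ℂ (fun z : ℂ => (Complex.Gamma (z + 1))⁻¹ * (h *
      (((c + 1 : ℝ) : ℂ) ^ a - a * ((q : ℂ) *
      ∫ t in (0 : ℝ)..1, (t : ℂ) ^ (z + q - 1) * ((c + t ^ q : ℝ) : ℂ) ^ (a - 1))))) U := by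
    refine DifferentiableOn.analyticOnNhd (fun z hz => ?_) hUo
    refine DifferentiableAt.differentiableWithinAt ?_
    refine DifferentiableAt.mul ?_ ?_
    · exact (Complex.differentiable_one_div_Gamma.comp (differentiable_id.add_const 1)) z
    · refine DifferentiableAt.const_mul (DifferentiableAt.const_sub
        (DifferentiableAt.const_mul (DifferentiableAt.const_mul ?_ _) _) _) _
      refine differentiableAt_integral_cpow_mul
        (k := fun _ t => ((c + t ^ q : ℝ) : ℂ) ^ (a - 1)) (w := fun z => z + q)
        ((hcont (a - 1)).comp continuousOn_snd fun p hp => hp.2) (fun t _ => differentiable_const _)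
        (differentiable_id.add_const _) ?_
      simp only [Complex.add_re, Complex.natCast_re]
      have : -(q : ℝ) < z.re := hz
      linarith
  refine hf.eqOn_of_preconnected_of_eventuallyEq hg hUc.isPreconnected (z₀ := 1) ?_ ?_ hz
  · simp only [hU, Set.mem_ofPred_eq, Complex.one_re]
    have : (0 : ℝ) ≤ q := Nat.cast_nonneg q
    linarith
  · have : ∀ᶠ z : ℂ in 𝓝 1, 0 < z.re :=
      Complex.continuous_re.continuousAt.eventually (lt_mem_nhds (by simp))
    filter_upwards [this] with z hz using hpos z hz

/-- The two regularised integrals over the exceptional curve add up to a value of the beta function.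
Integration by parts replaces `v` by `v + 1`, where the integrals converge; the boundary terms
`(1 + c)^α` cancel. -/
theorem residue_eq_betaFn {c : ℝ} (hc : 0 < c) {n q : ℕ} (hn : 0 < n) (hq : 0 < q) {u v α h : ℂ}
    (hα : α = -u - v) (hu : 0 < u.re) (hv : -1 < v.re) (huv : 0 < (u + v).re)
    (hqv : ∀ ν : ℕ, (q : ℂ) * v ≠ -ν)
    {k₁ k₂ : ℕ → ℝ → ℂ} (hk₁ : IsDerivSeq k₁) (hk₂ : IsDerivSeq k₂)
    (h₁ : ∀ t, k₁ 0 t = ((1 + c * t ^ n : ℝ) : ℂ) ^ α * h)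
    (h₂ : ∀ t, k₂ 0 t = ((c + t ^ q : ℝ) : ℂ) ^ α * h) :
    (n : ℂ) * (Complex.Gamma (n * u) * regInt k₁ (n * u)) +
      (q : ℂ) * (Complex.Gamma (q * v) * regInt k₂ (q * v)) =
      h * ((c : ℂ) ^ (-u) * betaFn u v) := by
  have hv0 : v ≠ 0 := by
    rintro rfl
    exact hqv 0 (by simp)
  have hq0 : (q : ℂ) ≠ 0 := by exact_mod_cast hq.ne'
  have huv0 : u + v ≠ 0 := by intro h; simp [h] at huv
  have hG2 : Complex.Gamma (q * v) ≠ 0 := Complex.Gamma_ne_zero hqv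
  have hnu : 0 < ((n : ℂ) * u).re := by simpa [hn] using hu
  have hqv' : -(q : ℝ) < ((q : ℂ) * v).re := by
    have : (0 : ℝ) < q := by exact_mod_cast hq
    simp only [Complex.mul_re, Complex.natCast_re, Complex.natCast_im, zero_mul, sub_zero]
    nlinarith
  have s1 := integral_lower_step hc hn hu α
  have s2 := integral_upper_step hc hq α h hk₂ h₂ hqv'
  have s3 := integral_beta_add hc hn hq hu (w := v + 1)
    (by rw [Complex.add_re, Complex.one_re]; linarith)
  rw [show -u - (v + 1) = α - 1 by rw [hα]; ring,
    show (q : ℂ) * (v + 1) = q * v + q by ring] at s3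
  rw [Complex.Gamma_add_one _ (mul_ne_zero hq0 hv0)] at s2
  rw [regInt_of_re_pos hk₁ hnu, s2]
  simp only [h₁, ← mul_assoc]
  rw [intervalIntegral.integral_mul_const]
  have hb : betaFn u (v + 1) * (u + v) = v * betaFn u v := by
    rw [betaFn, betaFn, ← add_assoc, Complex.Gamma_add_one _ hv0, Complex.Gamma_add_one _ huv0]
    have := Complex.Gamma_ne_zero_of_re_pos huv
    field_simp
  have hG1 := Complex.Gamma_ne_zero_of_re_pos hnu
  rw [add_comm c 1]
  have hua : u + α = -v := by rw [hα]; ring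
  rw [hua] at s1
  generalize (∫ t in (0 : ℝ)..1,
    (t : ℂ) ^ (n * u - 1) * ((1 + c * t ^ n : ℝ) : ℂ) ^ α) = I₁ at *
  generalize (∫ t in (0 : ℝ)..1,
    (t : ℂ) ^ (n * u - 1) * ((1 + c * t ^ n : ℝ) : ℂ) ^ (α - 1)) = I₂ at *
  generalize (∫ t in (0 : ℝ)..1,
    (t : ℂ) ^ (q * v + q - 1) * ((c + t ^ q : ℝ) : ℂ) ^ (α - 1)) = I₃ at *
  have hα' : α = -(u + v) := by rw [hα]; ring
  field_simp
  linear_combination (-h) * s1 + h * (u + v) * s3 + h * (c : ℂ) ^ (-u) * hb -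
    h * (n * I₂ + q * I₃) * hα'

/-! ### The Newton polygon of the pulled back polynomial -/

/-- A nonzero polynomial with at most `N` terms has no nonzero root of multiplicity `N`, in
characteristic zero. -/
theorem eq_zero_of_support_card_le {K : Type*} [Field K] [CharZero K] {a : K} (ha : a ≠ 0) (N : ℕ) :
    ∀ p : Polynomial K, p.support.card ≤ N → (Polynomial.X - Polynomial.C a) ^ N ∣ p → p = 0 := by
  induction N with
  | zero =>
    intro p hp _
    exact Polynomial.support_eq_empty.1 (Finset.card_eq_zero.1 (Nat.le_zero.1 hp))
  | succ N ih =>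
    intro p hp hdvd
    by_contra hp0
    set d := p.natDegree with hd
    -- the Euler operator minus the degree removes the leading term
    obtain ⟨r, hr⟩ : ∃ r, r = Polynomial.X * Polynomial.derivative p - Polynomial.C (d : K) * p :=
      ⟨_, rfl⟩
    have hcoeff : ∀ k, r.coeff k = ((k : K) - d) * p.coeff k := by
      intro k
      rw [hr, Polynomial.coeff_sub, Polynomial.coeff_C_mul]
      cases k with
      | zero => simp
      | succ k =>
        rw [Polynomial.coeff_X_mul, Polynomial.coeff_derivative]
        push_cast
        ring
    have hsupp : r.support ⊆ p.support.erase d := by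
      intro k hk
      rw [Polynomial.mem_support_iff, hcoeff] at hk
      rw [Finset.mem_erase, Polynomial.mem_support_iff]
      exact ⟨fun h => hk (by rw [h]; ring), fun h => hk (by rw [h]; ring)⟩
    have hcard : r.support.card ≤ N := by
      refine (Finset.card_le_card hsupp).trans ?_
      rw [Finset.card_erase_of_mem (Polynomial.natDegree_mem_support_of_nonzero hp0)]
      omega
    have hr0 : r = 0 := by
      have h1 := Polynomial.pow_sub_one_dvd_derivative_of_pow_dvd hdvd
      rw [Nat.add_sub_cancel] at h1
      have h2 := (pow_dvd_pow (Polynomial.X - Polynomial.C a) (Nat.le_succ N)).trans hdvd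
      refine ih r hcard ?_
      rw [hr]
      exact dvd_sub (Dvd.dvd.mul_left h1 _) (Dvd.dvd.mul_left h2 _)
    have hmono : p = Polynomial.C p.leadingCoeff * Polynomial.X ^ d := by
      ext k
      rw [Polynomial.coeff_C_mul, Polynomial.coeff_X_pow]
      have := hcoeff k
      rw [hr0, Polynomial.coeff_zero] at this
      split_ifs with hk
      · rw [hk, mul_one]
        rfl
      · rcases mul_eq_zero.1 this.symm with h | h
        · exact absurd (by exact_mod_cast sub_eq_zero.1 h) hk
        · rw [h, mul_zero]
    have hroot : p.eval a = 0 := by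
      have h1 : Polynomial.X - Polynomial.C a ∣ p :=
        (dvd_pow_self _ (Nat.succ_ne_zero N)).trans hdvd
      exact Polynomial.dvd_iff_isRoot.1 h1
    rw [hmono] at hroot
    simp only [Polynomial.eval_mul, Polynomial.eval_C, Polynomial.eval_pow,
      Polynomial.eval_X] at hroot
    rcases mul_eq_zero.1 hroot with h | h
    · exact hp0 (Polynomial.leadingCoeff_eq_zero.1 h)
    · exact pow_ne_zero d ha h

/-- The substitution `x ↦ x^m`, `y ↦ ((1 - y) w(x))^{n₁}`. -/
def pullback (n₁ m : ℕ) (w : Polynomial ℝ) :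
    MvPolynomial (Fin 2) ℝ →ₐ[ℝ] MvPolynomial (Fin 2) ℝ :=
  MvPolynomial.aeval
    ![(MvPolynomial.X 0 : MvPolynomial (Fin 2) ℝ) ^ m,
      ((1 - MvPolynomial.X 1) * Polynomial.aeval (MvPolynomial.X 0) w) ^ n₁]

theorem aeval_eq_sum_fin_two {S : Type*} [CommRing S] [Algebra ℝ S] (a b : S)
    (p : MvPolynomial (Fin 2) ℝ) :
    MvPolynomial.aeval ![a, b] p =
      ∑ d ∈ p.support, algebraMap ℝ S (p.coeff d) * (a ^ d 0 * b ^ d 1) := by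
  rw [MvPolynomial.aeval_eq_eval₂Hom, MvPolynomial.coe_eval₂Hom, MvPolynomial.eval₂_eq']
  simp [Fin.prod_univ_two]

/-- The part of `w` after division by `x`, in the variable `x = X 0`. -/
def unitPart (w : Polynomial ℝ) : MvPolynomial (Fin 2) ℝ :=
  Polynomial.aeval (MvPolynomial.X 0) w.divX

theorem aeval_eq_X_mul_unitPart {w : Polynomial ℝ} (hw : w.coeff 0 = 0) :
    Polynomial.aeval (MvPolynomial.X 0 : MvPolynomial (Fin 2) ℝ) w =
      MvPolynomial.X 0 * unitPart w := by
  conv_lhs => rw [← Polynomial.divX_mul_X_add w, hw]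
  simp [unitPart, mul_comm]

theorem exists_unitPart_pow {w : Polynomial ℝ} (hw : w.coeff 1 = 1) (k : ℕ) :
    ∃ r, unitPart w ^ k = 1 + MvPolynomial.X 0 * r := by
  have h1 : unitPart w =
      1 + MvPolynomial.X 0 * Polynomial.aeval (MvPolynomial.X 0) w.divX.divX := by
    rw [unitPart]
    conv_lhs => rw [← Polynomial.divX_mul_X_add w.divX, Polynomial.coeff_divX, zero_add, hw]
    simp [mul_comm, add_comm]
  have h2 : (MvPolynomial.X 0 : MvPolynomial (Fin 2) ℝ) ∣ unitPart w ^ k - 1 := by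
    refine dvd_trans ?_ (sub_one_dvd_pow_sub_one (unitPart w) k)
    exact ⟨Polynomial.aeval (MvPolynomial.X 0) w.divX.divX, by rw [h1]; ring⟩
  obtain ⟨r, hr⟩ := h2
  exact ⟨r, by rw [← hr]; ring⟩

theorem pullback_eq_sum (n₁ m : ℕ) {w : Polynomial ℝ} (hw : w.coeff 0 = 0)
    (p : MvPolynomial (Fin 2) ℝ) :
    pullback n₁ m w p = ∑ d ∈ p.support, MvPolynomial.C (p.coeff d) *
      (MvPolynomial.X 0 ^ (m * d 0 + n₁ * d 1) *
        ((1 - MvPolynomial.X 1) ^ (n₁ * d 1) * unitPart w ^ (n₁ * d 1))) := by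
  rw [pullback, aeval_eq_sum_fin_two, aeval_eq_X_mul_unitPart hw]
  refine Finset.sum_congr rfl fun d _ => ?_
  rw [MvPolynomial.algebraMap_eq, mul_pow, mul_pow, mul_pow, mul_pow, pow_add, pow_mul, pow_mul,
    pow_mul, pow_mul]
  ring

theorem X_pow_dvd_pullback (n₁ m : ℕ) {w : Polynomial ℝ} (hw : w.coeff 0 = 0)
    {p : MvPolynomial (Fin 2) ℝ} {k : ℕ} (hp : ∀ d ∈ p.support, k ≤ m * d 0 + n₁ * d 1) :
    MvPolynomial.X 0 ^ k ∣ pullback n₁ m w p := by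
  rw [pullback_eq_sum n₁ m hw]
  exact Finset.dvd_sum fun d hd =>
    Dvd.dvd.mul_left (Dvd.dvd.mul_right (pow_dvd_pow _ (hp d hd)) _) _

theorem coeff_aeval_X_one (r : Polynomial ℝ) (k : ℕ) :
    MvPolynomial.coeff (Finsupp.single 1 k)
      (Polynomial.aeval (MvPolynomial.X 1 : MvPolynomial (Fin 2) ℝ) r) = r.coeff k := by
  classical
  rw [Polynomial.aeval_eq_sum_range, MvPolynomial.coeff_sum]
  simp only [MvPolynomial.coeff_smul, MvPolynomial.coeff_X_pow, smul_eq_mul, mul_ite, mul_one,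
    mul_zero, Finsupp.single_injective (1 : Fin 2) |>.eq_iff]
  rw [Finset.sum_ite_eq']
  split_ifs with h
  · rfl
  · rw [Polynomial.coeff_eq_zero_of_natDegree_lt]
    simpa [Nat.lt_succ_iff] using h

/-- If all exponents `(i, j)` of `p` have weight `m i + n₁ j ≥ W`, the lowest coefficient in `x` of
the pullback of `p` comes from the part of `p` of weight `W` and is a polynomial in `1 - y`. -/
theorem exists_pullback_lowest (n₁ m : ℕ) {w : Polynomial ℝ} (hw : w.coeff 0 = 0)
    (hw1 : w.coeff 1 = 1) {p : MvPolynomial (Fin 2) ℝ} {W : ℕ}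
    (hp : ∀ d ∈ p.support, W ≤ m * d 0 + n₁ * d 1) :
    ∃ R, pullback n₁ m w p = MvPolynomial.X 0 ^ W *
      (Polynomial.aeval (1 - MvPolynomial.X 1) (∑ d ∈ p.support with m * d 0 + n₁ * d 1 = W,
        Polynomial.C (p.coeff d) * Polynomial.X ^ (n₁ * d 1)) + MvPolynomial.X 0 * R) := by
  have key : MvPolynomial.X 0 ^ (W + 1) ∣ pullback n₁ m w p - MvPolynomial.X 0 ^ W *
      Polynomial.aeval (1 - MvPolynomial.X 1) (∑ d ∈ p.support with m * d 0 + n₁ * d 1 = W,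
        Polynomial.C (p.coeff d) * Polynomial.X ^ (n₁ * d 1)) := by
    rw [pullback_eq_sum n₁ m hw, map_sum, Finset.mul_sum, Finset.sum_filter,
      ← Finset.sum_sub_distrib]
    refine Finset.dvd_sum fun d hd => ?_
    obtain ⟨r, hr⟩ := exists_unitPart_pow hw1 (n₁ * d 1)
    split_ifs with h
    · refine ⟨MvPolynomial.C (p.coeff d) * ((1 - MvPolynomial.X 1) ^ (n₁ * d 1) * r), ?_⟩
      rw [h, hr, map_mul, map_pow, Polynomial.aeval_X, Polynomial.aeval_C,
        MvPolynomial.algebraMap_eq]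
      ring
    · rw [sub_zero]
      refine Dvd.dvd.mul_left (Dvd.dvd.mul_right (pow_dvd_pow _ ?_) _) _
      have := hp d hd
      omega
  obtain ⟨R, hR⟩ := key
  exact ⟨R, by rw [sub_eq_iff_eq_add] at hR; rw [hR]; ring⟩

theorem coeff_X_pow_mul_lowest (W k : ℕ) (r : Polynomial ℝ) (R : MvPolynomial (Fin 2) ℝ) :
    MvPolynomial.coeff (Finsupp.single 0 W + Finsupp.single 1 k)
      (MvPolynomial.X 0 ^ W * (Polynomial.aeval (1 - MvPolynomial.X 1) r + MvPolynomial.X 0 * R)) =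
      (r.comp (1 - Polynomial.X)).coeff k := by
  classical
  rw [MvPolynomial.X_pow_eq_monomial, MvPolynomial.coeff_monomial_mul, one_mul,
    MvPolynomial.coeff_add, ← coeff_aeval_X_one, Polynomial.aeval_comp, MvPolynomial.coeff_X_mul',
    if_neg (by simp)]
  simp

/-- The perturbation `h₂` is of weighted order greater than `m n₁ n₂`: its part of lowest weight
`W ≤ m n₁ n₂` would be a polynomial with at most `n₂ + 1` terms in `1 - y` that vanishes to order
`n₂ + 1` at `y = 0`. -/
theorem weight_lt_of_newton {n₁ m n₂ q : ℕ} (hn₁ : 0 < n₁) (hm : 0 < m) (hmn : Nat.Coprime m n₁)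
    {w : Polynomial ℝ} (hw : w.coeff 0 = 0) (hw1 : w.coeff 1 = 1) {h : MvPolynomial (Fin 2) ℝ}
    (hN : ∀ d ∈ (pullback n₁ m w h).support,
      n₂ * (m * n₁ * n₂ + q) < n₂ * d 0 + q * d 1) :
    ∀ d ∈ h.support, m * n₁ * n₂ < m * d 0 + n₁ * d 1 := by
  by_contra! hcon
  obtain ⟨d₁, hd₁, hle⟩ := hcon
  obtain ⟨d₀, hd₀, hmin⟩ := Finset.exists_min_image h.support
    (fun d => m * d 0 + n₁ * d 1) ⟨d₁, hd₁⟩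
  set W := m * d₀ 0 + n₁ * d₀ 1 with hW
  have hWA : W ≤ m * n₁ * n₂ := (hmin d₁ hd₁).trans hle
  obtain ⟨R, hR⟩ := exists_pullback_lowest n₁ m hw hw1 hmin
  set p := ∑ d ∈ h.support with m * d 0 + n₁ * d 1 = W,
        Polynomial.C (h.coeff d) * Polynomial.X ^ (n₁ * d 1) with hp
  have hvan : ∀ k < n₂ + 1, (p.comp (1 - Polynomial.X)).coeff k = 0 := by
    intro k hk
    rw [← coeff_X_pow_mul_lowest W k p R, ← hR]
    by_contra hne
    have := hN _ (MvPolynomial.mem_support_iff.2 hne)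
    simp only [Finsupp.add_apply, Finsupp.single_apply] at this
    simp only [if_true, one_ne_zero, zero_ne_one, if_false, add_zero, zero_add] at this
    have h1 : n₂ * W ≤ n₂ * (m * n₁ * n₂) := Nat.mul_le_mul_left _ hWA
    have h2 : q * k ≤ q * n₂ := Nat.mul_le_mul_left _ (by omega)
    have h3 : n₂ * (m * n₁ * n₂ + q) = n₂ * (m * n₁ * n₂) + q * n₂ := by ring
    omega
  have hdvd : (Polynomial.X - Polynomial.C (1 : ℝ)) ^ (n₂ + 1) ∣ p := by
    obtain ⟨r, hr⟩ := Polynomial.X_pow_dvd_iff.2 hvan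
    have hcc : p = (p.comp (1 - Polynomial.X)).comp (1 - Polynomial.X) := by
      rw [Polynomial.comp_assoc]
      simp
    rw [hcc, hr, Polynomial.mul_comp, Polynomial.pow_comp, Polynomial.X_comp]
    refine Dvd.dvd.mul_right (pow_dvd_pow_of_dvd ⟨-1, ?_⟩ _) _
    rw [Polynomial.C_1]
    ring
  have hinj : ∀ d ∈ h.support.filter (fun d => m * d 0 + n₁ * d 1 = W),
      ∀ d' ∈ h.support.filter (fun d => m * d 0 + n₁ * d 1 = W), d 1 = d' 1 → d = d' := by
    intro d hd d' hd' h1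
    have e1 := (Finset.mem_filter.1 hd).2
    have e2 := (Finset.mem_filter.1 hd').2
    rw [h1] at e1
    have e3 : d 0 = d' 0 := Nat.eq_of_mul_eq_mul_left hm (by omega)
    ext i
    fin_cases i
    · exact e3
    · exact h1
  have hcard : p.support.card ≤ n₂ + 1 := by
    -- the exponents of `1 - y` are `n₁ j` with `j` in a fixed class mod `m` and `j ≤ m n₂`
    have hsub : p.support ⊆ (h.support.filter (fun d => m * d 0 + n₁ * d 1 = W)).image
        (fun d => n₁ * d 1) := by
      intro k hk
      rw [Polynomial.mem_support_iff, hp, Polynomial.finsetSum_coeff] at hk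
      obtain ⟨d, hd, hne⟩ := Finset.exists_ne_zero_of_sum_ne_zero hk
      refine Finset.mem_image.2 ⟨d, hd, ?_⟩
      by_contra hkd
      rw [Polynomial.coeff_C_mul, Polynomial.coeff_X_pow, if_neg (Ne.symm hkd), mul_zero] at hne
      exact hne rfl
    refine (Finset.card_le_card hsub).trans (Finset.card_image_le.trans ?_)
    rw [← Finset.card_range (n₂ + 1)]
    refine Finset.card_le_card_of_injOn (fun d => d 1 / m) ?_ ?_
    · intro d hd
      have e1 := (Finset.mem_filter.1 hd).2
      have e2 : n₁ * d 1 ≤ n₁ * (m * n₂) := by nlinarith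
      have e3 := Nat.le_of_mul_le_mul_left e2 hn₁
      simp only [Finset.coe_range, Set.mem_Iio]
      exact Nat.lt_succ_of_le (Nat.div_le_of_le_mul e3)
    · intro d hd d' hd' hdd
      refine hinj d hd d' hd' ?_
      have e1 := (Finset.mem_filter.1 hd).2
      have e2 := (Finset.mem_filter.1 hd').2
      have e3 : n₁ * d 1 ≡ n₁ * d' 1 [MOD m] := by
        have a1 : n₁ * d 1 ≡ W [MOD m] := by
          rw [← e1]
          exact (Nat.modEq_iff_dvd' (by omega)).2 ⟨d 0, by omega⟩
        have a2 : n₁ * d' 1 ≡ W [MOD m] := by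
          rw [← e2]
          exact (Nat.modEq_iff_dvd' (by omega)).2 ⟨d' 0, by omega⟩
        exact a1.trans a2.symm
      have e4 : d 1 ≡ d' 1 [MOD m] := Nat.ModEq.cancel_left_of_coprime hmn e3
      rw [← Nat.div_add_mod (d 1) m, ← Nat.div_add_mod (d' 1) m]
      have e5 : d 1 % m = d' 1 % m := e4
      simp only at hdd
      rw [hdd, e5]
  have hp0 := eq_zero_of_support_card_le one_ne_zero (n₂ + 1) p hcard hdvd
  have hc : p.coeff (n₁ * d₀ 1) = h.coeff d₀ := by
    rw [hp, Polynomial.finsetSum_coeff, Finset.sum_eq_single d₀]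
    · simp
    · intro d hd hne
      rw [Polynomial.coeff_C_mul, Polynomial.coeff_X_pow, if_neg, mul_zero]
      intro he
      exact hne (hinj d hd d₀ (Finset.mem_filter.2 ⟨hd₀, rfl⟩)
        (Nat.eq_of_mul_eq_mul_left hn₁ he.symm))
    · intro hn
      exact absurd (Finset.mem_filter.2 ⟨hd₀, hW.symm⟩) hn
  rw [hp0, Polynomial.coeff_zero] at hc
  exact MvPolynomial.mem_support_iff.1 hd₀ hc.symm

/-! ### The two weighted charts -/

/-- The substitution `x ↦ X^{n₂}`, `y ↦ X^q T`. -/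
def chartLower (n₂ q : ℕ) : MvPolynomial (Fin 2) ℝ →ₐ[ℝ] MvPolynomial (Fin 2) ℝ :=
  MvPolynomial.aeval ![(MvPolynomial.X 0 : MvPolynomial (Fin 2) ℝ) ^ n₂,
    MvPolynomial.X 0 ^ q * MvPolynomial.X 1]

/-- The substitution `x ↦ X^{n₂} T`, `y ↦ X^q`. -/
def chartUpper (n₂ q : ℕ) : MvPolynomial (Fin 2) ℝ →ₐ[ℝ] MvPolynomial (Fin 2) ℝ :=
  MvPolynomial.aeval ![(MvPolynomial.X 0 : MvPolynomial (Fin 2) ℝ) ^ n₂ * MvPolynomial.X 1,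
    MvPolynomial.X 0 ^ q]

section SubstitutionLemmas

variable (n₁ m n₂ q : ℕ) (w : Polynomial ℝ)

theorem eval_aeval_fin_two {R : Type*} [CommRing R] (x y : R) (a b p : MvPolynomial (Fin 2) R) :
    MvPolynomial.eval ![x, y] (MvPolynomial.aeval ![a, b] p) =
      MvPolynomial.eval ![MvPolynomial.eval ![x, y] a, MvPolynomial.eval ![x, y] b] p := by
  induction p using MvPolynomial.induction_on with
  | C r => simp
  | add p q hp hq => rw [map_add, map_add, hp, hq, map_add]
  | mul_X p i hp =>
    rw [map_mul, map_mul, hp, map_mul, MvPolynomial.aeval_X, MvPolynomial.eval_X]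
    fin_cases i <;> rfl

theorem eval_aeval_X_zero (x y : ℝ) (p : Polynomial ℝ) :
    MvPolynomial.eval ![x, y] (Polynomial.aeval (MvPolynomial.X 0) p) = p.eval x := by
  induction p using Polynomial.induction_on' with
  | add p q hp hq => simp [hp, hq]
  | monomial k a => simp

theorem eval_pullback (x y : ℝ) (p : MvPolynomial (Fin 2) ℝ) :
    MvPolynomial.eval ![x, y] (pullback n₁ m w p) =
      MvPolynomial.eval ![x ^ m, ((1 - y) * w.eval x) ^ n₁] p := by
  rw [pullback, eval_aeval_fin_two]
  simp [eval_aeval_X_zero]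

theorem eval_chartLower (x t : ℝ) (p : MvPolynomial (Fin 2) ℝ) :
    MvPolynomial.eval ![x, t] (chartLower n₂ q p) = MvPolynomial.eval ![x ^ n₂, x ^ q * t] p := by
  rw [chartLower, eval_aeval_fin_two]
  simp

theorem eval_chartUpper (x t : ℝ) (p : MvPolynomial (Fin 2) ℝ) :
    MvPolynomial.eval ![x, t] (chartUpper n₂ q p) = MvPolynomial.eval ![x ^ n₂ * t, x ^ q] p := by
  rw [chartUpper, eval_aeval_fin_two]
  simp

@[simp] theorem chartLower_X_zero :
    chartLower n₂ q (MvPolynomial.X 0) = MvPolynomial.X 0 ^ n₂ := by simp [chartLower]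

@[simp] theorem chartLower_X_one :
    chartLower n₂ q (MvPolynomial.X 1) = MvPolynomial.X 0 ^ q * MvPolynomial.X 1 := by
  simp [chartLower]

@[simp] theorem chartUpper_X_zero :
    chartUpper n₂ q (MvPolynomial.X 0) = MvPolynomial.X 0 ^ n₂ * MvPolynomial.X 1 := by
  simp [chartUpper]

@[simp] theorem chartUpper_X_one :
    chartUpper n₂ q (MvPolynomial.X 1) = MvPolynomial.X 0 ^ q := by simp [chartUpper]

theorem X_pow_dvd_chartLower {p : MvPolynomial (Fin 2) ℝ} {k : ℕ}
    (hp : ∀ d ∈ p.support, k ≤ n₂ * d 0 + q * d 1) :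
    MvPolynomial.X 0 ^ k ∣ chartLower n₂ q p := by
  rw [chartLower, aeval_eq_sum_fin_two]
  refine Finset.dvd_sum fun d hd => Dvd.dvd.mul_left ?_ _
  rw [mul_pow, ← mul_assoc, ← pow_mul, ← pow_mul, ← pow_add]
  exact Dvd.dvd.mul_right (pow_dvd_pow _ (hp d hd)) _

theorem X_pow_mul_X_pow_dvd_chartUpper {p : MvPolynomial (Fin 2) ℝ} {k j : ℕ}
    (hp : ∀ d ∈ p.support, k ≤ n₂ * d 0 + q * d 1) (hp' : ∀ d ∈ p.support, j ≤ d 0) :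
    MvPolynomial.X 0 ^ k * MvPolynomial.X 1 ^ j ∣ chartUpper n₂ q p := by
  rw [chartUpper, aeval_eq_sum_fin_two]
  refine Finset.dvd_sum fun d hd => Dvd.dvd.mul_left ?_ _
  rw [mul_pow, mul_right_comm, ← pow_mul, ← pow_mul, ← pow_add]
  exact mul_dvd_mul (pow_dvd_pow _ (hp d hd)) (pow_dvd_pow _ (hp' d hd))

end SubstitutionLemmas

theorem le_of_X_pow_dvd {p : MvPolynomial (Fin 2) ℝ} {k : ℕ} (hp : MvPolynomial.X 0 ^ k ∣ p) :
    ∀ d ∈ p.support, k ≤ d 0 := by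
  classical
  obtain ⟨r, rfl⟩ := hp
  intro d hd
  rw [MvPolynomial.mem_support_iff, MvPolynomial.X_pow_eq_monomial,
    MvPolynomial.coeff_monomial_mul'] at hd
  by_contra hlt
  refine hd (if_neg fun h => hlt ?_)
  simpa using h 0

/-- A polynomial in `x` and `y` is a polynomial in `x` alone modulo `y`. -/
theorem exists_aeval_X_zero_add (p : MvPolynomial (Fin 2) ℝ) :
    ∃ (p₀ : Polynomial ℝ) (p₁ : MvPolynomial (Fin 2) ℝ),
      p = Polynomial.aeval (MvPolynomial.X 0) p₀ + MvPolynomial.X 1 * p₁ := by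
  induction p using MvPolynomial.induction_on with
  | C a => exact ⟨Polynomial.C a, 0, by simp⟩
  | add p q hp hq =>
    obtain ⟨p₀, p₁, hp⟩ := hp
    obtain ⟨q₀, q₁, hq⟩ := hq
    exact ⟨p₀ + q₀, p₁ + q₁, by rw [hp, hq, map_add]; ring⟩
  | mul_X p i hp =>
    obtain ⟨p₀, p₁, hp⟩ := hp
    fin_cases i
    · exact ⟨p₀ * Polynomial.X, p₁ * MvPolynomial.X 0, by
        simp only [hp, map_mul, Polynomial.aeval_X, Fin.zero_eta]; ring⟩
    · exact ⟨0, p, by simp only [map_zero, Fin.mk_one]; ring⟩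

theorem exists_one_sub_pow_eq {R : Type*} [CommRing R] (y : R) (k : ℕ) :
    ∃ r, 1 - (1 - y) ^ k = k * y + y ^ 2 * r := by
  induction k with
  | zero => exact ⟨0, by simp⟩
  | succ k ih =>
    obtain ⟨r, hr⟩ := ih
    refine ⟨r - k - y * r, ?_⟩
    have h : (1 - y) ^ k = 1 - (k * y + y ^ 2 * r) := by rw [← hr]; ring
    rw [pow_succ, h]
    push_cast
    ring

theorem exists_pullback_gPoly {n₁ m : ℕ} {w : Polynomial ℝ} (hw : w.coeff 0 = 0)
    (hw1 : w.coeff 1 = 1) {h : MvPolynomial (Fin 2) ℝ}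
    (hh : ∀ d ∈ h.support, m * n₁ < m * d 0 + n₁ * d 1) :
    ∃ R, pullback n₁ m w (gPoly n₁ m h) = MvPolynomial.X 0 ^ (m * n₁) *
      (1 - (1 - MvPolynomial.X 1) ^ (m * n₁) + MvPolynomial.X 0 * R) := by
  obtain ⟨r, hr⟩ := X_pow_dvd_pullback n₁ m hw (k := m * n₁ + 1) hh
  obtain ⟨v, hv⟩ := exists_unitPart_pow hw1 (m * n₁)
  refine ⟨r - (1 - MvPolynomial.X 1) ^ (m * n₁) * v, ?_⟩
  have h0 : pullback n₁ m w (MvPolynomial.X 0) = MvPolynomial.X 0 ^ m := by simp [pullback]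
  have h1 : pullback n₁ m w (MvPolynomial.X 1) =
      ((1 - MvPolynomial.X 1) * (MvPolynomial.X 0 * unitPart w)) ^ n₁ := by
    simp [pullback, aeval_eq_X_mul_unitPart hw]
  rw [gPoly, map_add, map_sub, map_pow, map_pow, h0, h1, hr, ← pow_mul, ← pow_mul,
    mul_comm n₁ m, mul_pow, mul_pow, hv]
  ring

/-- The curve `g(x, y) = 0` is parametrized by `y = 0` up to the order `D / n₂` in `x`, so that
`g` is a sum of terms that are either divisible by `x^{m n₁} y` or of that order in `x`. -/
theorem exists_pullback_gPoly_eq {n₁ m D n₂ : ℕ} (hn₂ : 0 < n₂) {w : Polynomial ℝ}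
    (hw : w.coeff 0 = 0)
    (hw1 : w.coeff 1 = 1) {h : MvPolynomial (Fin 2) ℝ}
    (hh : ∀ d ∈ h.support, m * n₁ < m * d 0 + n₁ * d 1)
    (hord : ∀ k : ℕ, n₂ * k ≤ D → (MvPolynomial.aeval
      ![(Polynomial.X : Polynomial ℝ) ^ m, w ^ n₁] (gPoly n₁ m h)).coeff k = 0) :
    ∃ (r₁ r₂ r₃ : MvPolynomial (Fin 2) ℝ) (e : ℕ), D < n₂ * e ∧
      pullback n₁ m w (gPoly n₁ m h) = MvPolynomial.X 0 ^ (m * n₁) *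
        (((m * n₁ : ℕ) : MvPolynomial (Fin 2) ℝ) * MvPolynomial.X 1 + MvPolynomial.X 1 ^ 2 * r₂ +
          MvPolynomial.X 0 * MvPolynomial.X 1 * r₁) + MvPolynomial.X 0 ^ e * r₃ := by
  obtain ⟨R, hR⟩ := exists_pullback_gPoly hw hw1 hh
  obtain ⟨R₀, R₁, hR₀⟩ := exists_aeval_X_zero_add R
  obtain ⟨r₂, hr₂⟩ := exists_one_sub_pow_eq (MvPolynomial.X 1 : MvPolynomial (Fin 2) ℝ) (m * n₁)
  let φ : MvPolynomial (Fin 2) ℝ →ₐ[ℝ] Polynomial ℝ := MvPolynomial.aeval ![Polynomial.X, 0]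
  have hφ0 : φ (MvPolynomial.X 0) = Polynomial.X := by simp [φ]
  have hφ1 : φ (MvPolynomial.X 1) = 0 := by simp [φ]
  have hφp : ∀ p : Polynomial ℝ, φ (Polynomial.aeval (MvPolynomial.X 0) p) = p := by
    intro p
    rw [← Polynomial.aeval_algHom_apply, hφ0, Polynomial.aeval_X_left_apply]
  have hφg : MvPolynomial.aeval ![(Polynomial.X : Polynomial ℝ) ^ m, w ^ n₁] (gPoly n₁ m h) =
      Polynomial.X ^ (m * n₁ + 1) * R₀ := by
    have : MvPolynomial.aeval ![(Polynomial.X : Polynomial ℝ) ^ m, w ^ n₁] =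
        φ.comp (pullback n₁ m w) := by
      refine MvPolynomial.algHom_ext fun i => ?_
      fin_cases i
      · simp [pullback, hφ0]
      · simp [pullback, hφ1, hφp]
    rw [this, AlgHom.comp_apply, hR, hR₀]
    simp only [map_mul, map_add, map_sub, map_one, map_pow, hφ0, hφ1, hφp]
    ring
  have hdvd : Polynomial.X ^ (D / n₂ + 1) ∣ Polynomial.X ^ (m * n₁ + 1) * R₀ := by
    rw [Polynomial.X_pow_dvd_iff, ← hφg]
    intro k hk
    exact hord k (by
      calc n₂ * k ≤ n₂ * (D / n₂) := Nat.mul_le_mul_left _ (by omega)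
        _ ≤ D := Nat.mul_div_le D n₂)
  obtain ⟨r₃, hr₃⟩ := hdvd
  refine ⟨R₁, r₂, Polynomial.aeval (MvPolynomial.X 0) r₃, D / n₂ + 1,
    Nat.lt_mul_div_succ D hn₂, ?_⟩
  have h3 := congrArg (Polynomial.aeval (MvPolynomial.X 0 : MvPolynomial (Fin 2) ℝ)) hr₃
  simp only [map_mul, map_pow, Polynomial.aeval_X] at h3
  rw [hR, hr₂, hR₀]
  linear_combination h3

variable {n₁ m n₂ q : ℕ} {f h₁ h₂ : MvPolynomial (Fin 2) ℝ} {a b : ℕ} {w : Polynomial ℝ}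

/-- In the lower chart `g` is a power of `X` times `m n₁ T`, up to higher order in `X`. -/
theorem exists_chartLower_gPoly (hn₂ : 0 < n₂) (hq : 0 < q)
    (hf : IsTypeMinus n₁ m n₂ q f h₁ h₂ a b w) :
    ∃ S : MvPolynomial (Fin 2) ℝ, chartLower n₂ q (pullback n₁ m w (gPoly n₁ m h₁)) =
      MvPolynomial.X 0 ^ (m * n₁ * n₂ + q) *
        (((m * n₁ : ℕ) : MvPolynomial (Fin 2) ℝ) * MvPolynomial.X 1 + MvPolynomial.X 0 * S) := by
  obtain ⟨r₁, r₂, r₃, e, he, hg⟩ :=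
    exists_pullback_gPoly_eq hn₂ hf.w_zero hf.w_one hf.supp_h₁ hf.order_g
  obtain ⟨t, ht⟩ := Nat.exists_eq_add_of_lt he
  obtain ⟨N, rfl⟩ : ∃ N, n₂ = N + 1 := ⟨n₂ - 1, by omega⟩
  obtain ⟨p, rfl⟩ : ∃ p, q = p + 1 := ⟨q - 1, by omega⟩
  refine ⟨MvPolynomial.X 0 ^ p * MvPolynomial.X 1 ^ 2 * chartLower (N + 1) (p + 1) r₂ +
    MvPolynomial.X 0 ^ N * MvPolynomial.X 1 * chartLower (N + 1) (p + 1) r₁ +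
    MvPolynomial.X 0 ^ t * chartLower (N + 1) (p + 1) r₃, ?_⟩
  rw [hg]
  simp only [map_mul, map_add, map_pow, map_natCast, chartLower_X_zero, chartLower_X_one]
  rw [← pow_mul _ (N + 1) e, ht]
  ring

/-- In the upper chart `g` is a monomial times `m n₁`, up to higher order in `X`. -/
theorem exists_chartUpper_gPoly (hn₂ : 0 < n₂) (hq : 0 < q)
    (hf : IsTypeMinus n₁ m n₂ q f h₁ h₂ a b w) :
    ∃ S : MvPolynomial (Fin 2) ℝ, chartUpper n₂ q (pullback n₁ m w (gPoly n₁ m h₁)) =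
      MvPolynomial.X 0 ^ (m * n₁ * n₂ + q) * MvPolynomial.X 1 ^ (m * n₁) *
        (((m * n₁ : ℕ) : MvPolynomial (Fin 2) ℝ) + MvPolynomial.X 0 * S) := by
  obtain ⟨r₁, r₂, r₃, e, he, hg⟩ :=
    exists_pullback_gPoly_eq hn₂ hf.w_zero hf.w_one hf.supp_h₁ hf.order_g
  obtain ⟨t, ht⟩ := Nat.exists_eq_add_of_lt he
  have hle : m * n₁ ≤ e := by
    by_contra hlt
    have : n₂ * e ≤ n₂ * (m * n₁) := Nat.mul_le_mul_left _ (by omega)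
    have h2 : n₂ * (m * n₁) = m * n₁ * n₂ := by ring
    omega
  obtain ⟨e', he'⟩ := Nat.exists_eq_add_of_le hle
  obtain ⟨N, rfl⟩ : ∃ N, n₂ = N + 1 := ⟨n₂ - 1, by omega⟩
  obtain ⟨p, rfl⟩ : ∃ p, q = p + 1 := ⟨q - 1, by omega⟩
  refine ⟨MvPolynomial.X 0 ^ p * chartUpper (N + 1) (p + 1) r₂ +
    MvPolynomial.X 0 ^ N * MvPolynomial.X 1 * chartUpper (N + 1) (p + 1) r₁ +
    MvPolynomial.X 0 ^ t * MvPolynomial.X 1 ^ e' * chartUpper (N + 1) (p + 1) r₃, ?_⟩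
  rw [hg]
  simp only [map_mul, map_add, map_pow, map_natCast, chartUpper_X_zero, chartUpper_X_one]
  rw [mul_pow _ _ e, ← pow_mul _ (N + 1) e, ht, he']
  ring

theorem pullback_monomial (hf : IsTypeMinus n₁ m n₂ q f h₁ h₂ a b w) :
    pullback n₁ m w (MvPolynomial.X 0 ^ a * MvPolynomial.X 1 ^ b) =
      MvPolynomial.X 0 ^ (m * n₁ * n₂ + q) *
        ((1 - MvPolynomial.X 1) ^ (n₁ * b) * unitPart w ^ (n₁ * b)) := by
  rw [← hf.weight]
  simp only [pullback, map_mul, map_pow, MvPolynomial.aeval_X, Matrix.cons_val_zero,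
    Matrix.cons_val_one, aeval_eq_X_mul_unitPart hf.w_zero, mul_pow]
  ring

theorem pullback_eq_add (hf : IsTypeMinus n₁ m n₂ q f h₁ h₂ a b w) :
    pullback n₁ m w f = pullback n₁ m w (gPoly n₁ m h₁) ^ n₂ +
      MvPolynomial.X 0 ^ (m * n₁ * n₂ + q) *
        ((1 - MvPolynomial.X 1) ^ (n₁ * b) * unitPart w ^ (n₁ * b)) + pullback n₁ m w h₂ := by
  rw [← pullback_monomial hf, ← map_pow, ← map_add, ← map_add, ← hf.eq]

theorem newton_pullback (hf : IsTypeMinus n₁ m n₂ q f h₁ h₂ a b w) :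
    ∀ d ∈ (pullback n₁ m w h₂).support, n₂ * (m * n₁ * n₂ + q) < n₂ * d 0 + q * d 1 :=
  hf.newton_h₂

theorem X_pow_dvd_pullback_h₂ (hn₁ : 0 < n₁) (hm : 0 < m) (hmn : Nat.Coprime m n₁)
    (hf : IsTypeMinus n₁ m n₂ q f h₁ h₂ a b w) :
    MvPolynomial.X 0 ^ (m * n₁ * n₂ + 1) ∣ pullback n₁ m w h₂ :=
  X_pow_dvd_pullback n₁ m hf.w_zero
    (weight_lt_of_newton hn₁ hm hmn hf.w_zero hf.w_one (newton_pullback hf))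

/-- The strict transform `P` of `f` in the lower chart, and its restriction to the exceptional curve
`X = 0`. -/
theorem exists_chartLower (hn₂ : 0 < n₂) (hq : 0 < q)
    (hf : IsTypeMinus n₁ m n₂ q f h₁ h₂ a b w) :
    ∃ P, chartLower n₂ q (pullback n₁ m w f) =
        MvPolynomial.X 0 ^ (n₂ * (m * n₁ * n₂ + q)) * P ∧
      ∀ t : ℝ, MvPolynomial.eval ![0, t] P = 1 + ((m : ℝ) * n₁) ^ n₂ * t ^ n₂ := by
  obtain ⟨S, hS⟩ := exists_chartLower_gPoly hn₂ hq hf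
  obtain ⟨R, hR⟩ := X_pow_dvd_chartLower n₂ q (k := n₂ * (m * n₁ * n₂ + q) + 1)
    (newton_pullback hf)
  obtain ⟨v, hv⟩ := exists_unitPart_pow hf.w_one (n₁ * b)
  refine ⟨(((m * n₁ : ℕ) : MvPolynomial (Fin 2) ℝ) * MvPolynomial.X 1 + MvPolynomial.X 0 * S) ^ n₂ +
    (1 - MvPolynomial.X 0 ^ q * MvPolynomial.X 1) ^ (n₁ * b) *
      (1 + MvPolynomial.X 0 ^ n₂ * chartLower n₂ q v) + MvPolynomial.X 0 * R, ?_, fun t => ?_⟩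
  · rw [pullback_eq_add hf, hv, map_add, map_add, map_pow, hS, hR]
    simp only [map_mul, map_add, map_sub, map_one, map_pow, chartLower_X_zero, chartLower_X_one,
      mul_pow]
    ring
  · simp [hn₂.ne', hq.ne', mul_pow]
    ring

/-- The strict transform `Q` of `f` in the upper chart, and its restrictions to the exceptional
curve `X = 0` and to `T = 0`, the strict transform of `x = 0`. -/
theorem exists_chartUpper (hn₁ : 0 < n₁) (hm : 0 < m) (hmn : Nat.Coprime m n₁) (hn₂ : 0 < n₂)
    (hq : 0 < q) (hf : IsTypeMinus n₁ m n₂ q f h₁ h₂ a b w) :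
    ∃ Q, chartUpper n₂ q (pullback n₁ m w f) =
        MvPolynomial.X 0 ^ (n₂ * (m * n₁ * n₂ + q)) * MvPolynomial.X 1 ^ (m * n₁ * n₂) * Q ∧
      (∀ t : ℝ, MvPolynomial.eval ![0, t] Q = ((m : ℝ) * n₁) ^ n₂ + t ^ q) ∧
      ∀ x : ℝ, x ^ (n₂ * q) * MvPolynomial.eval ![x, 0] Q =
        (1 - (1 - x ^ q) ^ (m * n₁)) ^ n₂ := by
  obtain ⟨S, hS⟩ := exists_chartUpper_gPoly hn₂ hq hf
  obtain ⟨p, rfl⟩ : ∃ p, q = p + 1 := ⟨q - 1, by omega⟩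
  obtain ⟨R, hR⟩ := X_pow_mul_X_pow_dvd_chartUpper n₂ (p + 1)
    (k := n₂ * (m * n₁ * n₂ + (p + 1)) + 1) (newton_pullback hf)
    (le_of_X_pow_dvd (X_pow_dvd_pullback_h₂ hn₁ hm hmn hf))
  obtain ⟨v, hv⟩ := exists_unitPart_pow hf.w_one (n₁ * b)
  set Q := (((m * n₁ : ℕ) : MvPolynomial (Fin 2) ℝ) + MvPolynomial.X 0 * S) ^ n₂ +
    MvPolynomial.X 1 ^ (p + 1) * ((1 - MvPolynomial.X 0 ^ (p + 1)) ^ (n₁ * b) *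
      (1 + MvPolynomial.X 0 ^ n₂ * MvPolynomial.X 1 * chartUpper n₂ (p + 1) v)) +
      MvPolynomial.X 0 * MvPolynomial.X 1 * R with hQ
  have hfac : chartUpper n₂ (p + 1) (pullback n₁ m w f) =
      MvPolynomial.X 0 ^ (n₂ * (m * n₁ * n₂ + (p + 1))) * MvPolynomial.X 1 ^ (m * n₁ * n₂) * Q := by
    rw [pullback_eq_add hf, hv, map_add, map_add, map_pow, hS, hR, hQ]
    simp only [map_mul, map_add, map_sub, map_one, map_pow, chartUpper_X_zero, chartUpper_X_one,
      mul_pow]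
    ring
  refine ⟨Q, hfac, fun t => ?_, fun x => ?_⟩
  · rw [hQ]
    simp [hn₂.ne']
  · obtain ⟨R₁, hR₁⟩ := exists_pullback_gPoly hf.w_zero hf.w_one hf.supp_h₁
    obtain ⟨R₂, hR₂⟩ := X_pow_dvd_pullback_h₂ hn₁ hm hmn hf
    -- `T^A` is cancelled before `T` is set to `0`; `h₂` and `x^a y^b` contribute multiples of `T`
    have hcancel : MvPolynomial.X 0 ^ (n₂ * (p + 1)) * Q =
        (1 - (1 - MvPolynomial.X 0 ^ (p + 1)) ^ (m * n₁) +
          MvPolynomial.X 0 ^ n₂ * MvPolynomial.X 1 * chartUpper n₂ (p + 1) R₁) ^ n₂ +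
        MvPolynomial.X 1 * (MvPolynomial.X 1 ^ p * MvPolynomial.X 0 ^ (n₂ * (p + 1)) *
          ((1 - MvPolynomial.X 0 ^ (p + 1)) ^ (n₁ * b) *
            chartUpper n₂ (p + 1) (unitPart w) ^ (n₁ * b)) +
          MvPolynomial.X 0 ^ n₂ * chartUpper n₂ (p + 1) R₂) := by
      have hne : (MvPolynomial.X 0 ^ (n₂ * (m * n₁ * n₂)) *
          MvPolynomial.X 1 ^ (m * n₁ * n₂) : MvPolynomial (Fin 2) ℝ) ≠ 0 :=
        mul_ne_zero (pow_ne_zero _ (MvPolynomial.X_ne_zero 0))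
          (pow_ne_zero _ (MvPolynomial.X_ne_zero 1))
      apply mul_left_cancel₀ hne
      have h2 := hfac
      rw [pullback_eq_add hf, hR₁, hR₂] at h2
      simp only [map_mul, map_add, map_sub, map_one, map_pow, chartUpper_X_zero,
        chartUpper_X_one, mul_pow] at h2
      calc _ = MvPolynomial.X 0 ^ (n₂ * (m * n₁ * n₂ + (p + 1))) *
            MvPolynomial.X 1 ^ (m * n₁ * n₂) * Q := by ring
        _ = _ := by
          rw [← h2]
          ring
    have := congrArg (MvPolynomial.eval ![x, 0]) hcancel
    simpa using this

/-! ### The product over the roots of unity -/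

/-- As `m` and `n₁` are coprime, `ζ ↦ ζ^{n₁}` permutes the `m`-th roots of unity. -/
theorem prod_sub_pow_nthRoots {n₁ m : ℕ} (hm : 0 < m) (hmn : Nat.Coprime m n₁) (z : ℂ) :
    ∏ ζ ∈ Polynomial.nthRootsFinset m (1 : ℂ), (z - ζ ^ n₁) = z ^ m - 1 := by
  classical
  have hmem : ∀ ζ : ℂ, ζ ∈ Polynomial.nthRootsFinset m (1 : ℂ) ↔ ζ ^ m = 1 := fun ζ =>
    Polynomial.mem_nthRootsFinset hm 1
  have hmaps : ∀ ζ ∈ Polynomial.nthRootsFinset m (1 : ℂ),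
      ζ ^ n₁ ∈ Polynomial.nthRootsFinset m (1 : ℂ) := by
    intro ζ hζ
    rw [hmem] at hζ ⊢
    rw [← pow_mul, mul_comm, pow_mul, hζ, one_pow]
  have hinj : Set.InjOn (fun ζ : ℂ => ζ ^ n₁) (Polynomial.nthRootsFinset m (1 : ℂ)) := by
    intro ζ hζ ξ hξ h
    have hζ' := (hmem ζ).1 hζ
    have hξ' := (hmem ξ).1 hξ
    have hξ0 : ξ ≠ 0 := by
      rintro rfl
      simp [hm.ne'] at hξ'
    have h1 : (ζ / ξ) ^ m = 1 := by rw [div_pow, hζ', hξ', div_one]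
    have h2 : (ζ / ξ) ^ n₁ = 1 := by
      simp only at h
      rw [div_pow, h, div_self (pow_ne_zero _ hξ0)]
    have h3 : orderOf (ζ / ξ) ∣ 1 := by
      rw [← hmn]
      exact Nat.dvd_gcd (orderOf_dvd_of_pow_eq_one h1) (orderOf_dvd_of_pow_eq_one h2)
    have h4 := orderOf_eq_one_iff.1 (Nat.dvd_one.1 h3)
    rwa [div_eq_one_iff_eq hξ0] at h4
  have himg : (Polynomial.nthRootsFinset m (1 : ℂ)).image (fun ζ => ζ ^ n₁) =
      Polynomial.nthRootsFinset m (1 : ℂ) :=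
    Finset.eq_of_subset_of_card_le (Finset.image_subset_iff.2 hmaps)
      (Finset.card_image_of_injOn hinj).ge
  have h1 : ∏ ζ ∈ Polynomial.nthRootsFinset m (1 : ℂ), (z - ζ ^ n₁) =
      ∏ ζ ∈ Polynomial.nthRootsFinset m (1 : ℂ), (z - ζ) := by
    conv_rhs => rw [← himg]
    rw [Finset.prod_image hinj]
  have h2 := congrArg (Polynomial.eval z)
    (Polynomial.X_pow_sub_one_eq_prod hm (Complex.isPrimitiveRoot_exp m hm.ne'))
  rw [Polynomial.eval_prod] at h2
  simp only [Polynomial.eval_sub, Polynomial.eval_pow, Polynomial.eval_X, Polynomial.eval_one,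
    Polynomial.eval_C] at h2
  rw [h1, h2]

theorem eval_polynomial_aeval (x y : ℂ) (p : Polynomial ℝ) (r : MvPolynomial (Fin 2) ℂ) :
    MvPolynomial.eval ![x, y] (Polynomial.aeval r p) =
      Polynomial.aeval (MvPolynomial.eval ![x, y] r) p := by
  induction p using Polynomial.induction_on' with
  | add p q hp hq => simp [hp, hq]
  | monomial k a => simp [Polynomial.aeval_monomial, MvPolynomial.algebraMap_apply]

/-- In the coordinates `x ↦ x^m`, `y ↦ ((1 - y) w(x))^{n₁}` the function `g_Y` is
`x^{m n₁} y` times a polynomial with value `-m n₁` at the origin. -/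
theorem exists_gY_eq {n₁ m : ℕ} (hm : 0 < m) (hmn : Nat.Coprime m n₁) {w : Polynomial ℝ}
    (hw : w.coeff 0 = 0) (hw1 : w.coeff 1 = 1) :
    ∃ G : MvPolynomial (Fin 2) ℂ,
      (∀ x y : ℝ, 0 ≤ x → gY n₁ m w (x ^ m) (((1 - y) * w.eval x) ^ n₁) =
        (x : ℂ) ^ (m * n₁) * (y * MvPolynomial.eval ![(x : ℂ), (y : ℂ)] G)) ∧
      MvPolynomial.eval ![0, 0] G = -((m : ℂ) * n₁) := by
  classical
  let V : ℂ → MvPolynomial (Fin 2) ℂ := fun ζ =>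
    Polynomial.aeval (MvPolynomial.C ζ * MvPolynomial.X 0) w.divX
  let fac : ℂ → MvPolynomial (Fin 2) ℂ := fun ζ =>
    ((1 - MvPolynomial.X 1) * V 1) ^ n₁ - (MvPolynomial.C ζ * V ζ) ^ n₁
  have hV : ∀ (ζ x y : ℂ), MvPolynomial.eval ![x, y] (V ζ) = Polynomial.aeval (ζ * x) w.divX := by
    intro ζ x y
    simp only [V, eval_polynomial_aeval]
    simp
  have hwV : ∀ z : ℂ, Polynomial.aeval z w = z * Polynomial.aeval z w.divX := by
    intro z
    conv_lhs => rw [← Polynomial.divX_mul_X_add w, hw]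
    simp [mul_comm]
  have hfac : ∀ ζ x y : ℂ, MvPolynomial.eval ![x, y] (fac ζ) =
      ((1 - y) * Polynomial.aeval x w.divX) ^ n₁ - (ζ * Polynomial.aeval (ζ * x) w.divX) ^ n₁ := by
    intro ζ x y
    simp [fac, hV]
  -- the factor of `ζ = 1` vanishes at `y = 0`
  have hdvd : MvPolynomial.X 1 ∣ ∏ ζ ∈ Polynomial.nthRootsFinset m (1 : ℂ), fac ζ := by
    refine dvd_trans ?_ (Finset.dvd_prod_of_mem fac
      ((Polynomial.mem_nthRootsFinset hm 1).2 (one_pow m) : (1 : ℂ) ∈ _))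
    refine dvd_trans ?_ (sub_dvd_pow_sub_pow _ _ n₁)
    exact ⟨-V 1, by rw [MvPolynomial.C_1]; ring⟩
  obtain ⟨G, hG⟩ := hdvd
  have hGeval : ∀ x y : ℂ, ∏ ζ ∈ Polynomial.nthRootsFinset m (1 : ℂ),
      (((1 - y) * Polynomial.aeval x w.divX) ^ n₁ -
        (ζ * Polynomial.aeval (ζ * x) w.divX) ^ n₁) =
      y * MvPolynomial.eval ![x, y] G := by
    intro x y
    have := congrArg (MvPolynomial.eval ![x, y]) hG
    rw [map_prod, map_mul, MvPolynomial.eval_X] at this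
    simpa only [hfac, Matrix.cons_val_one, Matrix.cons_val_fin_one] using this
  refine ⟨G, fun x y hx => ?_, ?_⟩
  · have hroot : (x ^ m) ^ (1 / (m : ℝ)) = x := by
      rw [one_div]
      exact Real.pow_rpow_inv_natCast hx hm.ne'
    have hcard : (Polynomial.nthRootsFinset m (1 : ℂ)).card = m :=
      (Complex.isPrimitiveRoot_exp m hm.ne').card_nthRootsFinset
    have hwx : ((w.eval x : ℝ) : ℂ) = x * Polynomial.aeval (x : ℂ) w.divX := by
      rw [← hwV]
      exact (Polynomial.aeval_algebraMap_apply_eq_algebraMap_eval x w).symm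
    have hpow : (x : ℂ) ^ (m * n₁) =
        ∏ _ζ ∈ Polynomial.nthRootsFinset m (1 : ℂ), (x : ℂ) ^ n₁ := by
      rw [Finset.prod_const, hcard, ← pow_mul, mul_comm]
    rw [gY, hroot, ← hGeval, hpow, ← Finset.prod_mul_distrib]
    refine Finset.prod_congr rfl fun ζ _ => ?_
    rw [hwV, Complex.ofReal_pow, Complex.ofReal_mul, hwx]
    push_cast
    simp only [mul_pow]
    ring
  · have hV0 : Polynomial.aeval (0 : ℂ) w.divX = 1 := by
      rw [← Polynomial.coeff_zero_eq_aeval_zero', Polynomial.coeff_divX, zero_add, hw1, map_one]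
    have h0 : ∀ y : ℂ, (1 - y) ^ (m * n₁) - 1 = y * MvPolynomial.eval ![0, y] G := by
      intro y
      rw [← hGeval]
      simp only [mul_zero, hV0, mul_one]
      rw [prod_sub_pow_nthRoots hm hmn, ← pow_mul, mul_comm n₁ m]
    -- the value at `y = 0` is the derivative of `(1 - y)^{m n₁} - 1`
    have hcont : Continuous fun y : ℂ => MvPolynomial.eval ![0, y] G :=
      (MvPolynomial.continuous_eval G).comp (continuous_pi fun i => by
        fin_cases i
        · exact continuous_const
        · exact continuous_id)
    have hd1 : HasDerivAt (fun y : ℂ => (1 - y) ^ (m * n₁) - 1) (-((m : ℂ) * n₁)) 0 := by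
      have := (((hasDerivAt_id (0 : ℂ)).const_sub 1).pow (m * n₁)).sub_const 1
      simpa using this
    have hs := hd1.tendsto_slope_zero
    have hs' : Tendsto (fun t : ℂ => MvPolynomial.eval ![0, t] G) (𝓝[≠] 0)
        (𝓝 (-((m : ℂ) * n₁))) := by
      refine hs.congr' ?_
      filter_upwards [self_mem_nhdsWithin] with t ht
      have ht0 : t ≠ 0 := ht
      simp only [zero_add, sub_zero, one_pow, sub_self, h0, smul_eq_mul]
      field_simp
    exact tendsto_nhds_unique ((hcont.tendsto 0).mono_left nhdsWithin_le_nhds) hs'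

/-! ### Change of variables -/

/-- The linear map of the plane with matrix `!![a, b; c, d]`. -/
def planeMap (a b c d : ℝ) : ℝ × ℝ →L[ℝ] ℝ × ℝ :=
  (a • ContinuousLinearMap.fst ℝ ℝ ℝ + b • ContinuousLinearMap.snd ℝ ℝ ℝ).prod
    (c • ContinuousLinearMap.fst ℝ ℝ ℝ + d • ContinuousLinearMap.snd ℝ ℝ ℝ)

theorem det_planeMap (a b c d : ℝ) : (planeMap a b c d).det = a * d - b * c := by
  have h : (planeMap a b c d : ℝ × ℝ →ₗ[ℝ] ℝ × ℝ) =
      Matrix.toLin (Module.Basis.finTwoProd ℝ) (Module.Basis.finTwoProd ℝ) !![a, b; c, d] := by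
    rw [Matrix.toLin_finTwoProd]
    ext <;> simp [planeMap]
  rw [ContinuousLinearMap.det, h, LinearMap.det_toLin, Matrix.det_fin_two_of]

theorem hasFDerivAt_planeMap {f g : ℝ × ℝ → ℝ} {p : ℝ × ℝ} {a b c d : ℝ}
    (hf : HasFDerivAt f (a • ContinuousLinearMap.fst ℝ ℝ ℝ +
      b • ContinuousLinearMap.snd ℝ ℝ ℝ) p)
    (hg : HasFDerivAt g (c • ContinuousLinearMap.fst ℝ ℝ ℝ +
      d • ContinuousLinearMap.snd ℝ ℝ ℝ) p) :
    HasFDerivAt (fun p => (f p, g p)) (planeMap a b c d) p :=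
  hf.prodMk hg

theorem hasFDerivAt_comp_fst {f : ℝ → ℝ} {f' : ℝ} {p : ℝ × ℝ} (hf : HasDerivAt f f' p.1) :
    HasFDerivAt (fun p : ℝ × ℝ => f p.1) (f' • ContinuousLinearMap.fst ℝ ℝ ℝ +
      (0 : ℝ) • ContinuousLinearMap.snd ℝ ℝ ℝ) p := by
  have := hf.comp_hasFDerivAt p (hasFDerivAt_fst (𝕜 := ℝ) (E := ℝ) (F := ℝ) (p := p))
  refine this.congr_fderiv ?_
  ext <;> simp

theorem hasFDerivAt_mul_comp {f g : ℝ → ℝ} {f' g' : ℝ} {p : ℝ × ℝ} (hf : HasDerivAt f f' p.1)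
    (hg : HasDerivAt g g' p.2) :
    HasFDerivAt (fun p : ℝ × ℝ => f p.1 * g p.2) ((f' * g p.2) • ContinuousLinearMap.fst ℝ ℝ ℝ +
      (f p.1 * g') • ContinuousLinearMap.snd ℝ ℝ ℝ) p := by
  have h1 := hf.comp_hasFDerivAt p (hasFDerivAt_fst (𝕜 := ℝ) (E := ℝ) (F := ℝ) (p := p))
  have h2 := hg.comp_hasFDerivAt p (hasFDerivAt_snd (𝕜 := ℝ) (E := ℝ) (F := ℝ) (p := p))
  refine (h1.mul h2).congr_fderiv ?_
  ext <;> simp [mul_comm]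

theorem prod_ae_eq_Ioo {s t : Set ℝ} (hs : s =ᵐ[volume] Set.Ioo (0 : ℝ) 1)
    (ht : t =ᵐ[volume] Set.Ioo (0 : ℝ) 1) :
    (s ×ˢ t : Set (ℝ × ℝ)) =ᵐ[volume] Set.Ioo (0 : ℝ) 1 ×ˢ Set.Ioo (0 : ℝ) 1 :=
  Measure.set_prod_ae_eq hs ht

/-- Change of variables for a map that is injective on a set equal to the open unit square up to
a null set. -/
theorem change_of_variables {Φ : ℝ × ℝ → ℝ × ℝ} {L : ℝ × ℝ → ℝ × ℝ →L[ℝ] ℝ × ℝ} {s t : Set ℝ}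
    (hs : MeasurableSet s) (ht : MeasurableSet t) (hs' : s =ᵐ[volume] Set.Ioo (0 : ℝ) 1)
    (ht' : t =ᵐ[volume] Set.Ioo (0 : ℝ) 1)
    (hΦ : ∀ p ∈ s ×ˢ t, HasFDerivAt Φ (L p) p) (hinj : Set.InjOn Φ (s ×ˢ t)) {g k : ℝ × ℝ → ℂ}
    (hgk : ∀ p ∈ Set.Ioo (0 : ℝ) 1 ×ˢ Set.Ioo (0 : ℝ) 1, |(L p).det| • g (Φ p) = k p)
    (hk : IntegrableOn k (Set.Ioo 0 1 ×ˢ Set.Ioo 0 1)) :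
    IntegrableOn g (Φ '' s ×ˢ t) ∧
      ∫ p in Φ '' s ×ˢ t, g p = ∫ p in Set.Ioo (0 : ℝ) 1 ×ˢ Set.Ioo (0 : ℝ) 1, k p := by
  have hΦ' := fun p hp => (hΦ p hp).hasFDerivWithinAt (s := s ×ˢ t)
  have hsq : MeasurableSet (Set.Ioo (0 : ℝ) 1 ×ˢ Set.Ioo (0 : ℝ) 1) :=
    measurableSet_Ioo.prod measurableSet_Ioo
  rw [integrableOn_image_iff_integrableOn_abs_det_fderiv_smul volume (hs.prod ht) hΦ' hinj,
    integral_image_eq_integral_abs_det_fderiv_smul volume (hs.prod ht) hΦ' hinj,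
    integrableOn_congr_set_ae (prod_ae_eq_Ioo hs' ht'),
    setIntegral_congr_set (prod_ae_eq_Ioo hs' ht')]
  exact ⟨hk.congr_fun (fun p hp => (hgk p hp).symm) hsq, setIntegral_congr_fun hsq hgk⟩

theorem rpow_inv_mem_Ioo {x : ℝ} (hx : x ∈ Set.Ioo (0 : ℝ) 1) {n : ℕ} (hn : 0 < n) :
    x ^ (n : ℝ)⁻¹ ∈ Set.Ioo (0 : ℝ) 1 :=
  ⟨Real.rpow_pos_of_pos hx.1 _, Real.rpow_lt_one hx.1.le hx.2 (by positivity)⟩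

theorem image_chartLower {n q : ℕ} (hn : 0 < n) (hq : 0 < q) :
    (fun p : ℝ × ℝ => (p.1 ^ n, p.1 ^ q * p.2)) '' Set.Ioo 0 1 ×ˢ Set.Ioc 0 1 =
      Set.Ioo 0 1 ×ˢ Set.Ioo 0 1 ∩ {p | p.2 ^ n ≤ p.1 ^ q} := by
  ext ⟨x, y⟩
  simp only [Set.mem_image, Set.mem_prod, Set.mem_inter_iff, Prod.mk.injEq, Prod.exists,
    Set.mem_ofPred_eq]
  constructor
  · rintro ⟨X, t, ⟨hX, ht⟩, rfl, rfl⟩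
    have h1 : X ^ q < 1 := pow_lt_one₀ hX.1.le hX.2 hq.ne'
    have h0 : 0 < X ^ q := pow_pos hX.1 q
    refine ⟨⟨⟨pow_pos hX.1 n, pow_lt_one₀ hX.1.le hX.2 hn.ne'⟩, mul_pos h0 ht.1, ?_⟩, ?_⟩
    · exact (mul_le_of_le_one_right h0.le ht.2).trans_lt h1
    · rw [mul_pow, ← pow_mul, ← pow_mul, mul_comm n q]
      exact mul_le_of_le_one_right (by have := hX.1; positivity) (pow_le_one₀ ht.1.le ht.2)
  · rintro ⟨⟨hx, hy⟩, hle⟩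
    have hX := rpow_inv_mem_Ioo hx hn
    have hXn := Real.rpow_inv_natCast_pow hx.1.le hn.ne'
    set X := x ^ (n : ℝ)⁻¹
    have h0 : 0 < X ^ q := pow_pos hX.1 q
    refine ⟨X, y / X ^ q, ⟨hX, div_pos hy.1 h0, ?_⟩, hXn, by field_simp⟩
    rw [div_le_one h0]
    refine le_of_pow_le_pow_left₀ hn.ne' h0.le ?_
    rwa [← pow_mul, mul_comm q n, pow_mul, hXn]

theorem image_chartUpper {n q : ℕ} (hn : 0 < n) (hq : 0 < q) :
    (fun p : ℝ × ℝ => (p.1 ^ n * p.2, p.1 ^ q)) '' Set.Ioo 0 1 ×ˢ Set.Ioo 0 1 =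
      (Set.Ioo 0 1 ×ˢ Set.Ioo 0 1) \ {p | p.2 ^ n ≤ p.1 ^ q} := by
  ext ⟨x, y⟩
  simp only [Set.mem_image, Set.mem_prod, Set.mem_sdiff, Prod.mk.injEq, Prod.exists,
    Set.mem_ofPred_eq, not_le]
  constructor
  · rintro ⟨X, t, ⟨hX, ht⟩, rfl, rfl⟩
    have h1 : X ^ n < 1 := pow_lt_one₀ hX.1.le hX.2 hn.ne'
    have h0 : 0 < X ^ n := pow_pos hX.1 n
    refine ⟨⟨⟨mul_pos h0 ht.1, ?_⟩, pow_pos hX.1 q, pow_lt_one₀ hX.1.le hX.2 hq.ne'⟩, ?_⟩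
    · exact (mul_le_of_le_one_right h0.le ht.2.le).trans_lt h1
    · rw [mul_pow, ← pow_mul, ← pow_mul, mul_comm q n]
      exact mul_lt_of_lt_one_right (by have := hX.1; positivity)
        (pow_lt_one₀ ht.1.le ht.2 hq.ne')
  · rintro ⟨⟨hx, hy⟩, hlt⟩
    have hX := rpow_inv_mem_Ioo hy hq
    have hXq := Real.rpow_inv_natCast_pow hy.1.le hq.ne'
    set X := y ^ (q : ℝ)⁻¹
    have h0 : 0 < X ^ n := pow_pos hX.1 n
    refine ⟨X, x / X ^ n, ⟨hX, div_pos hx.1 h0, ?_⟩, by field_simp, hXq⟩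
    rw [div_lt_one h0]
    refine lt_of_pow_lt_pow_left₀ q h0.le ?_
    rwa [← pow_mul, mul_comm n q, pow_mul, hXq]

/-- The integral over the unit square, split along the curve `y^n = x^q`, in the coordinates of
the two charts. -/
theorem integral_square_eq_charts {n q : ℕ} (hn : 0 < n) (hq : 0 < q) {g k₁ k₂ : ℝ × ℝ → ℂ}
    (h₁ : ∀ x ∈ Set.Ioo (0 : ℝ) 1, ∀ t ∈ Set.Ioo (0 : ℝ) 1,
      ((n * x ^ (n - 1) * x ^ q : ℝ) : ℂ) * g (x ^ n, x ^ q * t) = k₁ (x, t))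
    (h₂ : ∀ x ∈ Set.Ioo (0 : ℝ) 1, ∀ t ∈ Set.Ioo (0 : ℝ) 1,
      ((q * x ^ (q - 1) * x ^ n : ℝ) : ℂ) * g (x ^ n * t, x ^ q) = k₂ (x, t))
    (hk₁ : IntegrableOn k₁ (Set.Ioo 0 1 ×ˢ Set.Ioo 0 1))
    (hk₂ : IntegrableOn k₂ (Set.Ioo 0 1 ×ˢ Set.Ioo 0 1)) :
    IntegrableOn g (Set.Ioo 0 1 ×ˢ Set.Ioo 0 1) ∧
      ∫ p in Set.Ioo (0 : ℝ) 1 ×ˢ Set.Ioo (0 : ℝ) 1, g p =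
        (∫ p in Set.Ioo (0 : ℝ) 1 ×ˢ Set.Ioo (0 : ℝ) 1, k₁ p) +
          ∫ p in Set.Ioo (0 : ℝ) 1 ×ˢ Set.Ioo (0 : ℝ) 1, k₂ p := by
  have hIoc : Set.Ioc (0 : ℝ) 1 =ᵐ[volume] Set.Ioo (0 : ℝ) 1 := Ioo_ae_eq_Ioc.symm
  obtain ⟨i₁, e₁⟩ := change_of_variables (g := g) (k := k₁)
    (Φ := fun p : ℝ × ℝ => (p.1 ^ n, p.1 ^ q * p.2))
    (L := fun p => planeMap (n * p.1 ^ (n - 1)) 0 (q * p.1 ^ (q - 1) * p.2) (p.1 ^ q * 1))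
    measurableSet_Ioo measurableSet_Ioc EventuallyEq.rfl hIoc
    (fun p _ => hasFDerivAt_planeMap (hasFDerivAt_comp_fst (hasDerivAt_pow n p.1))
      (hasFDerivAt_mul_comp (hasDerivAt_pow q p.1) (hasDerivAt_id p.2)))
    (by
      rintro ⟨x, t⟩ ⟨hx, -⟩ ⟨x', t'⟩ ⟨hx', -⟩ h
      simp only [Prod.mk.injEq] at h hx hx' ⊢
      have hxx : x = x' := (pow_left_inj₀ hx.1.le hx'.1.le hn.ne').1 h.1
      subst hxx
      exact ⟨rfl, mul_left_cancel₀ (pow_pos hx.1 q).ne' h.2⟩)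
    (by
      rintro ⟨x, t⟩ ⟨hx, ht⟩
      rw [← h₁ x hx t ht, det_planeMap, abs_of_nonneg, Complex.real_smul]
      · simp
      · have := hx.1
        simp only [zero_mul, sub_zero, mul_one]
        positivity) hk₁
  obtain ⟨i₂, e₂⟩ := change_of_variables (g := g) (k := k₂)
    (Φ := fun p : ℝ × ℝ => (p.1 ^ n * p.2, p.1 ^ q))
    (L := fun p => planeMap (n * p.1 ^ (n - 1) * p.2) (p.1 ^ n * 1) (q * p.1 ^ (q - 1)) 0)
    measurableSet_Ioo measurableSet_Ioo EventuallyEq.rfl EventuallyEq.rfl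
    (fun p _ => hasFDerivAt_planeMap
      (hasFDerivAt_mul_comp (hasDerivAt_pow n p.1) (hasDerivAt_id p.2))
      (hasFDerivAt_comp_fst (hasDerivAt_pow q p.1)))
    (by
      rintro ⟨x, t⟩ ⟨hx, -⟩ ⟨x', t'⟩ ⟨hx', -⟩ h
      simp only [Prod.mk.injEq] at h hx hx' ⊢
      have hxx : x = x' := (pow_left_inj₀ hx.1.le hx'.1.le hq.ne').1 h.2
      subst hxx
      exact ⟨rfl, mul_left_cancel₀ (pow_pos hx.1 n).ne' h.1⟩)
    (by
      rintro ⟨x, t⟩ ⟨hx, ht⟩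
      rw [← h₂ x hx t ht, det_planeMap, abs_of_nonpos, Complex.real_smul]
      · push_cast
        ring
      · have h1 : 0 ≤ x ^ n * (q * x ^ (q - 1)) := by
          have := hx.1
          positivity
        simp only [mul_zero, mul_one, zero_sub]
        linarith) hk₂
  rw [image_chartLower hn hq] at i₁ e₁
  rw [image_chartUpper hn hq] at i₂ e₂
  have hmeas : MeasurableSet {p : ℝ × ℝ | p.2 ^ n ≤ p.1 ^ q} :=
    measurableSet_le (by fun_prop) (by fun_prop)
  have hunion := Set.inter_union_sdiff (Set.Ioo (0 : ℝ) 1 ×ˢ Set.Ioo (0 : ℝ) 1)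
    {p : ℝ × ℝ | p.2 ^ n ≤ p.1 ^ q}
  refine ⟨?_, ?_⟩
  · have := i₁.union i₂
    rwa [hunion] at this
  · rw [← e₁, ← e₂, ← setIntegral_union (Set.disjoint_left.2 fun p h1 h2 => h2.2 h1.2)
      ((measurableSet_Ioo.prod measurableSet_Ioo).diff hmeas) i₁ i₂, hunion]

theorem domainY_ae_eq (n₁ m : ℕ) (w : Polynomial ℝ) :
    (domainY n₁ m w ∩ {p | 0 < p.1 ∧ 0 < p.2} : Set (ℝ × ℝ)) =ᵐ[volume] domainY n₁ m w := by
  have h1 : volume {p : ℝ × ℝ | p.1 = 0} = 0 := by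
    have : {p : ℝ × ℝ | p.1 = 0} = {0} ×ˢ Set.univ := by ext; simp
    rw [this, Measure.volume_eq_prod, Measure.prod_prod]
    simp
  have h2 : volume {p : ℝ × ℝ | p.2 = 0} = 0 := by
    have : {p : ℝ × ℝ | p.2 = 0} = Set.univ ×ˢ {0} := by ext; simp
    rw [this, Measure.volume_eq_prod, Measure.prod_prod]
    simp
  have h3 : ∀ᵐ p : ℝ × ℝ, p.1 ≠ 0 := by rw [ae_iff]; simpa using h1
  have h4 : ∀ᵐ p : ℝ × ℝ, p.2 ≠ 0 := by rw [ae_iff]; simpa using h2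
  filter_upwards [h3, h4] with p hp1 hp2
  refine propext ⟨fun h => h.1, fun h => ⟨h, ?_, ?_⟩⟩
  · exact lt_of_le_of_ne h.1 hp1.symm
  · exact lt_of_le_of_ne h.2.2.1 hp2.symm

/-- `Y = w^{n₁}` being positive, `w(x) / x` has no zero on `[0, 1]`, and its value at `0` is `1`. -/
theorem eval_divX_pos {n₁ m : ℕ} (hn₁ : 0 < n₁) (hm : 0 < m) {w : Polynomial ℝ}
    (hw : w.coeff 0 = 0) (hw1 : w.coeff 1 = 1)
    (hpos : ∀ x : ℝ, 0 < x → x ≤ 1 → 0 < curveY n₁ m w x) :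
    ∀ x ∈ Set.Icc (0 : ℝ) 1, 0 < w.divX.eval x := by
  have h0 : w.divX.eval 0 = 1 := by
    rw [← Polynomial.coeff_zero_eq_eval_zero, Polynomial.coeff_divX, zero_add, hw1]
  have hne : ∀ x ∈ Set.Icc (0 : ℝ) 1, w.divX.eval x ≠ 0 := by
    intro x hx h
    rcases hx.1.eq_or_lt with rfl | hx0
    · rw [h0] at h
      exact one_ne_zero h
    · have hY := hpos (x ^ m) (pow_pos hx0 m) (pow_le_one₀ hx0.le hx.2)
      rw [curveY, one_div, Real.pow_rpow_inv_natCast hx0.le hm.ne'] at hY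
      have hwx : w.eval x = 0 := by
        conv_lhs => rw [← Polynomial.divX_mul_X_add w, hw]
        simp [h]
      rw [hwx, zero_pow hn₁.ne'] at hY
      exact lt_irrefl _ hY
  intro x hx
  by_contra! hle
  obtain ⟨y, hy, hy0⟩ := intermediate_value_Icc' hx.1 (w.divX.continuous.continuousOn)
    (⟨hle, by rw [h0]; exact zero_le_one⟩ : (0 : ℝ) ∈ Set.Icc (w.divX.eval x) (w.divX.eval 0))
  exact hne y ⟨hy.1, hy.2.trans hx.2⟩ hy0

theorem eval_eq_mul_divX {w : Polynomial ℝ} (hw : w.coeff 0 = 0) (x : ℝ) :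
    w.eval x = x * w.divX.eval x := by
  conv_lhs => rw [← Polynomial.divX_mul_X_add w, hw]
  simp [mul_comm]

theorem image_pullback {n₁ m : ℕ} (hn₁ : 0 < n₁) (hm : 0 < m) {w : Polynomial ℝ}
    (hpos : ∀ x ∈ Set.Ioc (0 : ℝ) 1, 0 < w.eval x) :
    (fun p : ℝ × ℝ => (p.1 ^ m, w.eval p.1 ^ n₁ * (1 - p.2) ^ n₁)) ''
      Set.Ioc 0 1 ×ˢ Set.Ico 0 1 = domainY n₁ m w ∩ {p | 0 < p.1 ∧ 0 < p.2} := by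
  ext ⟨x, y⟩
  simp only [Set.mem_image, Set.mem_prod, Set.mem_inter_iff, Prod.mk.injEq, Prod.exists,
    Set.mem_ofPred_eq, domainY, curveY]
  constructor
  · rintro ⟨X, t, ⟨hX, ht⟩, rfl, rfl⟩
    have h1 := pow_pos (hpos X hX) n₁
    have h2 : 0 < (1 - t) ^ n₁ := pow_pos (by linarith [ht.2]) n₁
    rw [one_div, Real.pow_rpow_inv_natCast hX.1.le hm.ne']
    refine ⟨⟨(pow_pos hX.1 m).le, pow_le_one₀ hX.1.le hX.2, by positivity, ?_⟩, pow_pos hX.1 m,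
      by positivity⟩
    exact mul_le_of_le_one_right h1.le (pow_le_one₀ (by linarith [ht.2]) (by linarith [ht.1]))
  · rintro ⟨⟨-, hx1, -, hy1⟩, hx0, hy0⟩
    rw [one_div] at hy1
    have hX : x ^ (m : ℝ)⁻¹ ∈ Set.Ioc (0 : ℝ) 1 :=
      ⟨Real.rpow_pos_of_pos hx0 _, Real.rpow_le_one hx0.le hx1 (by positivity)⟩
    have hXm := Real.rpow_inv_natCast_pow hx0.le hm.ne'
    set X := x ^ (m : ℝ)⁻¹
    have hw := hpos X hX
    have hT : y ^ (n₁ : ℝ)⁻¹ ≤ w.eval X := by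
      refine le_of_pow_le_pow_left₀ hn₁.ne' hw.le ?_
      rwa [Real.rpow_inv_natCast_pow hy0.le hn₁.ne']
    have hT0 : 0 < y ^ (n₁ : ℝ)⁻¹ := Real.rpow_pos_of_pos hy0 _
    refine ⟨X, 1 - y ^ (n₁ : ℝ)⁻¹ / w.eval X, ⟨hX, ?_, ?_⟩, hXm, ?_⟩
    · have := (div_le_one hw).2 hT
      linarith
    · have := div_pos hT0 hw
      linarith
    · rw [sub_sub_cancel, ← mul_pow, mul_div_cancel₀ _ hw.ne',
        Real.rpow_inv_natCast_pow hy0.le hn₁.ne']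

/-- The integral over `D_Y` in the coordinates `x ↦ x^m`, `y ↦ ((1 - y) w(x))^{n₁}`. -/
theorem integral_domainY_eq {n₁ m : ℕ} (hn₁ : 0 < n₁) (hm : 0 < m) {w : Polynomial ℝ}
    (hpos : ∀ x ∈ Set.Ioc (0 : ℝ) 1, 0 < w.eval x) {g k : ℝ × ℝ → ℂ}
    (hgk : ∀ x ∈ Set.Ioo (0 : ℝ) 1, ∀ y ∈ Set.Ioo (0 : ℝ) 1,
      ((m * x ^ (m - 1) * (w.eval x ^ n₁ * (n₁ * (1 - y) ^ (n₁ - 1))) : ℝ) : ℂ) *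
        g (x ^ m, ((1 - y) * w.eval x) ^ n₁) = k (x, y))
    (hk : IntegrableOn k (Set.Ioo 0 1 ×ˢ Set.Ioo 0 1)) :
    IntegrableOn g (domainY n₁ m w) ∧
      ∫ p in domainY n₁ m w, g p = ∫ p in Set.Ioo (0 : ℝ) 1 ×ˢ Set.Ioo (0 : ℝ) 1, k p := by
  have hd : ∀ y : ℝ, HasDerivAt (fun y : ℝ => (1 - y) ^ n₁) (-(n₁ * (1 - y) ^ (n₁ - 1))) y := by
    intro y
    refine (((hasDerivAt_id y).const_sub 1).pow n₁).congr_deriv ?_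
    simp
  have hw : ∀ x : ℝ, HasDerivAt (fun x : ℝ => w.eval x ^ n₁)
      (n₁ * w.eval x ^ (n₁ - 1) * w.derivative.eval x) x := fun x =>
    (w.hasDerivAt x).pow n₁
  obtain ⟨i, e⟩ := change_of_variables (g := g) (k := k)
    (Φ := fun p : ℝ × ℝ => (p.1 ^ m, w.eval p.1 ^ n₁ * (1 - p.2) ^ n₁))
    (L := fun p => planeMap (m * p.1 ^ (m - 1)) 0
      (n₁ * w.eval p.1 ^ (n₁ - 1) * w.derivative.eval p.1 * (1 - p.2) ^ n₁)
      (w.eval p.1 ^ n₁ * (-(n₁ * (1 - p.2) ^ (n₁ - 1)))))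
    measurableSet_Ioc measurableSet_Ico Ioo_ae_eq_Ioc.symm Ioo_ae_eq_Ico.symm
    (fun p _ => hasFDerivAt_planeMap (hasFDerivAt_comp_fst (hasDerivAt_pow m p.1))
      (hasFDerivAt_mul_comp (hw p.1) (hd p.2)))
    (by
      rintro ⟨x, t⟩ ⟨hx, ht⟩ ⟨x', t'⟩ ⟨hx', ht'⟩ h
      simp only [Prod.mk.injEq] at h hx hx' ht ht' ⊢
      have hxx : x = x' := (pow_left_inj₀ hx.1.le hx'.1.le hm.ne').1 h.1
      subst hxx
      have h2 := mul_left_cancel₀ (pow_pos (hpos x hx) n₁).ne' h.2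
      have h3 := (pow_left_inj₀ (by linarith [ht.2]) (by linarith [ht'.2]) hn₁.ne').1 h2
      exact ⟨rfl, by linarith⟩)
    (by
      rintro ⟨x, y⟩ ⟨hx, hy⟩
      have h0 : 0 ≤ m * x ^ (m - 1) * (w.eval x ^ n₁ * (n₁ * (1 - y) ^ (n₁ - 1))) := by
        have h1 := hx.1
        have h2 := hpos x (Set.Ioo_subset_Ioc_self hx)
        have h3 : 0 < 1 - y := by linarith [hy.2]
        positivity
      rw [← hgk x hx y hy, det_planeMap, abs_of_nonpos, Complex.real_smul]
      · rw [mul_pow, mul_comm ((1 - y) ^ n₁)]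
        push_cast
        ring
      · simp only [zero_mul, sub_zero]
        linarith) hk
  rw [image_pullback hn₁ hm hpos] at i e
  rw [integrableOn_congr_set_ae (domainY_ae_eq n₁ m w)] at i
  rw [setIntegral_congr_set (domainY_ae_eq n₁ m w)] at e
  exact ⟨i, e⟩

/-! ### The zeta integral in the charts -/

section Assembly

variable {n₁ m n₂ q : ℕ} {f h₁ h₂ : MvPolynomial (Fin 2) ℝ} {a b : ℕ} {w : Polynomial ℝ}

theorem IsTypeMinus.eval_pos (hf : IsTypeMinus n₁ m n₂ q f h₁ h₂ a b w) (hn₁ : 0 < n₁)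
    (hm : 0 < m) {x : ℝ} (hx : x ∈ Set.Ioc (0 : ℝ) 1) : 0 < w.eval x := by
  rw [eval_eq_mul_divX hf.w_zero]
  exact mul_pos hx.1 (eval_divX_pos hn₁ hm hf.w_zero hf.w_one hf.Y_pos x ⟨hx.1.le, hx.2⟩)

theorem IsTypeMinus.eval_pullback_pos (hf : IsTypeMinus n₁ m n₂ q f h₁ h₂ a b w) (hn₁ : 0 < n₁)
    (hm : 0 < m) {x y : ℝ} (hx : x ∈ Set.Ioc (0 : ℝ) 1) (hy : y ∈ Set.Icc (0 : ℝ) 1) :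
    0 < MvPolynomial.eval ![x, y] (pullback n₁ m w f) := by
  have hw := hf.eval_pos hn₁ hm hx
  have hxm := pow_pos hx.1 m
  have hy' : 0 ≤ 1 - y := by linarith [hy.2]
  rw [eval_pullback]
  refine hf.f_pos (x ^ m, ((1 - y) * w.eval x) ^ n₁)
    ⟨hxm.le, pow_le_one₀ hx.1.le hx.2, by positivity, ?_⟩ fun h => hxm.ne' (Prod.mk.inj h).1
  rw [curveY, one_div, Real.pow_rpow_inv_natCast hx.1.le hm.ne']
  exact pow_le_pow_left₀ (by positivity)
    (mul_le_of_le_one_left hw.le (by linarith [hy.1])) n₁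

/-- The quotient of the pulled back `f` by a power of `X` is positive in the lower chart. -/
theorem IsTypeMinus.chartLower_pos (hf : IsTypeMinus n₁ m n₂ q f h₁ h₂ a b w) (hn₁ : 0 < n₁)
    (hm : 0 < m) {N : ℕ} {c : ℝ} (hc : 0 < c) {P : MvPolynomial (Fin 2) ℝ}
    (hP : chartLower n₂ q (pullback n₁ m w f) = MvPolynomial.X 0 ^ N * P)
    (hP0 : ∀ t, MvPolynomial.eval ![0, t] P = 1 + c * t ^ n₂) :
    ∀ x ∈ Set.Icc (0 : ℝ) 1, ∀ t ∈ Set.Icc (0 : ℝ) 1, 0 < MvPolynomial.eval ![x, t] P := by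
  intro x hx t ht
  rcases hx.1.eq_or_lt with rfl | hx0
  · rw [hP0]
    have := pow_nonneg ht.1 n₂
    positivity
  · have h := congrArg (MvPolynomial.eval ![x, t]) hP
    have hpos := hf.eval_pullback_pos hn₁ hm (x := x ^ n₂) (y := x ^ q * t)
      ⟨pow_pos hx0 _, pow_le_one₀ hx.1 hx.2⟩
      ⟨mul_nonneg (pow_nonneg hx.1 q) ht.1,
        mul_le_one₀ (pow_le_one₀ hx.1 hx.2) ht.1 ht.2⟩
    rw [eval_chartLower] at h
    simp only [map_mul, map_pow, MvPolynomial.eval_X, Matrix.cons_val_zero] at h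
    rw [h] at hpos
    exact pos_of_mul_pos_right hpos (pow_nonneg hx.1 N)

/-- The quotient of the pulled back `f` by a monomial is positive in the upper chart. -/
theorem IsTypeMinus.chartUpper_pos (hf : IsTypeMinus n₁ m n₂ q f h₁ h₂ a b w) (hn₁ : 0 < n₁)
    (hm : 0 < m) {N M : ℕ} {c : ℝ} (hc : 0 < c) {Q : MvPolynomial (Fin 2) ℝ}
    (hQ : chartUpper n₂ q (pullback n₁ m w f) = MvPolynomial.X 0 ^ N * MvPolynomial.X 1 ^ M * Q)
    (hQ0 : ∀ t, MvPolynomial.eval ![0, t] Q = c + t ^ q)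
    (hQ1 : ∀ x, x ^ (n₂ * q) * MvPolynomial.eval ![x, 0] Q =
      (1 - (1 - x ^ q) ^ (m * n₁)) ^ n₂) :
    ∀ x ∈ Set.Icc (0 : ℝ) 1, ∀ t ∈ Set.Icc (0 : ℝ) 1, 0 < MvPolynomial.eval ![x, t] Q := by
  intro x hx t ht
  rcases hx.1.eq_or_lt with rfl | hx0
  · rw [hQ0]
    have := pow_nonneg ht.1 q
    positivity
  have hxq0 := pow_pos hx0 q
  have hxq1 := pow_le_one₀ hx.1 hx.2 (n := q)
  -- the pullback of `f` vanishes on `T = 0`, where the positivity of `Q` has to be read off from `hQ1`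
  rcases ht.1.eq_or_lt with rfl | ht0
  · have h1 : (1 - x ^ q) ^ (m * n₁) < 1 :=
      pow_lt_one₀ (by linarith) (by linarith) (Nat.mul_pos hm hn₁).ne'
    have h2 : 0 < (1 - (1 - x ^ q) ^ (m * n₁)) ^ n₂ := pow_pos (by linarith) n₂
    rw [← hQ1] at h2
    exact pos_of_mul_pos_right h2 (pow_nonneg hx.1 _)
  · have h := congrArg (MvPolynomial.eval ![x, t]) hQ
    have hpos := hf.eval_pullback_pos hn₁ hm (x := x ^ n₂ * t) (y := x ^ q)
      ⟨mul_pos (pow_pos hx0 _) ht0, mul_le_one₀ (pow_le_one₀ hx.1 hx.2) ht.1 ht.2⟩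
      ⟨hxq0.le, hxq1⟩
    rw [eval_chartUpper] at h
    simp only [map_mul, map_pow, MvPolynomial.eval_X, Matrix.cons_val_zero,
      Matrix.cons_val_one] at h
    rw [h] at hpos
    exact pos_of_mul_pos_right hpos (mul_nonneg (pow_nonneg hx.1 N) (pow_nonneg ht.1 M))

/-- The integrand of `ℐ` times the Jacobian, in the coordinates `x ↦ x^m`,
`y ↦ ((1 - y) w(x))^{n₁}`. -/
theorem exists_integrand_eq (hm : 0 < m) (hn₁ : 0 < n₁) (hmn : Nat.Coprime m n₁)
    (hf : IsTypeMinus n₁ m n₂ q f h₁ h₂ a b w) (β₁ β₂ β₃ : ℕ) :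
    ∃ H : MvPolynomial (Fin 2) ℂ, MvPolynomial.eval ![0, 0] H = (-((m : ℂ) * n₁)) ^ β₃ ∧
      ∀ s : ℂ, ∀ x ∈ Set.Ioo (0 : ℝ) 1, ∀ y ∈ Set.Ioo (0 : ℝ) 1,
        ((m * x ^ (m - 1) * (w.eval x ^ n₁ * (n₁ * (1 - y) ^ (n₁ - 1))) : ℝ) : ℂ) *
          integrand n₁ m f w (β₁ + 1) (β₂ + 1) β₃ s (x ^ m, ((1 - y) * w.eval x) ^ n₁) =
        m * n₁ * (((MvPolynomial.eval ![x, y] (pullback n₁ m w f) : ℝ) : ℂ) ^ s *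
          (x : ℂ) ^ (m * (β₁ + 1) + n₁ * (β₂ + 1) + m * n₁ * β₃ - 1) * (y : ℂ) ^ β₃ *
          MvPolynomial.eval ![(x : ℂ), (y : ℂ)] H) := by
  obtain ⟨G, hG, hG0⟩ := exists_gY_eq hm hmn hf.w_zero hf.w_one
  have hW : ∀ x y : ℂ, MvPolynomial.eval ![x, y]
      (Polynomial.aeval (MvPolynomial.X 0 : MvPolynomial (Fin 2) ℂ) w.divX) =
      Polynomial.aeval x w.divX := by
    intro x y
    rw [eval_polynomial_aeval]
    simp
  refine ⟨(1 - MvPolynomial.X 1) ^ (n₁ * β₂ + (n₁ - 1)) *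
    Polynomial.aeval (MvPolynomial.X 0) w.divX ^ (n₁ * (β₂ + 1)) * G ^ β₃, ?_, ?_⟩
  · have h0 : Polynomial.aeval (0 : ℂ) w.divX = 1 := by
      rw [← Polynomial.coeff_zero_eq_aeval_zero']
      simp [Polynomial.coeff_divX, hf.w_one]
    simp only [map_mul, map_pow, hW, h0, hG0]
    simp
  · intro s x hx y hy
    have hx0 : (x : ℂ) ≠ 0 := by exact_mod_cast hx.1.ne'
    have hw0 : ((w.eval x : ℝ) : ℂ) ≠ 0 := by
      exact_mod_cast (hf.eval_pos hn₁ hm (Set.Ioo_subset_Ioc_self hx)).ne'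
    have hy0 : (1 : ℂ) - (y : ℂ) ≠ 0 := by
      have : (1 - y : ℝ) ≠ 0 := by linarith [hy.2]
      exact_mod_cast this
    have hW' : ((w.eval x : ℝ) : ℂ) = x * Polynomial.aeval (x : ℂ) w.divX := by
      rw [eval_eq_mul_divX hf.w_zero, Complex.ofReal_mul]
      congr 1
      rw [← Complex.coe_algebraMap, Polynomial.aeval_algebraMap_apply]
      simp
    -- `m = d + 1` and `n₁ = e + 1` remove the truncated subtractions from the exponents
    obtain ⟨d, rfl⟩ := Nat.exists_eq_succ_of_ne_zero hm.ne'
    obtain ⟨e, rfl⟩ := Nat.exists_eq_succ_of_ne_zero hn₁.ne'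
    have hexp : (d + 1) * (β₁ + 1) + (e + 1) * (β₂ + 1) + (d + 1) * (e + 1) * β₃ - 1 =
        d + (d + 1) * β₁ + (e + 1) * (β₂ + 1) + (d + 1) * (e + 1) * β₃ := by
      rw [Nat.sub_eq_iff_eq_add (Nat.succ_le_of_lt (by positivity))]
      ring
    rw [eval_pullback]
    simp only [integrand, hG x y hx.1.le, map_mul, map_pow, map_sub, map_one,
      MvPolynomial.eval_X, hW, Nat.succ_eq_add_one, hexp, Nat.add_sub_cancel, Matrix.cons_val_one]
    generalize ((MvPolynomial.eval _ f : ℝ) : ℂ) ^ s = F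
    push_cast
    simp only [hW'] at hw0 ⊢
    generalize Polynomial.aeval (x : ℂ) w.divX = W at *
    generalize MvPolynomial.eval ![(x : ℂ), (y : ℂ)] G = g at *
    have hW0 : W ≠ 0 := right_ne_zero_of_mul hw0
    generalize (1 : ℂ) - (y : ℂ) = z at *
    field_simp
    ring

theorem ofReal_pow_mul_cpow {x p : ℝ} (hx : 0 < x) (hp : 0 < p) (N : ℕ) (s : ℂ) :
    ((x ^ N * p : ℝ) : ℂ) ^ s = (x : ℂ) ^ (N * s) * (p : ℂ) ^ s := by
  rw [Complex.ofReal_mul, Complex.mul_cpow_ofReal_nonneg (pow_pos hx N).le hp.le,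
    ofReal_cpow_eq_exp (pow_pos hx N), ofReal_cpow_eq_exp hx, Real.log_pow]
  push_cast
  ring_nf

theorem cpow_mul_pow {x : ℂ} (hx : x ≠ 0) (z : ℂ) (k : ℕ) : x ^ z * x ^ k = x ^ (z + k) := by
  rw [Complex.cpow_add _ _ hx, Complex.cpow_natCast]

/-- In the coordinates of the two charts, `ℐ` is a sum of two integrals over the unit square of a
positive function to the power `s` times complex powers of the coordinates; their regularised
continuations are entire, and at a zero of the exponent of `X` they are one-dimensional integrals
along the exceptional curve `X = 0`. -/
theorem exists_regularization (hn₁ : 0 < n₁) (hm : 0 < m) (hmn : Nat.Coprime m n₁)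
    (hn₂ : 0 < n₂) (hq : 0 < q) (hf : IsTypeMinus n₁ m n₂ q f h₁ h₂ a b w)
    {β₁ β₂ β₃ B : ℕ} (hβ₁ : 0 < β₁) (hβ₂ : 0 < β₂)
    (hB : B = m * β₁ + n₁ * β₂ + m * n₁ * β₃) {z₁ z₂ : ℂ → ℂ}
    (hz₁ : ∀ s, z₁ s = (n₂ * (m * n₁ * n₂ + q) : ℕ) * s + (n₂ * B + q * (β₃ + 1) : ℕ))
    (hz₂ : ∀ s, z₂ s = (m * n₁ * n₂ : ℕ) * s + B) :
    ∃ E₁ E₂ : ℂ → ℂ, Differentiable ℂ E₁ ∧ Differentiable ℂ E₂ ∧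
      (∀ s : ℂ, 0 < s.re → IntegrableOn (integrand n₁ m f w β₁ β₂ β₃ s) (domainY n₁ m w) ∧
        integralI n₁ m f w β₁ β₂ β₃ s = m * n₁ * (Complex.Gamma (z₁ s) *
          (n₂ * (Complex.Gamma (β₃ + 1) * E₁ s) + q * (Complex.Gamma (z₂ s) * E₂ s)))) ∧
      ∀ s, z₁ s = 0 → ∃ k₁ k₂ : ℕ → ℝ → ℂ, IsDerivSeq k₁ ∧ IsDerivSeq k₂ ∧
        (∀ t : ℝ, k₁ 0 t = ((1 + ((m : ℝ) * n₁) ^ n₂ * t ^ n₂ : ℝ) : ℂ) ^ s *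
          (-((m : ℂ) * n₁)) ^ β₃) ∧
        (∀ t : ℝ, k₂ 0 t = ((((m : ℝ) * n₁) ^ n₂ + t ^ q : ℝ) : ℂ) ^ s *
          (-((m : ℂ) * n₁)) ^ β₃) ∧
        E₁ s = regInt k₁ (β₃ + 1) ∧ E₂ s = regInt k₂ (z₂ s) := by
  obtain ⟨b₁, rfl⟩ := Nat.exists_eq_succ_of_ne_zero hβ₁.ne'
  obtain ⟨b₂, rfl⟩ := Nat.exists_eq_succ_of_ne_zero hβ₂.ne'
  obtain ⟨H, hH0, hH⟩ := exists_integrand_eq hm hn₁ hmn hf b₁ b₂ β₃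
  have hB0 : 0 < B := by rw [hB]; positivity
  simp only [Nat.succ_eq_add_one, ← hB] at hH ⊢
  obtain ⟨P, hP, hP0⟩ := exists_chartLower hn₂ hq hf
  obtain ⟨Q, hQ, hQ0, hQ1⟩ := exists_chartUpper hn₁ hm hmn hn₂ hq hf
  have hc : 0 < ((m : ℝ) * n₁) ^ n₂ := by positivity
  have hPpos := hf.chartLower_pos hn₁ hm hc hP hP0
  have hQpos := hf.chartUpper_pos hn₁ hm hc hQ hQ0 hQ1
  let H₁ : MvPolynomial (Fin 2) ℂ :=
    MvPolynomial.aeval ![MvPolynomial.X 0 ^ n₂, MvPolynomial.X 0 ^ q * MvPolynomial.X 1] H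
  let H₂ : MvPolynomial (Fin 2) ℂ :=
    MvPolynomial.aeval ![MvPolynomial.X 0 ^ n₂ * MvPolynomial.X 1, MvPolynomial.X 0 ^ q] H
  have hH₁ : ∀ x t : ℂ, MvPolynomial.eval ![x, t] H₁ =
      MvPolynomial.eval ![x ^ n₂, x ^ q * t] H := by
    intro x t
    simp only [H₁, eval_aeval_fin_two]
    simp
  have hH₂ : ∀ x t : ℂ, MvPolynomial.eval ![x, t] H₂ =
      MvPolynomial.eval ![x ^ n₂ * t, x ^ q] H := by
    intro x t
    simp only [H₂, eval_aeval_fin_two]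
    simp
  have hd₁ : Differentiable ℂ z₁ := by
    rw [funext hz₁]
    fun_prop
  have hd₂ : Differentiable ℂ z₂ := by
    rw [funext hz₂]
    fun_prop
  obtain ⟨E₁, hE₁, hI₁, hR₁⟩ := exists_entire_squareIntegrand H₁ hPpos hd₁
    (differentiable_const ((β₃ : ℂ) + 1))
  obtain ⟨E₂, hE₂, hI₂, hR₂⟩ := exists_entire_squareIntegrand H₂ hQpos hd₁ hd₂
  refine ⟨E₁, E₂, hE₁, hE₂, fun s hs => ?_, fun s hs => ?_⟩
  · have hz₁s : 0 < (z₁ s).re := by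
      rw [hz₁]
      have h1 : (0 : ℝ) < (n₂ * (m * n₁ * n₂ + q) : ℕ) := by positivity
      have h2 : (0 : ℝ) < (n₂ * B + q * (β₃ + 1) : ℕ) := by positivity
      simp only [Complex.add_re, Complex.mul_re, Complex.natCast_re, Complex.natCast_im, zero_mul,
        sub_zero]
      positivity
    have hz₂s : 0 < (z₂ s).re := by
      rw [hz₂]
      have h1 : (0 : ℝ) < (m * n₁ * n₂ : ℕ) := by positivity
      have h2 : (0 : ℝ) < B := by positivity
      simp only [Complex.add_re, Complex.mul_re, Complex.natCast_re, Complex.natCast_im, zero_mul,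
        sub_zero]
      positivity
    obtain ⟨i₁, e₁⟩ := hI₁ s hz₁s (by simp; positivity)
    obtain ⟨i₂, e₂⟩ := hI₂ s hz₁s hz₂s
    let g : ℝ × ℝ → ℂ := fun p => m * n₁ *
      (((MvPolynomial.eval ![p.1, p.2] (pullback n₁ m w f) : ℝ) : ℂ) ^ s *
        (p.1 : ℂ) ^ (B - 1) * (p.2 : ℂ) ^ β₃ * MvPolynomial.eval ![(p.1 : ℂ), (p.2 : ℂ)] H)
    obtain ⟨ig, eg⟩ := integral_square_eq_charts hn₂ hq (g := g)
      (k₁ := fun p => (m * n₁ * n₂ : ℂ) * squareIntegrand P H₁ (z₁ s) (β₃ + 1) s p)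
      (k₂ := fun p => (m * n₁ * q : ℂ) * squareIntegrand Q H₂ (z₁ s) (z₂ s) s p)
      (by
        intro x hx t ht
        have hP' := congrArg (MvPolynomial.eval ![x, t]) hP
        rw [eval_chartLower] at hP'
        simp only [map_mul, map_pow, MvPolynomial.eval_X, Matrix.cons_val_zero] at hP'
        have hx0 : (x : ℂ) ≠ 0 := by exact_mod_cast hx.1.ne'
        have hexp : z₁ s - 1 = (n₂ * (m * n₁ * n₂ + q) : ℕ) * s +
            (n₂ - 1 + q + n₂ * (B - 1) + q * β₃ : ℕ) := by
          rw [hz₁]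
          push_cast [Nat.cast_sub hn₂, Nat.cast_sub hB0]
          ring
        simp only [g, squareIntegrand, hP', hH₁, hexp]
        rw [ofReal_pow_mul_cpow hx.1 (hPpos x ⟨hx.1.le, hx.2.le⟩ t ⟨ht.1.le, ht.2.le⟩),
          ← cpow_mul_pow hx0, add_sub_cancel_right, Complex.cpow_natCast]
        push_cast
        ring)
      (by
        intro x hx t ht
        have hQ' := congrArg (MvPolynomial.eval ![x, t]) hQ
        rw [eval_chartUpper] at hQ'
        simp only [map_mul, map_pow, MvPolynomial.eval_X, Matrix.cons_val_zero,
          Matrix.cons_val_one] at hQ'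
        have hx0 : (x : ℂ) ≠ 0 := by exact_mod_cast hx.1.ne'
        have ht0 : (t : ℂ) ≠ 0 := by exact_mod_cast ht.1.ne'
        have hexp : z₁ s - 1 = (n₂ * (m * n₁ * n₂ + q) : ℕ) * s +
            (q - 1 + n₂ + n₂ * (B - 1) + q * β₃ : ℕ) := by
          rw [hz₁]
          push_cast [Nat.cast_sub (show 1 ≤ q from hq), Nat.cast_sub hB0]
          ring
        have hexp' : z₂ s - 1 = (m * n₁ * n₂ : ℕ) * s + (B - 1 : ℕ) := by
          rw [hz₂]
          push_cast [Nat.cast_sub hB0]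
          ring
        have hQt := hQpos x ⟨hx.1.le, hx.2.le⟩ t ⟨ht.1.le, ht.2.le⟩
        simp only [g, squareIntegrand, hQ', hH₂, hexp, hexp']
        rw [mul_assoc (x ^ _) (t ^ _), ofReal_pow_mul_cpow hx.1 (mul_pos (pow_pos ht.1 _) hQt),
          ofReal_pow_mul_cpow ht.1 hQt, ← cpow_mul_pow hx0, ← cpow_mul_pow ht0]
        push_cast
        ring)
      (i₁.const_mul _) (i₂.const_mul _)
    obtain ⟨ii, ei⟩ := integral_domainY_eq hn₁ hm
      (fun x hx => hf.eval_pos hn₁ hm hx) (g := integrand n₁ m f w (b₁ + 1) (b₂ + 1) β₃ s)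
      (fun x hx y hy => hH s x hx y hy) ig
    refine ⟨ii, ?_⟩
    rw [integralI, ei, eg, integral_const_mul, integral_const_mul, e₁, e₂]
    ring
  · obtain ⟨k₁, hk₁, hk₁0, hk₁E⟩ := hR₁ s hs
    obtain ⟨k₂, hk₂, hk₂0, hk₂E⟩ := hR₂ s hs
    refine ⟨k₁, k₂, hk₁, hk₂, fun t => ?_, fun t => ?_, hk₁E, hk₂E⟩
    · rw [hk₁0, hP0, hH₁, zero_pow hn₂.ne', zero_pow hq.ne', zero_mul, hH0]
    · rw [hk₂0, hQ0, hH₂, zero_pow hn₂.ne', zero_pow hq.ne', zero_mul, hH0]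

end Assembly

/-! ### The pole and its residue -/

theorem meromorphicOn_Gamma_comp_affine (N C : ℂ) :
    MeromorphicOn (fun s => Complex.Gamma (N * s + C)) Set.univ := fun _ _ =>
  (Meromorphic.Gamma _).comp_analyticAt (by fun_prop)

/-- A function `Γ(N s + C) K(s)` has at the zero of `N s + C` a simple pole with residue
`K / N`. -/
theorem tendsto_mul_Gamma_affine {N C α : ℂ} (hN : N ≠ 0) (hα : N * α + C = 0) {K : ℂ → ℂ}
    (hK : ContinuousAt K α) :
    Tendsto (fun s => (s - α) * (Complex.Gamma (N * s + C) * K s)) (𝓝[≠] α) (𝓝 (1 / N * K α)) := by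
  have h1 : Tendsto (fun s => N * s + C) (𝓝[≠] α) (𝓝[≠] 0) := by
    refine tendsto_nhdsWithin_iff.2 ⟨?_, ?_⟩
    · rw [← hα]
      have h : Continuous fun s => N * s + C := by fun_prop
      exact (h.tendsto α).mono_left nhdsWithin_le_nhds
    · filter_upwards [self_mem_nhdsWithin] with s hs h
      have h' : N * s + C = 0 := h
      exact hs (mul_left_cancel₀ hN (by linear_combination h' - hα))
  have h2 := ((Complex.tendsto_self_mul_Gamma_nhds_zero.comp h1).div_const N).mul
    (hK.tendsto.mono_left nhdsWithin_le_nhds)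
  refine h2.congr fun s => ?_
  have h3 : N * s + C = N * (s - α) := by linear_combination hα
  simp only [Function.comp_apply]
  rw [h3]
  field_simp

theorem meromorphicOrderAt_eq_neg_one {F : ℂ → ℂ} {α r : ℂ} (hF : MeromorphicAt F α) (hr : r ≠ 0)
    (h : Tendsto (fun s => (s - α) * F s) (𝓝[≠] α) (𝓝 r)) : meromorphicOrderAt F α = -1 := by
  have hid : MeromorphicAt (fun s : ℂ => s - α) α := by fun_prop
  have h1 : meromorphicOrderAt (fun s : ℂ => s - α) α = 1 := by
    refine (meromorphicOrderAt_eq_int_iff (n := 1) hid).2 ⟨fun _ => 1, analyticAt_const,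
      one_ne_zero, ?_⟩
    simp
  have h2 := (tendsto_ne_zero_iff_meromorphicOrderAt_eq_zero (hid.mul hF)).1 ⟨r, hr, h⟩
  rw [meromorphicOrderAt_mul hid hF, h1] at h2
  cases ho : meromorphicOrderAt F α with
  | top => simp [ho] at h2
  | coe o =>
    rw [ho] at h2
    have h3 : 1 + o = 0 := by exact_mod_cast h2
    rw [show o = -1 by omega]
    rfl

end TwoPuiseux

end

theorem mainTheorem5 (n₁ m n₂ q : ℕ)
    (hn₁ : 1 < n₁) (hm : n₁ < m) (hmn : Nat.gcd m n₁ = 1)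
    (hq : 0 < q) (hn₂ : 1 < n₂) (hqn : Nat.gcd q n₂ = 1)
    (f h₁ h₂ : MvPolynomial (Fin 2) ℝ) (a b : ℕ) (w : Polynomial ℝ)
    (hf : TwoPuiseux.IsTypeMinus n₁ m n₂ q f h₁ h₂ a b w)
    (β₁ β₂ β₃ : ℕ) (hβ₁ : 1 ≤ β₁) (hβ₂ : 1 ≤ β₂)
    (α : ℚ) (hα : α ∈ TwoPuiseux.A21 n₁ m n₂ q)
    (hαβ : α = -((n₂ : ℚ) * (β₁ * m + β₂ * n₁) + β₃ * (m * n₁ * n₂ + q) + q) /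
      (n₂ * (m * n₁ * n₂ + q)))
    (hres : ∀ ν : ℕ, α ≠ -((m : ℚ) * β₁ + n₁ * β₂ + m * n₁ * β₃ + ν) / (m * n₁ * n₂)) :
    ∃ F : ℂ → ℂ, TwoPuiseux.IsMeromorphicContinuation n₁ m f w β₁ β₂ β₃ F ∧
      meromorphicOrderAt F (α : ℂ) = -1 ∧
      Tendsto (fun s : ℂ => (s - (α : ℂ)) * F s) (𝓝[≠] (α : ℂ))
        (𝓝 ((-1) ^ β₃ * (1 / ((n₂ : ℂ) * (m * n₁ * n₂ + q))) *
          TwoPuiseux.betaFn ((β₃ + 1) / n₂) (-(α : ℂ) - (β₃ + 1) / n₂))) := by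
  have hD : 0 < m * n₁ * n₂ + q := by positivity
  have hm0 : 0 < m := by omega
  have hn0 : 0 < n₁ := by omega
  have hn₂0 : 0 < n₂ := by omega
  -- The exponents of `X` in both charts and of `T` in the upper chart.
  let z₁ : ℂ → ℂ := fun s => (n₂ * (m * n₁ * n₂ + q) : ℕ) * s +
    (n₂ * (m * β₁ + n₁ * β₂ + m * n₁ * β₃) + q * (β₃ + 1) : ℕ)
  let z₂ : ℂ → ℂ := fun s => (m * n₁ * n₂ : ℕ) * s + (m * β₁ + n₁ * β₂ + m * n₁ * β₃ : ℕ)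
  obtain ⟨E₁, E₂, hE₁, hE₂, hI, hR⟩ := TwoPuiseux.exists_regularization (β₃ := β₃) (z₁ := z₁)
    (z₂ := z₂) hn0 hm0 hmn hn₂0 hq hf hβ₁ hβ₂ rfl (fun _ => rfl) (fun _ => rfl)
  -- `K` is the factor of `Γ(z₁)` in the continuation `F`.
  let K : ℂ → ℂ := fun s =>
    m * n₁ * (n₂ * (Complex.Gamma (β₃ + 1) * E₁ s) + q * (Complex.Gamma (z₂ s) * E₂ s))
  let F : ℂ → ℂ := fun s => Complex.Gamma (z₁ s) * K s
  set u : ℂ := (β₃ + 1) / n₂ with hu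
  set v : ℂ := -(α : ℂ) - u with hv
  -- The real number `v` is `(m β₁ + n₁ β₂ - m n₁) / D`.
  let v' : ℝ := (m * β₁ + n₁ * β₂ - m * n₁) / (m * n₁ * n₂ + q)
  have hDℂ : ((m : ℂ) * n₁ * n₂ + q) ≠ 0 := by exact_mod_cast hD.ne'
  have hDℝ : (0 : ℝ) < (m : ℝ) * n₁ * n₂ + q := by exact_mod_cast hD
  have hn₂ℂ : (n₂ : ℂ) ≠ 0 := by exact_mod_cast hn₂0.ne'
  have hn₁ℂ : (n₁ : ℂ) ≠ 0 := by exact_mod_cast hn0.ne'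
  have hmℂ : (m : ℂ) ≠ 0 := by exact_mod_cast hm0.ne'
  have hqℂ : (q : ℂ) ≠ 0 := by exact_mod_cast hq.ne'
  have hαℂ : (α : ℂ) = -((n₂ : ℂ) * (β₁ * m + β₂ * n₁) + β₃ * (m * n₁ * n₂ + q) + q) /
      (n₂ * (m * n₁ * n₂ + q)) := by
    rw [hαβ]
    push_cast
    rfl
  have hαD : (n₂ : ℂ) * (m * n₁ * n₂ + q) * α =
      -((n₂ : ℂ) * (β₁ * m + β₂ * n₁) + β₃ * (m * n₁ * n₂ + q) + q) := by
    rw [hαℂ, mul_div_cancel₀ _ (mul_ne_zero hn₂ℂ hDℂ)]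
  have hnu : (n₂ : ℂ) * u = β₃ + 1 := by
    rw [hu]
    field_simp
  have hvv : v = v' := by
    simp only [v']
    push_cast
    rw [eq_div_iff hDℂ]
    apply mul_left_cancel₀ hn₂ℂ
    rw [hv]
    linear_combination -hαD - (m * n₁ * n₂ + q) * hnu
  have hz₁α : z₁ α = 0 := by
    simp only [z₁]
    push_cast
    linear_combination hαD
  have hqv : z₂ α = q * v := by
    rw [hvv]
    simp only [z₂, hαℂ, v']
    push_cast
    field_simp
    ring
  have hqvν : ∀ ν : ℕ, (q : ℂ) * v ≠ -ν := by
    intro ν h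
    apply hres ν
    rw [← hqv] at h
    have h1 : (m : ℚ) * n₁ * n₂ * α + (m * β₁ + n₁ * β₂ + m * n₁ * β₃) = -ν := by
      simp only [z₂] at h
      exact_mod_cast h
    have h2 : (m : ℚ) * n₁ * n₂ ≠ 0 := by positivity
    rw [eq_div_iff h2]
    linear_combination h1
  have hure : 0 < u.re := by
    have h1 : u = ((((β₃ : ℝ) + 1) / n₂ : ℝ) : ℂ) := by
      rw [hu]
      push_cast
      rfl
    rw [h1, Complex.ofReal_re]
    positivity
  have hvre : -1 < v.re := by
    have h1 : (0 : ℝ) < (m : ℝ) * n₁ * (n₂ - 1) := by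
      have : (0 : ℝ) < (n₂ : ℝ) - 1 := by
        have : (1 : ℝ) < n₂ := by exact_mod_cast hn₂
        linarith
      positivity
    have h2 : (0 : ℝ) ≤ (m : ℝ) * β₁ + n₁ * β₂ := by positivity
    have h3 : (0 : ℝ) < q := by exact_mod_cast hq
    rw [hvv, Complex.ofReal_re]
    simp only [v']
    rw [lt_div_iff₀ hDℝ]
    linarith
  have huvre : 0 < (u + v).re := by
    have h1 : u + v = (((n₂ * (β₁ * m + β₂ * n₁) + β₃ * (m * n₁ * n₂ + q) + q) /
        (n₂ * (m * n₁ * n₂ + q)) : ℝ) : ℂ) := by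
      rw [hv, add_sub_cancel, hαℂ]
      push_cast
      ring
    rw [h1, Complex.ofReal_re]
    positivity
  -- The residue of `Γ(z₁)` is the inverse of the slope of `z₁`.
  have hN : ((n₂ * (m * n₁ * n₂ + q) : ℕ) : ℂ) ≠ 0 := by exact_mod_cast (by positivity)
  have hGz₂ : DifferentiableAt ℂ (fun s => Complex.Gamma (z₂ s)) (α : ℂ) := by
    have h1 : DifferentiableAt ℂ z₂ (α : ℂ) := by fun_prop
    refine DifferentiableAt.comp (α : ℂ) (Complex.differentiableAt_Gamma _ fun ν => ?_) h1
    rw [hqv]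
    exact hqvν ν
  have hK : ContinuousAt K (α : ℂ) := by
    have h1 := (hE₁ (α : ℂ)).continuousAt
    have h2 := (hE₂ (α : ℂ)).continuousAt
    have h3 := hGz₂.continuousAt
    fun_prop
  have hlim : Tendsto (fun s => (s - (α : ℂ)) * F s) (𝓝[≠] (α : ℂ)) _ :=
    TwoPuiseux.tendsto_mul_Gamma_affine hN hz₁α hK
  obtain ⟨k₁, k₂, hk₁, hk₂, hk₁0, hk₂0, hk₁E, hk₂E⟩ := hR α hz₁α
  -- The exponents at `α` are `β₃ + 1 = n₂ u` in the lower chart and `q v` in the upper one.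
  have hbeta := TwoPuiseux.residue_eq_betaFn (c := ((m : ℝ) * n₁) ^ n₂) (by positivity) hn₂0 hq
    (u := u) (v := v) (α := α) (by rw [hv]; ring) hure hvre huvre hqvν hk₁ hk₂ hk₁0 hk₂0
  have hcpow : (((((m : ℝ) * n₁) ^ n₂ : ℝ) : ℂ)) ^ (-u) = ((m : ℂ) * n₁) ^ (-((β₃ : ℂ) + 1)) := by
    have h1 : (0 : ℝ) < (m : ℝ) * n₁ := by positivity
    have h2 := TwoPuiseux.ofReal_pow_mul_cpow h1 one_pos n₂ (-u)
    rw [mul_one, Complex.ofReal_one, Complex.one_cpow, mul_one, mul_neg, hnu] at h2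
    rw [h2]
    push_cast
    rfl
  have hKα : K α = (-1) ^ β₃ * TwoPuiseux.betaFn u v := by
    have h1 : (m : ℂ) * n₁ ≠ 0 := mul_ne_zero hmℂ hn₁ℂ
    simp only [K]
    rw [hqv, hk₁E, hk₂E, hqv, ← hnu, hbeta, hcpow, Complex.cpow_neg, Complex.cpow_add _ _ h1,
      Complex.cpow_natCast, Complex.cpow_one, neg_pow]
    field_simp
  rw [hKα] at hlim
  have hB0 : TwoPuiseux.betaFn u v ≠ 0 := by
    refine div_ne_zero (mul_ne_zero (Complex.Gamma_ne_zero_of_re_pos hure)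
      (Complex.Gamma_ne_zero fun ν h => hqvν (q * ν) ?_)) (Complex.Gamma_ne_zero_of_re_pos huvre)
    rw [h]
    push_cast
    ring
  have hmero : MeromorphicOn F Set.univ := by
    have h1 : MeromorphicOn E₁ Set.univ := fun s _ => (hE₁.analyticAt s).meromorphicAt
    have h2 : MeromorphicOn E₂ Set.univ := fun s _ => (hE₂.analyticAt s).meromorphicAt
    have h3 : MeromorphicOn (fun s => Complex.Gamma (z₁ s)) Set.univ :=
      TwoPuiseux.meromorphicOn_Gamma_comp_affine _ _
    have h4 : MeromorphicOn (fun s => Complex.Gamma (z₂ s)) Set.univ :=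
      TwoPuiseux.meromorphicOn_Gamma_comp_affine _ _
    intro s hs
    have h1 := h1 s hs
    have h2 := h2 s hs
    have h3 := h3 s hs
    have h4 := h4 s hs
    fun_prop
  refine ⟨F, ⟨hmero, 0, fun s hs => ⟨(hI s hs).1, ?_⟩⟩, ?_, ?_⟩
  · rw [(hI s hs).2]
    simp only [F, K]
    ring
  · refine TwoPuiseux.meromorphicOrderAt_eq_neg_one (hmero _ (Set.mem_univ _)) ?_ hlim
    exact mul_ne_zero (one_div_ne_zero hN) (mul_ne_zero (pow_ne_zero _ (by norm_num)) hB0)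
  · convert hlim using 2
    push_cast
    ring
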